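/- **The model.** Fix $\gamma\in(2,3)$, an integer $\delta\ge1$, $\zeta\in(0,\frac1{\gamma-1}]$, $\beta\in(1,2)$, an integer $s\ge\delta+1$, $\tau\in(\zeta,1)$ and $\xi\in(0,1)$. For $n\in\mathbb N$ put $D=\lfloor n^{\zeta}\rfloor$, $S=\lfloor n^{\tau}\rfloor$, $$q_k=\frac{\int_k^{k+1}x^{-\gamma}\,dx}{\int_\delta^{D+1}x^{-\gamma}\,dx}\quad(\delta\le k\le D),\qquad d=d(n)=\sum_{k=\delta}^{D}k\,q_k .$$ The ABCD multigraph $\mathcal A$ on $V=\{1,\dots,n\}$ is generated as follows. 1. *Degrees.* $w_1,\dots,w_n$ are independent with law $(q_k)$; if their sum is odd, the degree of one node of largest degree is decreased by one. 2. *Community sizes.* Independently, sizes with law $\int_k^{k+1}x^{-\beta}dx\big/\int_s^{S+1}x^{-\beta}dx$ on $\{s,\dots,S\}$ are drawn independently until their sum is at least $n$. If the sum exceeds $n$ by $k$ and the last size is $z$, then the last size is replaced by $z-k$ if $z-k\ge s$; otherwise the last community is removed and $z-k$ of the other communities, chosen uniformly at random, grow by one. Let $c_1,\dots,c_\ell$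 be the resulting sizes and $\phi=1-\sum_k(c_k/n)^2$. 3. *Assignment.* The nodes are assigned to communities $C_1,\dots,C_\ell$ with $|C_j|=c_j$, uniformly at random among the admissible assignments, those with $\lceil(1-\xi\phi)w_v\rceil\le c_j-1$ whenever $v\in C_j$. (If step 2 or 3 is impossible, the generation fails.) 4. *Splitting.* In each community one node of largest degree is the leader. For every other node $v$, the community degree $y_v$ is $(1-\xi)w_v$ randomly rounded, independently: up with probability equal to its fractional part, down otherwise. For a leader, $(1-\xi)w_v$ is rounded up or down so that $\sum_{u\in C_j}y_u$ is even; if it is an integer and the sum is odd, then a fair coin decides whether one is added or subtracted. 5. *Edges.* $\mathcal A$ is the union of independent configuration-model multigraphs: one on each $C_j$ with degrees $(y_v)_{v\in C_j}$, and one on $V$ with degrees $(w_v-y_v)_{v\in V}$. For $A\subseteq V$ let $\mathrm{vol}(A)=\sum_{v\in A}\deg_{\mathcal A}(v)$ (loops count twice) and $\mathrm{vol}_c(A)=\sum_{v\in A}y_v$. An event holds *w.e.p.* if its probability is at least $1-\exp(-\Omega((\log n)^2))$ as $n\to\infty$. All constants implied by $\mathcal O$ and $\Omega$ depend only on $\gamma,\delta,\zeta,\beta,s,\tau,\xi$;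 in particular they are uniform over the communities. **Lemma.** A community is *small* if $|C|<(\log n)^8$, *large* if $(\log n)^8\le|C|<n^{\zeta}(\log n)^4$, and *very large* if $|C|\ge n^{\zeta}(\log n)^4$. (a) W.e.p. the degrees and the community sizes are such that an admissible assignment exists and, conditionally on them, simultaneously for all communities $C$ with $|C|\ge(\log n)^8$, $$\mathbb E[\mathrm{vol}(C)]=\bigl(1+\mathcal O((\log n)^{-(\gamma-2)})\bigr)\,d|C|,\qquad \mathbb E[\mathrm{vol}_c(C)]=\bigl(1+\mathcal O((\log n)^{-(\gamma-2)})\bigr)(1-\xi)\,d|C| .$$ Likewise, w.e.p. the community sizes are such that these estimates hold for the expectations conditional on the community sizes only (and on the generation not failing). (b) W.e.p. the generation does not fail and the following properties hold simultaneously for all communities $C$: - if $C$ is very large, then $\mathrm{vol}(C)=\bigl(1+\mathcal O((\log n)^{-(\gamma-2)})\bigr)d|C|$ and $\mathrm{vol}_c(C)=\bigl(1+\mathcal O((\log n)^{-(\gamma-2)})\bigr)(1-\xi)d|C|$; - if $C$ is large, then $\mathrm{vol}(C)=\mathcal O(n^{\zeta}(\log n)^4)$; - if $C$ is small, then $\mathrm{vol}(C)\le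 D|C|<n^{\zeta}(\log n)^8$; and moreover $\mathrm{vol}(F)=\mathcal O(n(\log n)^{-2})$, where $F$ is the union of the communities that are not very large. -/

import Mathlib

open Filter

noncomputable section

namespace ABCD

/-! ## Probability on countable spaces -/

/-- The joint law of independent random variables with laws `p 0, …, p (m - 1)`. -/
def independent {α : Type} : {m : ℕ} → (Fin m → PMF α) → PMF (Fin m → α)
  | 0, _ => PMF.pure Fin.elim0
  | _ + 1, p => (p 0).bind fun a =>
      (independent fun i => p i.succ).map fun v => (Fin.cons a v : Fin _ → α)

/-- A sequence of events `E n` holds with extreme probability under the laws `μ n`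
if its probability is at least `1 - exp (-Ω((log n)²))`. -/
def WithExtremeProbability {Ω : ℕ → Type} (μ : ∀ n, PMF (Ω n)) (E : ∀ n, Set (Ω n)) : Prop :=
  ∃ c : ℝ, 0 < c ∧ ∀ᶠ n : ℕ in atTop,
    1 - Real.exp (-(c * Real.log n ^ 2)) ≤ ((μ n).toOuterMeasure (E n)).toReal

/-- For a random experiment that may fail (`none`), the expectation of `f` conditional on the
experiment not failing. -/
def expectation {α : Type} (p : PMF (Option α)) (f : α → ℝ) : ℝ :=
  (∑' a, (p (some a)).toReal * f a) / ∑' a, (p (some a)).toReal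

/-! ## Truncated power laws -/

/-- `∫_k^{k+1} x^{-e} dx / ∫_a^{N+1} x^{-e} dx`, the probability of `k ∈ {a, …, N}` under the
truncated power law with exponent `e`, minimum `a` and maximum `N`. -/
def powerLawMass (e : ℝ) (a N k : ℕ) : ℝ :=
  (∫ x in (k : ℝ)..(k + 1 : ℕ), x ^ (-e)) / ∫ x in (a : ℝ)..(N + 1 : ℕ), x ^ (-e)

theorem sum_powerLawMass (e : ℝ) {a N : ℕ} (ha : 0 < a) (haN : a ≤ N) :
    ∑ k ∈ Finset.Icc a N, ENNReal.ofReal (powerLawMass e a N k) = 1 := by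
  have hint : ∀ {b c : ℕ}, 0 < b → b < c →
      IntervalIntegrable (fun x : ℝ => x ^ (-e)) MeasureTheory.volume b c := by
    intro b c hb hbc
    apply ContinuousOn.intervalIntegrable
    intro x hx
    rw [Set.uIcc_of_le (by exact_mod_cast hbc.le)] at hx
    have h0 : (0 : ℝ) < x := lt_of_lt_of_le (by exact_mod_cast hb) hx.1
    exact (Real.continuousAt_rpow_const x (-e) (Or.inl h0.ne')).continuousWithinAt
  have hpos : ∀ {b c : ℕ}, 0 < b → b < c → 0 < ∫ x in (b : ℝ)..c, x ^ (-e) := by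
    intro b c hb hbc
    refine intervalIntegral.intervalIntegral_pos_of_pos_on (hint hb hbc) ?_
      (by exact_mod_cast hbc)
    intro x hx
    exact Real.rpow_pos_of_pos (lt_trans (by exact_mod_cast hb) hx.1) _
  rw [← ENNReal.ofReal_sum_of_nonneg, ← ENNReal.ofReal_one]
  · congr 1
    simp only [powerLawMass]
    rw [← Finset.sum_div, div_eq_one_iff_eq (hpos ha (by omega)).ne']
    have hI : Finset.Icc a N = Finset.Ico a (N + 1) := by ext; simp
    rw [hI]
    refine intervalIntegral.sum_integral_adjacent_intervals_Ico (a := fun k : ℕ => (k : ℝ))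
      (by omega) ?_
    intro k hk
    exact hint (by have := hk.1; omega) (Nat.lt_succ_self k)
  · intro k hk
    have := (Finset.mem_Icc.mp hk).1
    exact div_nonneg (hpos (by omega) (by omega)).le (hpos ha (by omega)).le

/-- The truncated power law on `{a, …, N}` with exponent `e`
(a point mass in the degenerate cases `a = 0` and `N < a`). -/
def powerLaw (e : ℝ) (a N : ℕ) : PMF ℕ :=
  if h : 0 < a ∧ a ≤ N then
    PMF.ofFinset
      (fun k => if k ∈ Finset.Icc a N then ENNReal.ofReal (powerLawMass e a N k) else 0)
      (Finset.Icc a N)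
      (by rw [Finset.sum_congr rfl fun k hk => if_pos hk]; exact sum_powerLawMass e h.1 h.2)
      (fun _ hk => if_neg hk)
  else PMF.pure a

/-! ## Parameters -/

/-- The parameters of the model other than the number of nodes. -/
structure Params where
  /-- power-law exponent of the degree distribution -/
  γ : ℝ
  /-- minimum degree -/
  δ : ℕ
  /-- the maximum degree is at most `n ^ ζ` -/
  ζ : ℝ
  /-- power-law exponent of the community sizes -/
  β : ℝ
  /-- minimum community size -/
  s : ℕ
  /-- the community sizes are at most `n ^ τ` -/
  τ : ℝ
  /-- level of noise -/
  ξ : ℝ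

/-- `D = n ^ ζ`, rounded down. -/
def Params.maxDegree (P : Params) (n : ℕ) : ℕ := ⌊(n : ℝ) ^ P.ζ⌋₊

/-- `S = n ^ τ`, rounded down. -/
def Params.maxSize (P : Params) (n : ℕ) : ℕ := ⌊(n : ℝ) ^ P.τ⌋₊

/-- `d = ∑_{k = δ}^{D} k q_k`, the mean of the degree distribution. -/
def Params.meanDegree (P : Params) (n : ℕ) : ℝ :=
  ∑ k ∈ Finset.Icc P.δ (P.maxDegree n), (k : ℝ) * powerLawMass P.γ P.δ (P.maxDegree n) k

/-! ## Degrees -/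

open Classical in
/-- A node of `A` of the largest degree, selected arbitrarily (`none` if `A` is empty). -/
def leader {n : ℕ} (w : Fin n → ℕ) (A : Finset (Fin n)) : Option (Fin n) :=
  if h : A.Nonempty then some (A.exists_max_image w h).choose else none

/-- If the sum of the degrees is odd, decrease by one the degree of one node of the largest
degree. -/
def fixParity {n : ℕ} (w : Fin n → ℕ) : Fin n → ℕ := fun v =>
  if Odd (∑ u, w u) ∧ leader w Finset.univ = some v then w v - 1 else w v

/-- The law of the degree sequence. -/
def degreeLaw (P : Params) (n : ℕ) : PMF (Fin n → ℕ) :=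
  (independent fun _ : Fin n => powerLaw P.γ P.δ (P.maxDegree n)).map fixParity

/-! ## Community sizes -/

/-- Going through a list of sizes, the communities that are generated before the last one: those
after whose addition the sum of the sizes is still less than `n`. -/
def oldCommunities : ℕ → List ℕ → List ℕ
  | _, [] => []
  | n, x :: l => if x < n then x :: oldCommunities (n - x) l else []

/-- The law of the list of community sizes. At most `n` independent sizes are needed to reach the
sum `n`. If `old` are the communities before the last one, of size `z`, and the sum of all sizes
exceeds `n` by `k`, then `z - k = n - old.sum`. If this number is at least `s`, then it is the size
of the last community; otherwise the last community is removed and `z - k` old communities,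
selected uniformly at random, increase their sizes by one (`none` if there are not enough of
them). -/
def sizeLaw (P : Params) (n : ℕ) : PMF (Option (List ℕ)) :=
  (independent fun _ : Fin n => powerLaw P.β P.s (P.maxSize n)).bind fun X =>
    let old := oldCommunities n (List.ofFn X)
    let r := n - old.sum
    if P.s ≤ r then PMF.pure (some (old ++ [r]))
    else if h : (Finset.powersetCard r (Finset.univ : Finset (Fin old.length))).Nonempty then
      (PMF.uniformOfFinset _ h).map fun T =>
        some (List.ofFn fun j : Fin old.length => old.get j + if j ∈ T then 1 else 0)
    else PMF.pure none

/-! ## Assignment of nodes to communities -/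

/-- `φ = 1 - ∑_k (c_k / n)²`. -/
def phi (n : ℕ) (c : List ℕ) : ℝ := 1 - (c.map fun x => ((x : ℝ) / n) ^ 2).sum

open Classical in
/-- The admissible assignments of nodes with degrees `w` to communities of sizes `c`. -/
def admissible {n : ℕ} (ξ : ℝ) (w : Fin n → ℕ) (c : List ℕ) :
    Finset (Fin n → Fin c.length) :=
  Finset.univ.filter fun σ =>
    (∀ j, (Finset.univ.filter fun v => σ v = j).card = c.get j) ∧
    ∀ v, ⌈(1 - ξ * phi n c) * (w v : ℝ)⌉ ≤ (c.get (σ v) : ℤ) - 1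

/-! ## Splitting of the degrees -/

/-- The random rounding of a real number `x ≥ 0`: up with probability equal to the fractional part
of `x`, down otherwise. -/
def randomRound (x : ℝ) : PMF ℕ :=
  (PMF.ofFintype
    (fun up : Bool => ENNReal.ofReal (if up then Int.fract x else 1 - Int.fract x))
    (by
      have h1 := Int.fract_nonneg x
      have h2 := (Int.fract_lt_one x).le
      rw [Fintype.sum_bool, ← ENNReal.ofReal_add (by simp) (by simpa using h2)]
      simp)).map
    fun up => ⌊x⌋₊ + if up then 1 else 0

/-- The community degree of a leader: `x` is `(1 - ξ)` times its degree, `S` the sum of the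
community degrees of the other nodes of the community, and `coin` a coin flip. The number `x` is
rounded up or down to make the total even; if `x` is an integer and the total is odd, then the
coin decides between subtracting and adding one. -/
def leaderDegree (x : ℝ) (S : ℕ) (coin : Bool) : ℕ :=
  if Even (S + ⌊x⌋₊) then ⌊x⌋₊
  else if Int.fract x = 0 ∧ coin = false then ⌊x⌋₊ - 1
  else ⌊x⌋₊ + 1

open Classical in
/-- The community degrees, given the degrees `w`, the assignment `σ`, the rounding `R` of
`(1 - ξ) w`, and one coin flip per community. -/
def communityDegrees {n l : ℕ} (ξ : ℝ) (w : Fin n → ℕ) (σ : Fin n → Fin l)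
    (R : Fin n → ℕ) (coin : Fin l → Bool) : Fin n → ℕ := fun v =>
  let C := Finset.univ.filter fun u => σ u = σ v
  if leader w C = some v then
    leaderDegree ((1 - ξ) * w v) (∑ u ∈ C.erase v, R u) (coin (σ v))
  else R v

/-- The law of the community degrees, given the degrees and the assignment. -/
def splitLaw {n l : ℕ} (ξ : ℝ) (w : Fin n → ℕ) (σ : Fin n → Fin l) : PMF (Fin n → ℕ) :=
  (independent fun v => randomRound ((1 - ξ) * w v)).bind fun R =>
    (independent fun _ : Fin l => PMF.uniformOfFintype Bool).map fun coin =>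
      communityDegrees ξ w σ R coin

/-! ## Configuration model -/

open Classical in
/-- The pairings of a finite set of points, as sets of disjoint unordered pairs that cover all
points. -/
def pairings (Q : Type) [Fintype Q] : Finset (Finset (Sym2 Q)) :=
  Finset.univ.filter fun M =>
    (∀ e ∈ M, ¬ e.IsDiag) ∧ ∀ x : Q, ∃! e, e ∈ M ∧ x ∈ e

/-- The configuration model with degree sequence `a`: bucket `v` holds `a v` points, and every pair
of a uniformly random pairing of all points gives one edge between the buckets of its points.
The result is the multiset of edges; loops and parallel edges are allowed. (There is a pairing
exactly if the sum of `a` is even, which is always so below.) -/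
def configurationModel {n : ℕ} (a : Fin n → ℕ) : PMF (Multiset (Sym2 (Fin n))) :=
  if h : (pairings (Σ v : Fin n, Fin (a v))).Nonempty then
    (PMF.uniformOfFinset _ h).map fun M => M.val.map (Sym2.map Sigma.fst)
  else PMF.pure 0

/-! ## The ABCD graph -/

/-- A possible outcome: a multigraph on `n` nodes that is the union of `l` community graphs and a
background graph. -/
structure Graph (n l : ℕ) where
  /-- the community of each node -/
  label : Fin n → Fin l
  /-- the community degree of each node -/
  communityDegree : Fin n → ℕ
  /-- the edges of the community graphs -/
  communityEdges : Fin l → Multiset (Sym2 (Fin n))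
  /-- the edges of the background graph -/
  backgroundEdges : Multiset (Sym2 (Fin n))

namespace Graph

variable {n l : ℕ} (G : Graph n l)

/-- All edges of the graph, with multiplicities. -/
def edges : Multiset (Sym2 (Fin n)) := G.backgroundEdges + ∑ j, G.communityEdges j

/-- The degree of a node; a loop contributes two. -/
def degree (v : Fin n) : ℕ := (G.edges.bind Sym2.toMultiset).count v

/-- The community with index `j`. -/
def community (j : Fin l) : Finset (Fin n) := Finset.univ.filter fun v => G.label v = j

/-- The volume of a set of nodes. -/
def vol (A : Finset (Fin n)) : ℕ := ∑ v ∈ A, G.degree v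

/-- The community volume of a set of nodes. -/
def volC (A : Finset (Fin n)) : ℕ := ∑ v ∈ A, G.communityDegree v

end Graph

/-- The law of the ABCD graph, given the degrees `w` and the community sizes `c`
(`none` if there is no admissible assignment). -/
def graphLawGiven {n : ℕ} (ξ : ℝ) (w : Fin n → ℕ) (c : List ℕ) :
    PMF (Option (Graph n c.length)) :=
  if h : (admissible ξ w c).Nonempty then
    (PMF.uniformOfFinset _ h).bind fun σ =>
      (splitLaw ξ w σ).bind fun y =>
        (configurationModel fun v => w v - y v).bind fun E₀ =>
          (independent fun j => configurationModel fun v => if σ v = j then y v else 0).map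
            fun E => some ⟨σ, y, E, E₀⟩
  else PMF.pure none

/-- The law of the ABCD graph, given the community sizes `c`. -/
def graphLawGivenSizes (P : Params) (n : ℕ) (c : List ℕ) : PMF (Option (Graph n c.length)) :=
  (degreeLaw P n).bind fun w => graphLawGiven P.ξ w c

/-- The joint law of the degree sequence and the community sizes, which are independent. -/
def sequencesLaw (P : Params) (n : ℕ) : PMF ((Fin n → ℕ) × Option (List ℕ)) :=
  (degreeLaw P n).bind fun w => (sizeLaw P n).map fun c => (w, c)

/-- The law of the ABCD graph (`none` if the generation fails). -/
def graphLaw (P : Params) (n : ℕ) : PMF (Option (Σ l : ℕ, Graph n l)) :=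
  (sequencesLaw P n).bind fun x =>
    match x.2 with
    | none => PMF.pure none
    | some c => (graphLawGiven P.ξ x.1 c).map (Option.map (Sigma.mk c.length))

/-- The size from which on a community is not small. -/
def smallThreshold (n : ℕ) : ℝ := Real.log n ^ 8

/-- The size from which on a community is very large. -/
def Params.veryLargeThreshold (P : Params) (n : ℕ) : ℝ := (n : ℝ) ^ P.ζ * Real.log n ^ 4

/-- `X = (1 + O((log n)^{-(γ-2)})) m` with implied constant `K`. -/
def Params.Approx (P : Params) (K : ℝ) (n : ℕ) (X m : ℝ) : Prop :=
  |X - m| ≤ K * Real.log n ^ (-(P.γ - 2)) * m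

/-- For a law of ABCD graphs with community sizes `c`: every community that is not small has
expected volume `(1 + O((log n)^{-(γ-2)})) d |C|` and expected community volume
`(1 + O((log n)^{-(γ-2)})) (1 - ξ) d |C|`, with implied constant `K`. -/
def Params.ExpectedVolumes (P : Params) (K : ℝ) (n : ℕ) (c : List ℕ)
    (law : PMF (Option (Graph n c.length))) : Prop :=
  ∀ j : Fin c.length, smallThreshold n ≤ c.get j →
    P.Approx K n (expectation law fun G => G.vol (G.community j))
      (P.meanDegree n * c.get j) ∧
    P.Approx K n (expectation law fun G => G.volC (G.community j))
      ((1 - P.ξ) * P.meanDegree n * c.get j)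

/-- The union of the communities that are not very large. -/
def Params.notVeryLarge (P : Params) {n l : ℕ} (G : Graph n l) : Finset (Fin n) :=
  (Finset.univ.filter fun j : Fin l =>
    ((G.community j).card : ℝ) < P.veryLargeThreshold n).biUnion G.community

end ABCD

end

/-! The degrees, the drawn sizes and the roundings are independent families; the essential
difficulty is the uniformly random admissible assignment. It is handled by switching
(`card_assignments_insert_mul_le`). If a set A and a node v all lie in C, exchange v with a node u
outside C such that both fit in their new places. The result has A in C and v outside, and arises in
at most |C| ways. Few places are closed to v and few nodes are barred from C, so there are almost n
choices of u. Hence A lies in C with probability at most (|C|/m)^|A|, where m is close to n.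
Expanding a product over subsets, the moment generating function of a sum of nonnegative weights
over C is at most that for independent indicators of probability |C|/m, and the upper Chernoff bound
follows (`outer_assignments_tail`). Lower bounds come from the same inequality for the complementary
weights log n - min(w, log n), because C has exactly |C| nodes. Truncating at log n loses the tail
of the first moment of the power law, which is of order (log n)^(-(γ-2)): this is the error term of
the theorem.

Two facts provide the room for switching. Additive functions of the degrees concentrate
(`eventually_goodDegrees`). As β < 2 and ζ < τ, the mass of the size distribution sits near n^τ, so
the communities that are not very large contain at most n^(1-ε) nodes
(`exists_eventually_goodSizes`). Very large communities accept every node, their size exceeding D.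
For the same reason admissible assignments exist: nodes of degree above δ go to very large
communities, and the others fit anywhere since s > δ. The bound on vol(F) is deterministic given
these facts: n^(1-ε) nodes of truncated degree, plus the excess of all degrees over the truncation.

In the graph, at most one node has degree zero and every community has at least two nodes. Each
leader therefore has positive degree and can be rounded so that the community sum is even without
exceeding its degree. The configuration models then realize the prescribed degrees exactly
(`degree_eq_of_good`), so vol(C) is the sum of w over C, and vol_c(C) is 1 - ξ times this sum up to
independent rounding errors and a leader error of at most 2.

The expectations follow by averaging. When only the sizes are given, atypical degree sequences have
probability at most exp(-(log n)²), against which the crude bound |C|(D+1) suffices. Part (b) is a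
union bound over at most n communities. -/

namespace ABCD
open scoped ENNReal

/-- The expectation of a function with values in `[0, ∞]`. -/
noncomputable def mean {α : Type} (μ : PMF α) (g : α → ℝ≥0∞) : ℝ≥0∞ := ∑' a, μ a * g a

/-! ### Expectations, Markov's inequality and staged experiments -/

section mean
variable {α β : Type}

theorem mean_pure (a : α) (g : α → ℝ≥0∞) : mean (PMF.pure a) g = g a := by
  rw [mean, tsum_eq_single a]
  · simp
  · intro b hb; simp [hb]

theorem mean_bind (μ : PMF α) (f : α → PMF β) (g : β → ℝ≥0∞) :
    mean (μ.bind f) g = mean μ fun a => mean (f a) g := by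
  simp only [mean, PMF.bind_apply, ← ENNReal.tsum_mul_right, ← ENNReal.tsum_mul_left]
  rw [ENNReal.tsum_comm]
  simp only [mul_assoc]

theorem mean_map (μ : PMF α) (f : α → β) (g : β → ℝ≥0∞) :
    mean (μ.map f) g = mean μ fun a => g (f a) := by
  rw [← PMF.bind_pure_comp, mean_bind]
  simp [mean_pure]

theorem mean_mono {μ : PMF α} {g h : α → ℝ≥0∞} (H : ∀ a ∈ μ.support, g a ≤ h a) :
    mean μ g ≤ mean μ h := by
  refine ENNReal.tsum_le_tsum fun a => ?_
  by_cases ha : a ∈ μ.support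
  · exact mul_le_mul_right (H a ha) _
  · simp [(μ.apply_eq_zero_iff a).2 ha]

theorem mean_congr {μ : PMF α} {g h : α → ℝ≥0∞} (H : ∀ a ∈ μ.support, g a = h a) :
    mean μ g = mean μ h :=
  le_antisymm (mean_mono fun a ha => (H a ha).le) (mean_mono fun a ha => (H a ha).ge)

theorem mean_add (μ : PMF α) (g h : α → ℝ≥0∞) :
    mean μ (fun a => g a + h a) = mean μ g + mean μ h := by
  simp only [mean, mul_add, ENNReal.tsum_add]

theorem mean_sum {ι : Type} (μ : PMF α) (s : Finset ι) (g : ι → α → ℝ≥0∞) :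
    mean μ (fun a => ∑ i ∈ s, g i a) = ∑ i ∈ s, mean μ (g i) := by
  classical
  induction s using Finset.induction_on with
  | empty => simp [mean]
  | insert i s hi ih => simp only [Finset.sum_insert hi, mean_add, ih]

theorem mean_const_mul (μ : PMF α) (k : ℝ≥0∞) (g : α → ℝ≥0∞) :
    mean μ (fun a => k * g a) = k * mean μ g := by
  simp only [mean, ← ENNReal.tsum_mul_left]
  exact tsum_congr fun a => by ring

theorem mean_mul_const (μ : PMF α) (k : ℝ≥0∞) (g : α → ℝ≥0∞) :
    mean μ (fun a => g a * k) = mean μ g * k := by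
  simp only [mul_comm _ k, mean_const_mul]

theorem mean_const (μ : PMF α) (k : ℝ≥0∞) : mean μ (fun _ => k) = k := by
  simp [mean, ENNReal.tsum_mul_right, μ.tsum_coe]

open Classical in
theorem toOuterMeasure_eq_mean (μ : PMF α) (E : Set α) :
    μ.toOuterMeasure E = mean μ fun a => if a ∈ E then 1 else 0 := by
  rw [PMF.toOuterMeasure_apply, mean]
  exact tsum_congr fun a => by by_cases h : a ∈ E <;> simp [h]

theorem markov (μ : PMF α) {E : Set α} {g : α → ℝ≥0∞} (h : ∀ a ∈ E, 1 ≤ g a) :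
    μ.toOuterMeasure E ≤ mean μ g := by
  classical
  rw [toOuterMeasure_eq_mean]
  refine mean_mono fun a _ => ?_
  split_ifs with ha
  · exact h a ha
  · exact zero_le

/-- The accounting for atypical outcomes: a sharp bound on the typical set, and a crude bound
elsewhere that is paid only with the probability of the exception. -/
theorem mean_le_add {μ : PMF α} (G : Set α) {g : α → ℝ≥0∞} {b c : ℝ≥0∞}
    (h1 : ∀ a ∈ μ.support, a ∈ G → g a ≤ b) (h2 : ∀ a ∈ μ.support, g a ≤ c) :
    mean μ g ≤ b + c * μ.toOuterMeasure Gᶜ := by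
  classical
  calc mean μ g ≤ mean μ fun a => b + c * if a ∈ Gᶜ then 1 else 0 := by
        refine mean_mono fun a ha => ?_
        by_cases hG : a ∈ G
        · exact (h1 a ha hG).trans le_self_add
        · refine (h2 a ha).trans ?_
          simp [hG]
    _ = b + c * μ.toOuterMeasure Gᶜ := by
        rw [mean_add, mean_const, mean_const_mul, toOuterMeasure_eq_mean]
        congr!

theorem outer_le_one (μ : PMF α) (E : Set α) : μ.toOuterMeasure E ≤ 1 := by
  rw [← mean_const μ 1]; exact markov μ fun _ _ => le_rfl

/-- Composition rule for experiments in stages: the second stage is analysed only from typical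
outcomes of the first, and the atypical ones cost their probability. -/
theorem outer_bind_le {μ : PMF α} {f : α → PMF β} {E : Set β} (G : Set α) {b : ℝ≥0∞}
    (h : ∀ a ∈ μ.support, a ∈ G → (f a).toOuterMeasure E ≤ b) :
    (μ.bind f).toOuterMeasure E ≤ b + μ.toOuterMeasure Gᶜ := by
  classical
  have := mean_le_add (μ := μ) G (g := fun a => (f a).toOuterMeasure E) (c := 1) h
    (fun a _ => outer_le_one _ _)
  rw [one_mul] at this
  rwa [toOuterMeasure_eq_mean, mean_bind, ← mean_congr fun a _ => toOuterMeasure_eq_mean (f a) E]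

theorem outer_le_of_imp (μ : PMF α) {E F : Set α} (h : ∀ a ∈ μ.support, a ∈ E → a ∈ F) :
    μ.toOuterMeasure E ≤ μ.toOuterMeasure F :=
  PMF.toOuterMeasure_mono _ fun a ha => h a ha.2 ha.1

theorem one_sub_le_outer (μ : PMF α) {E : Set α} {r : ℝ} (hr : 0 ≤ r)
    (h : μ.toOuterMeasure Eᶜ ≤ ENNReal.ofReal r) : 1 - r ≤ (μ.toOuterMeasure E).toReal := by
  have h1 : (1 : ℝ≥0∞) ≤ μ.toOuterMeasure E + μ.toOuterMeasure Eᶜ := by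
    rw [← (μ.toOuterMeasure_apply_eq_one_iff Set.univ).2 (Set.subset_univ μ.support),
      ← Set.union_compl_self E]
    exact MeasureTheory.measure_union_le _ _
  have hfin : μ.toOuterMeasure E ≠ ∞ := ((outer_le_one μ E).trans_lt ENNReal.one_lt_top).ne
  have h2 := ENNReal.toReal_mono (ENNReal.add_ne_top.2 ⟨hfin, ENNReal.ofReal_ne_top⟩)
    (h1.trans (add_le_add_right h _))
  rw [ENNReal.toReal_add hfin ENNReal.ofReal_ne_top, ENNReal.toReal_ofReal hr,
    ENNReal.toReal_one] at h2
  linarith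

theorem mean_uniformOfFinset {s : Finset α} (hs : s.Nonempty) (f : α → ℝ) (hf : ∀ a ∈ s, 0 ≤ f a) :
    mean (PMF.uniformOfFinset s hs) (fun a => ENNReal.ofReal (f a)) =
      ENNReal.ofReal ((∑ a ∈ s, f a) / s.card) := by
  have hc : (0 : ℝ) < s.card := by exact_mod_cast hs.card_pos
  rw [mean, tsum_eq_sum (s := s)]
  · rw [Finset.sum_div, ENNReal.ofReal_sum_of_nonneg fun a ha => div_nonneg (hf a ha) hc.le]
    refine Finset.sum_congr rfl fun a ha => ?_
    rw [PMF.uniformOfFinset_apply_of_mem hs ha, div_eq_inv_mul, ENNReal.ofReal_mul (by positivity),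
      ENNReal.ofReal_inv_of_pos hc, ENNReal.ofReal_natCast]
  · intro a ha
    simp [PMF.uniformOfFinset_apply_of_notMem hs ha]

end mean

/-! ### Independent families and Chernoff's method -/

section independent
variable {α : Type}

theorem mean_independent_prod : ∀ {m : ℕ} (p : Fin m → PMF α) (g : Fin m → α → ℝ≥0∞),
    mean (independent p) (fun v => ∏ i, g i (v i)) = ∏ i, mean (p i) (g i)
  | 0, p, g => by simp [independent, mean_pure]
  | m + 1, p, g => by
    simp only [independent, mean_bind, mean_map, Fin.prod_univ_succ, Fin.cons_zero, Fin.cons_succ,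
      mean_const_mul, mean_mul_const]
    rw [mean_independent_prod (fun i => p i.succ) (fun i => g i.succ)]

theorem mean_independent_apply {m : ℕ} (p : Fin m → PMF α) (i : Fin m) (g : α → ℝ≥0∞) :
    mean (independent p) (fun v => g (v i)) = mean (p i) g := by
  classical
  have := mean_independent_prod p fun k a => if k = i then g a else 1
  simp only [Finset.prod_ite_eq', Finset.mem_univ, if_true] at this
  rw [this, Finset.prod_eq_single i]
  · simp
  · intro k _ hk; simp [hk, mean_const]
  · simp

theorem mem_support_of_independent : ∀ {m : ℕ} {p : Fin m → PMF α} {v : Fin m → α},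
    v ∈ (independent p).support → ∀ i, v i ∈ (p i).support
  | 0, _, _, _ => fun i => i.elim0
  | m + 1, p, v, hv => by
    simp only [independent, PMF.mem_support_bind_iff, PMF.mem_support_map_iff] at hv
    obtain ⟨a, ha, u, hu, rfl⟩ := hv
    refine Fin.cases ?_ fun i => ?_
    · simpa using ha
    · simpa using mem_support_of_independent hu i

/-- Markov's inequality for the exponential of l(∑ f - y), whose expectation factors by
independence. The exponents `s i` are left free so that one statement serves degrees, sizes and
roundings. -/
theorem outer_independent_tail {m : ℕ} (p : Fin m → PMF α) (f : Fin m → α → ℝ) (s : Fin m → ℝ)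
    {l y : ℝ} (hl : 0 ≤ l)
    (h : ∀ i, mean (p i) (fun a => ENNReal.ofReal (Real.exp (l * f i a))) ≤
      ENNReal.ofReal (Real.exp (s i))) :
    (independent p).toOuterMeasure {v | y ≤ ∑ i, f i (v i)} ≤
      ENNReal.ofReal (Real.exp (∑ i, s i - l * y)) := by
  have key : mean (independent p)
      (fun v => ENNReal.ofReal (Real.exp (-(l * y))) * ∏ i, ENNReal.ofReal (Real.exp (l * f i (v i))))
      ≤ ENNReal.ofReal (Real.exp (∑ i, s i - l * y)) := by
    rw [mean_const_mul,
      mean_independent_prod p fun i a => ENNReal.ofReal (Real.exp (l * f i a)), sub_eq_neg_add,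
      Real.exp_add, ENNReal.ofReal_mul (Real.exp_pos _).le, Real.exp_sum,
      ENNReal.ofReal_prod_of_nonneg fun i _ => (Real.exp_pos _).le]
    exact mul_le_mul_right (Finset.prod_le_prod' fun i _ => h i) _
  refine (markov _ fun v hv => ?_).trans key
  rw [← ENNReal.ofReal_prod_of_nonneg fun i _ => (Real.exp_pos _).le,
    ← ENNReal.ofReal_mul (Real.exp_pos _).le, ← Real.exp_sum, ← Real.exp_add,
    ENNReal.one_le_ofReal, ← Finset.mul_sum]
  apply Real.one_le_exp
  have := mul_le_mul_of_nonneg_left hv.out hl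
  linarith

end independent

/-! ### Expectations under a truncated power law -/

theorem mean_powerLaw {e : ℝ} {a N : ℕ} (ha : 0 < a) (haN : a ≤ N) (g : ℕ → ℝ≥0∞) :
    mean (powerLaw e a N) g = ∑ k ∈ Finset.Icc a N, ENNReal.ofReal (powerLawMass e a N k) * g k := by
  rw [mean, tsum_eq_sum (s := Finset.Icc a N)]
  · refine Finset.sum_congr rfl fun k hk => ?_
    rw [powerLaw, dif_pos ⟨ha, haN⟩, PMF.ofFinset_apply, if_pos hk]
  · intro k hk
    rw [powerLaw, dif_pos ⟨ha, haN⟩, PMF.ofFinset_apply, if_neg hk, zero_mul]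

theorem mem_Icc_of_mem_support_powerLaw {e : ℝ} {a N k : ℕ} (ha : 0 < a) (haN : a ≤ N)
    (hk : k ∈ (powerLaw e a N).support) : k ∈ Finset.Icc a N := by
  rw [powerLaw, dif_pos ⟨ha, haN⟩, PMF.mem_support_iff, PMF.ofFinset_apply] at hk
  by_contra h
  exact hk (if_neg h)

theorem powerLaw_integrable {e : ℝ} {b c : ℝ} (hb : 0 < b) (hbc : b ≤ c) :
    IntervalIntegrable (fun x : ℝ => x ^ e) MeasureTheory.volume b c := by
  apply ContinuousOn.intervalIntegrable
  intro x hx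
  rw [Set.uIcc_of_le hbc] at hx
  have h0 : (0 : ℝ) < x := hb.trans_le hx.1
  exact (Real.continuousAt_rpow_const x e (Or.inl h0.ne')).continuousWithinAt

theorem powerLaw_integral_pos {e : ℝ} {b c : ℝ} (hb : 0 < b) (hbc : b < c) :
    0 < ∫ x in b..c, x ^ e := by
  refine intervalIntegral.intervalIntegral_pos_of_pos_on (powerLaw_integrable hb hbc.le) ?_ hbc
  intro x hx
  exact Real.rpow_pos_of_pos (hb.trans hx.1) _

theorem powerLawMass_nonneg {e : ℝ} {a N k : ℕ} (ha : 0 < a) (hk : k ∈ Finset.Icc a N) :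
    0 ≤ powerLawMass e a N k := by
  rw [Finset.mem_Icc] at hk
  have h1 : (0 : ℝ) < a := by exact_mod_cast ha
  have h2 : (0 : ℝ) < k := by exact_mod_cast ha.trans_le hk.1
  exact div_nonneg (powerLaw_integral_pos h2 (by push_cast; linarith)).le
    (powerLaw_integral_pos h1 (by exact_mod_cast Nat.lt_succ_of_le (hk.1.trans hk.2))).le

theorem sum_powerLawMass_real (e : ℝ) {a N : ℕ} (ha : 0 < a) (haN : a ≤ N) :
    ∑ k ∈ Finset.Icc a N, powerLawMass e a N k = 1 := by
  have := sum_powerLawMass e ha haN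
  rw [← ENNReal.ofReal_sum_of_nonneg fun k hk => powerLawMass_nonneg ha hk] at this
  exact ENNReal.ofReal_eq_one.1 this

theorem mean_powerLaw_ofReal {e : ℝ} {a N : ℕ} (ha : 0 < a) (haN : a ≤ N) (g : ℕ → ℝ)
    (hg : ∀ k, 0 ≤ g k) :
    mean (powerLaw e a N) (fun k => ENNReal.ofReal (g k)) =
      ENNReal.ofReal (∑ k ∈ Finset.Icc a N, powerLawMass e a N k * g k) := by
  rw [mean_powerLaw ha haN, ENNReal.ofReal_sum_of_nonneg fun k hk =>
    mul_nonneg (powerLawMass_nonneg ha hk) (hg k)]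
  exact Finset.sum_congr rfl fun k hk => (ENNReal.ofReal_mul (powerLawMass_nonneg ha hk)).symm

end ABCD

namespace ABCD
open scoped ENNReal

/-! ### Random admissible assignments: switching and the upper tail -/

section assignment
variable {V ι : Type} [Fintype V] [Fintype ι] [DecidableEq V] [DecidableEq ι]
  {k : ι → ℕ} {ok : V → ι → Prop} {S : Finset (V → ι)}

-- Switching: exchange v with a node u outside C, where u may enter C and v may take its place.
-- There are at least m - k C choices of u, and at most k C ways to arrive at a given result. With
-- X, Y the numbers of assignments having A in C and v inside, respectively outside, C, this gives
-- X(m - k C) ≤ Y k C, that is, X m ≤ k C (X + Y).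
open Classical in
theorem card_assignments_insert_mul_le
    (hS : ∀ σ, σ ∈ S ↔ (∀ j, (Finset.univ.filter fun v => σ v = j).card = k j) ∧ ∀ v, ok v (σ v))
    (C : ι) (A : Finset V) (v : V) (hv : v ∉ A) (m : ℕ)
    (hm : m + (Finset.univ.filter fun u => ¬ ok u C).card ≤
      ∑ j ∈ Finset.univ.filter (fun j => ok v j), k j) :
    (S.filter fun σ => ∀ u ∈ insert v A, σ u = C).card * m ≤
      k C * (S.filter fun σ => ∀ u ∈ A, σ u = C).card := by
  set X := S.filter fun σ => ∀ u ∈ insert v A, σ u = C with hX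
  set XA := S.filter fun σ => ∀ u ∈ A, σ u = C with hXA
  set Y := XA.filter fun σ => σ v ≠ C with hY
  have hXeq : X = XA.filter fun σ => σ v = C := by
    ext σ; simp only [hX, hXA, Finset.mem_filter, Finset.forall_mem_insert]; tauto
  have hcard : X.card + Y.card = XA.card := by
    rw [hXeq, hY]; exact Finset.card_filter_add_card_filter_not _
  let src : (V → ι) → Finset V := fun σ =>
    Finset.univ.filter fun u => ok u C ∧ ok v (σ u) ∧ σ u ≠ C
  let tgt : (V → ι) → Finset V := fun σ => Finset.univ.filter fun u => σ u = C
  -- The nodes sitting where v is allowed are at least m plus the number of nodes barred from C.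
  -- Discarding the barred nodes and the k C members of C leaves the admissible partners. The bound
  -- is stated additively because m - k C may be negative.
  have hsrc : ∀ σ ∈ X, m ≤ (src σ).card + k C := by
    intro σ hσ
    have hσS := (hS σ).1 (Finset.mem_filter.1 hσ).1
    have h1 : ∑ j ∈ Finset.univ.filter (fun j => ok v j), k j =
        (Finset.univ.filter fun u => ok v (σ u)).card := by
      rw [Finset.card_eq_sum_card_fiberwise (f := σ) (t := Finset.univ.filter fun j => ok v j)]
      · refine Finset.sum_congr rfl fun j hj => ?_
        rw [← hσS.1 j]
        congr 1
        ext u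
        simp only [Finset.mem_filter, Finset.mem_univ, true_and] at hj ⊢
        exact ⟨fun h => ⟨h ▸ hj, h⟩, fun h => h.2⟩
      · intro u hu; simpa using hu
    have h2 : (Finset.univ.filter fun u => ok v (σ u)) ⊆
        (src σ ∪ tgt σ) ∪ Finset.univ.filter fun u => ¬ ok u C := by
      intro u hu
      simp only [src, tgt, Finset.mem_union, Finset.mem_filter, Finset.mem_univ, true_and] at hu ⊢
      tauto
    have h3 := (Finset.card_le_card h2).trans
      ((Finset.card_union_le _ _).trans (Nat.add_le_add_right (Finset.card_union_le _ _) _))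
    have h4 : (tgt σ).card = k C := hσS.1 C
    omega
  -- The partner u ends up in C, so it is recorded as an element of `tgt`; knowing u, a second swap
  -- restores the old assignment.
  have hinj : (X.sigma src).card ≤ (Y.sigma tgt).card := by
    refine Finset.card_le_card_of_injOn
      (fun x => ⟨fun u => x.1 (Equiv.swap x.2 v u), x.2⟩) ?_ ?_
    · rintro ⟨σ, u⟩ hx
      simp only [Finset.coe_sigma, Set.mem_sigma_iff, Finset.mem_coe, src, Finset.mem_filter,
        Finset.mem_univ, true_and] at hx
      obtain ⟨hσ, h1, h2, h3⟩ := hx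
      rw [hX, Finset.mem_filter, Finset.forall_mem_insert] at hσ
      obtain ⟨hσ, h4, h5⟩ := hσ
      have h6 := (hS σ).1 hσ
      simp only [Finset.coe_sigma, Set.mem_sigma_iff, Finset.mem_coe, tgt, Finset.mem_filter,
        Finset.mem_univ, true_and, hY, hXA, Equiv.swap_apply_left, Equiv.swap_apply_right]
      refine ⟨⟨⟨(hS _).2 ⟨fun j => ?_, fun z => ?_⟩, fun z hz => ?_⟩, h3⟩, h4⟩
      · rw [← h6.1 j]
        refine Finset.card_bij (fun a _ => Equiv.swap u v a) ?_ ?_ ?_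
        · intro a ha; simpa using ha
        · intro a _ b _ h; exact (Equiv.swap u v).injective h
        · intro b hb
          exact ⟨Equiv.swap u v b, by simpa using hb, by simp⟩
      · rcases eq_or_ne z u with rfl | hzu
        · rwa [Equiv.swap_apply_left, h4]
        · rcases eq_or_ne z v with rfl | hzv
          · rwa [Equiv.swap_apply_right]
          · rw [Equiv.swap_apply_of_ne_of_ne hzu hzv]; exact h6.2 z
      · have hzu : z ≠ u := by rintro rfl; exact h3 (h5 z hz)
        have hzv : z ≠ v := by rintro rfl; exact hv hz
        rw [Equiv.swap_apply_of_ne_of_ne hzu hzv]; exact h5 z hz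
    · rintro ⟨σ, u⟩ _ ⟨σ', u'⟩ _ h
      simp only [Sigma.mk.injEq, heq_eq_eq] at h
      obtain ⟨h1, rfl⟩ := h
      simp only [Sigma.mk.injEq, heq_eq_eq, and_true]
      ext z
      have := congrFun h1 (Equiv.swap u v z)
      simpa using this
  have htgt : (Y.sigma tgt).card = Y.card * k C := by
    rw [Finset.card_sigma]
    refine Finset.sum_const_nat fun σ hσ => ?_
    exact ((hS σ).1 (Finset.mem_filter.1 (Finset.mem_filter.1 hσ).1).1).1 C
  have hsrc2 : X.card * m ≤ (X.sigma src).card + X.card * k C := by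
    rw [Finset.card_sigma, ← smul_eq_mul, ← Finset.sum_const, ← smul_eq_mul (a := X.card) (b := k C),
      ← Finset.sum_const, ← Finset.sum_add_distrib]
    exact Finset.sum_le_sum hsrc
  calc X.card * m ≤ Y.card * k C + X.card * k C := by omega
    _ = k C * XA.card := by rw [← hcard]; ring

-- Iterated switching: for upper bounds, the nodes behave as if each entered C independently with
-- probability k C / m.
open Classical in
theorem card_assignments_mul_pow_le
    (hS : ∀ σ, σ ∈ S ↔ (∀ j, (Finset.univ.filter fun v => σ v = j).card = k j) ∧ ∀ v, ok v (σ v))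
    (C : ι) (m : ℕ)
    (hm : ∀ v, m + (Finset.univ.filter fun u => ¬ ok u C).card ≤
      ∑ j ∈ Finset.univ.filter (fun j => ok v j), k j) (A : Finset V) :
    (S.filter fun σ => ∀ u ∈ A, σ u = C).card * m ^ A.card ≤ k C ^ A.card * S.card := by
  induction A using Finset.induction_on with
  | empty => simp
  | insert v A hv ih =>
    rw [Finset.card_insert_of_notMem hv, pow_succ', pow_succ', ← mul_assoc]
    calc _ ≤ k C * (S.filter fun σ => ∀ u ∈ A, σ u = C).card * m ^ A.card :=
          Nat.mul_le_mul_right _ (card_assignments_insert_mul_le hS C A v hv m (hm v))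
      _ = k C * ((S.filter fun σ => ∀ u ∈ A, σ u = C).card * m ^ A.card) := by ring
      _ ≤ k C * (k C ^ A.card * S.card) := Nat.mul_le_mul_left _ ih
      _ = _ := by ring

-- Expanding both products over subsets A reduces the claim to the joint probabilities just bounded;
-- `x ≥ 0` allows the comparison term by term.
open Classical in
theorem sum_assignments_prod_le
    (hS : ∀ σ, σ ∈ S ↔ (∀ j, (Finset.univ.filter fun v => σ v = j).card = k j) ∧ ∀ v, ok v (σ v))
    (C : ι) (m : ℕ) (hm0 : 0 < m)
    (hm : ∀ v, m + (Finset.univ.filter fun u => ¬ ok u C).card ≤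
      ∑ j ∈ Finset.univ.filter (fun j => ok v j), k j) (x : V → ℝ) (hx : ∀ v, 0 ≤ x v) :
    ∑ σ ∈ S, ∏ v, (1 + if σ v = C then x v else 0) ≤
      S.card * ∏ v, (1 + (k C : ℝ) / m * x v) := by
  have hm1 : (0 : ℝ) < m := by exact_mod_cast hm0
  simp only [Finset.prod_one_add]
  rw [Finset.sum_comm, Finset.mul_sum]
  refine Finset.sum_le_sum fun A _ => ?_
  have h1 : ∑ σ ∈ S, ∏ v ∈ A, (if σ v = C then x v else 0) =
      ∑ σ ∈ S.filter fun σ => ∀ u ∈ A, σ u = C, ∏ v ∈ A, x v := by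
    rw [Finset.sum_filter]
    refine Finset.sum_congr rfl fun σ _ => ?_
    rw [Finset.prod_ite_zero]
    congr
  rw [h1, Finset.sum_const, nsmul_eq_mul, Finset.prod_mul_distrib, Finset.prod_const, ← mul_assoc]
  refine mul_le_mul_of_nonneg_right ?_ (Finset.prod_nonneg fun v _ => hx v)
  rw [div_pow, ← mul_div_assoc, le_div_iff₀ (pow_pos hm1 _)]
  have := card_assignments_mul_pow_le hS C m hm A
  rw [mul_comm (S.card : ℝ)]
  exact_mod_cast this

open Classical in
theorem sum_assignments_sum_le
    (hS : ∀ σ, σ ∈ S ↔ (∀ j, (Finset.univ.filter fun v => σ v = j).card = k j) ∧ ∀ v, ok v (σ v))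
    (C : ι) (m : ℕ) (hm0 : 0 < m)
    (hm : ∀ v, m + (Finset.univ.filter fun u => ¬ ok u C).card ≤
      ∑ j ∈ Finset.univ.filter (fun j => ok v j), k j) (x : V → ℝ) (hx : ∀ v, 0 ≤ x v) :
    ∑ σ ∈ S, ∑ v, (if σ v = C then x v else 0) ≤ S.card * ((k C : ℝ) / m * ∑ v, x v) := by
  have hm1 : (0 : ℝ) < m := by exact_mod_cast hm0
  rw [Finset.sum_comm, Finset.mul_sum, Finset.mul_sum]
  refine Finset.sum_le_sum fun v _ => ?_
  rw [← Finset.sum_filter, Finset.sum_const, nsmul_eq_mul, ← mul_assoc]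
  refine mul_le_mul_of_nonneg_right ?_ (hx v)
  have := card_assignments_mul_pow_le hS C m hm {v}
  simp only [Finset.mem_singleton, forall_eq, Finset.card_singleton, pow_one] at this
  rw [← mul_div_assoc, le_div_iff₀ hm1, mul_comm (S.card : ℝ)]
  exact_mod_cast this

-- The Chernoff bound for a sum over a random community, with the variance of the sum replaced by b
-- μ. Only the upper tail is available, since switching bounds joint probabilities from above.
open Classical in
theorem outer_assignments_tail
    (hS : ∀ σ, σ ∈ S ↔ (∀ j, (Finset.univ.filter fun v => σ v = j).card = k j) ∧ ∀ v, ok v (σ v))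
    (hne : S.Nonempty) (C : ι) (m : ℕ) (hm0 : 0 < m)
    (hm : ∀ v, m + (Finset.univ.filter fun u => ¬ ok u C).card ≤
      ∑ j ∈ Finset.univ.filter (fun j => ok v j), k j)
    (a : V → ℝ) {b μ y : ℝ} (ha : ∀ v, 0 ≤ a v) (hab : ∀ v, a v ≤ b) (hb : 0 < b) (hμ : 0 < μ)
    (hμa : (k C : ℝ) / m * ∑ v, a v ≤ μ) (hy : 0 ≤ y) (hyμ : y ≤ 2 * μ) :
    (PMF.uniformOfFinset S hne).toOuterMeasure
      {σ | μ + y ≤ ∑ v, if σ v = C then a v else 0} ≤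
      ENNReal.ofReal (Real.exp (-(y ^ 2 / (4 * b * μ)))) := by
  -- The minimizer of -t y + t² b μ. The condition y ≤ 2 μ is what makes t b ≤ 1, where exp x ≤ 1 +
  -- x + x² may be used.
  set t := y / (2 * b * μ) with ht
  have ht0 : 0 ≤ t := by positivity
  have htb : t * b ≤ 1 := by
    rw [ht, div_mul_eq_mul_div, div_le_one (by positivity)]; nlinarith
  have hc : (0 : ℝ) < S.card := by exact_mod_cast hne.card_pos
  have hk : (0 : ℝ) ≤ (k C : ℝ) / m := by positivity
  refine (markov _ (g := fun σ => ENNReal.ofReal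
    (Real.exp (-(t * (μ + y))) * ∏ v, (1 + if σ v = C then Real.exp (t * a v) - 1 else 0)))
    fun σ hσ => ?_).trans ?_
  · rw [ENNReal.one_le_ofReal]
    have : ∏ v, (1 + if σ v = C then Real.exp (t * a v) - 1 else 0) =
        Real.exp (t * ∑ v, if σ v = C then a v else 0) := by
      rw [Finset.mul_sum, Real.exp_sum]
      refine Finset.prod_congr rfl fun v _ => ?_
      split_ifs <;> simp
    rw [this, ← Real.exp_add]
    apply Real.one_le_exp
    have := mul_le_mul_of_nonneg_left hσ.out ht0
    linarith
  have hexp : ∀ v, 0 ≤ Real.exp (t * a v) - 1 := fun v =>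
    sub_nonneg.2 (Real.one_le_exp (mul_nonneg ht0 (ha v)))
  rw [mean_uniformOfFinset]
  · apply ENNReal.ofReal_le_ofReal
    rw [← Finset.mul_sum, div_le_iff₀ hc]
    have h1 := sum_assignments_prod_le hS C m hm0 hm (fun v => Real.exp (t * a v) - 1) hexp
    have h2 : ∏ v, (1 + (k C : ℝ) / m * (Real.exp (t * a v) - 1)) ≤
        Real.exp (t * μ + t ^ 2 * b * μ) := by
      calc _ ≤ ∏ v, Real.exp ((k C : ℝ) / m * (t * a v * (1 + t * b))) := by
            refine Finset.prod_le_prod (fun v _ => by have := hexp v; positivity) fun v _ => ?_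
            have h3 := (Real.add_one_le_exp ((k C : ℝ) / m * (Real.exp (t * a v) - 1)))
            rw [add_comm] at h3
            refine h3.trans (Real.exp_le_exp.2 (mul_le_mul_of_nonneg_left ?_ hk))
            have h4 : t * a v ≤ t * b := mul_le_mul_of_nonneg_left (hab v) ht0
            have h5 : 0 ≤ t * a v := mul_nonneg ht0 (ha v)
            have h6 := (abs_le.1 (Real.abs_exp_sub_one_sub_id_le
              (abs_le.2 ⟨by linarith, h4.trans htb⟩))).2
            nlinarith
        _ = Real.exp (t * (1 + t * b) * ((k C : ℝ) / m * ∑ v, a v)) := by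
            rw [← Real.exp_sum, Finset.mul_sum, Finset.mul_sum]
            congr 1
            exact Finset.sum_congr rfl fun v _ => by ring
        _ ≤ _ := by
            apply Real.exp_le_exp.2
            calc _ ≤ t * (1 + t * b) * μ := mul_le_mul_of_nonneg_left hμa (by positivity)
              _ = _ := by ring
    calc _ ≤ Real.exp (-(t * (μ + y))) * (S.card * Real.exp (t * μ + t ^ 2 * b * μ)) :=
          mul_le_mul_of_nonneg_left (h1.trans (mul_le_mul_of_nonneg_left h2 hc.le))
            (Real.exp_pos _).le
      _ = Real.exp (-(t * (μ + y)) + (t * μ + t ^ 2 * b * μ)) * S.card := by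
          rw [Real.exp_add (-(t * (μ + y)))]; ring
      _ = _ := by
          congr 2
          rw [ht]; field_simp; ring
  · intro σ _
    refine mul_nonneg (Real.exp_pos _).le (Finset.prod_nonneg fun v _ => ?_)
    split_ifs
    · have := hexp v; linarith
    · norm_num

end assignment

/-- The assignment constraint: a node `v` may belong to the community with index `j`. -/
def Fits {n : ℕ} (ξ : ℝ) (w : Fin n → ℕ) (c : List ℕ) (v : Fin n) (j : Fin c.length) : Prop :=
  ⌈(1 - ξ * phi n c) * (w v : ℝ)⌉ ≤ (c.get j : ℤ) - 1

open Classical in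
theorem mem_admissible {n : ℕ} {ξ : ℝ} {w : Fin n → ℕ} {c : List ℕ} (σ : Fin n → Fin c.length) :
    σ ∈ admissible ξ w c ↔
      (∀ j, (Finset.univ.filter fun v => σ v = j).card = c.get j) ∧ ∀ v, Fits ξ w c v (σ v) := by
  simp [admissible, Fits]

end ABCD

namespace ABCD
open scoped ENNReal

/-! ### Degrees in the configuration model -/

theorem pairings_nonempty (Q : Type) [Fintype Q] (h : Even (Fintype.card Q)) :
    (pairings Q).Nonempty := by
  classical
  obtain ⟨k, hk⟩ := h
  have e : Fin k × Bool ≃ Q := Fintype.equivOfCardEq (by simp [hk]; ring)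
  refine ⟨Finset.univ.image fun i => s(e (i, false), e (i, true)), ?_⟩
  simp only [pairings, Finset.mem_filter, Finset.mem_univ, true_and]
  refine ⟨?_, fun x => ?_⟩
  · intro q hq
    obtain ⟨i, _, rfl⟩ := Finset.mem_image.1 hq
    simp
  · obtain ⟨⟨i, b⟩, rfl⟩ := e.surjective x
    refine ⟨s(e (i, false), e (i, true)), ⟨by simp, ?_⟩, ?_⟩
    · cases b <;> simp
    · rintro q ⟨hq, hx⟩
      obtain ⟨i', _, rfl⟩ := Finset.mem_image.1 hq
      have : i = i' := by
        rcases Sym2.mem_iff.1 hx with h | h <;> exact (Prod.mk.inj (e.injective h)).1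
      rw [this]

/-- The degree of `v` in a multiset of edges; a loop contributes two. -/
noncomputable def multidegree {n : ℕ} (E : Multiset (Sym2 (Fin n))) (v : Fin n) : ℕ :=
  (E.bind Sym2.toMultiset).count v

/-- Double counting of incidences between points of bucket v and pairs: every point lies in exactly
one pair, and a pair inside the bucket contributes two, like a loop. -/
theorem multidegree_of_pairing {n : ℕ} {a : Fin n → ℕ}
    {M : Finset (Sym2 (Σ v : Fin n, Fin (a v)))} (hM : M ∈ pairings (Σ v : Fin n, Fin (a v)))
    (v : Fin n) : multidegree (M.val.map (Sym2.map Sigma.fst)) v = a v := by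
  classical
  simp only [pairings, Finset.mem_filter, Finset.mem_univ, true_and] at hM
  obtain ⟨h1, h2⟩ := hM
  have h3 : ∀ e ∈ M, (Sym2.toMultiset (Sym2.map Sigma.fst e)).count v =
      (Finset.univ.filter fun x : Σ v : Fin n, Fin (a v) => x ∈ e ∧ x.1 = v).card := by
    intro e he
    have hd := h1 e he
    induction e using Sym2.ind with
    | _ x y =>
      have hxy : x ≠ y := by simpa using hd
      have h5 : (Finset.univ.filter fun z : Σ v : Fin n, Fin (a v) => z ∈ s(x, y) ∧ z.1 = v) =
          ({x, y} : Finset _).filter fun z => z.1 = v := by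
        ext z; simp
      rw [h5, Finset.filter_insert, Finset.filter_singleton, Sym2.map_mk]
      have h6 : (Sym2.toMultiset s(x.1, y.1)) = {x.1, y.1} := rfl
      rw [h6, Multiset.insert_eq_cons, Multiset.count_cons, Multiset.count_singleton]
      have e1 : (v = x.1) = (x.1 = v) := propext eq_comm
      have e2 : (v = y.1) = (y.1 = v) := propext eq_comm
      by_cases hx : x.1 = v <;> by_cases hy : y.1 = v <;>
        simp [e1, e2, hx, hy, hxy]
  rw [multidegree, Multiset.bind_map, Multiset.count_bind]
  have h4 : (M.val.map fun e => (Sym2.toMultiset (Sym2.map Sigma.fst e)).count v).sum =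
      ∑ e ∈ M, (Finset.univ.filter fun x : Σ v : Fin n, Fin (a v) => x ∈ e ∧ x.1 = v).card :=
    Finset.sum_congr rfl h3
  rw [h4]
  simp only [Finset.card_filter]
  rw [Finset.sum_comm]
  have h5 : ∀ x : Σ v : Fin n, Fin (a v),
      ∑ e ∈ M, (if x ∈ e ∧ x.1 = v then 1 else 0) = if x.1 = v then 1 else 0 := by
    intro x
    obtain ⟨e, ⟨he, hx⟩, hu⟩ := h2 x
    rw [Finset.sum_eq_single e]
    · simp [hx]
    · intro e' he' hne
      have : x ∉ e' := fun h => hne (hu e' ⟨he', h⟩)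
      simp [this]
    · exact fun h => absurd he h
  rw [Finset.sum_congr rfl fun x _ => h5 x, Fintype.sum_sigma, Finset.sum_eq_single v]
  · simp
  · intro u _ hu; simp [hu]
  · simp

theorem multidegree_of_mem_support {n : ℕ} {a : Fin n → ℕ} (ha : Even (∑ v, a v))
    {E : Multiset (Sym2 (Fin n))} (hE : E ∈ (configurationModel a).support) (v : Fin n) :
    multidegree E v = a v := by
  have h : (pairings (Σ v : Fin n, Fin (a v))).Nonempty := pairings_nonempty _ (by simpa using ha)
  rw [configurationModel, dif_pos h, PMF.mem_support_map_iff] at hE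
  obtain ⟨M, hM, rfl⟩ := hE
  rw [PMF.mem_support_uniformOfFinset_iff] at hM
  exact multidegree_of_pairing hM v

/-- No parity condition is needed, because an odd sum produces no edges at all. This makes crude
bounds valid for atypical degree sequences too. -/
theorem multidegree_le_of_mem_support {n : ℕ} {a : Fin n → ℕ}
    {E : Multiset (Sym2 (Fin n))} (hE : E ∈ (configurationModel a).support) (v : Fin n) :
    multidegree E v ≤ a v := by
  by_cases h : (pairings (Σ v : Fin n, Fin (a v))).Nonempty
  · rw [configurationModel, dif_pos h, PMF.mem_support_map_iff] at hE
    obtain ⟨M, hM, rfl⟩ := hE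
    rw [PMF.mem_support_uniformOfFinset_iff] at hM
    exact (multidegree_of_pairing hM v).le
  · rw [configurationModel, dif_neg h, PMF.mem_support_pure_iff] at hE
    subst hE
    simp [multidegree]

theorem Graph.degree_eq {n l : ℕ} (G : Graph n l) (v : Fin n) :
    G.degree v = multidegree G.backgroundEdges v + ∑ j, multidegree (G.communityEdges j) v := by
  have : ∀ s : Finset (Fin l), ((∑ j ∈ s, G.communityEdges j).bind Sym2.toMultiset).count v =
      ∑ j ∈ s, multidegree (G.communityEdges j) v := by
    intro s
    classical
    induction s using Finset.induction_on with
    | empty => simp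
    | insert j s hj ih =>
      rw [Finset.sum_insert hj, Finset.sum_insert hj, Multiset.add_bind, Multiset.count_add, ih]
      rfl
  rw [Graph.degree, Graph.edges, Multiset.add_bind, Multiset.count_add, this]
  rfl

/-- Membership in the support of the law of the edges, given the labels and community degrees. -/
structure Compatible {n l : ℕ} (w : Fin n → ℕ) (G : Graph n l) : Prop where
  background : G.backgroundEdges ∈
    (configurationModel fun v => w v - G.communityDegree v).support
  community : ∀ j, G.communityEdges j ∈
    (configurationModel fun v => if G.label v = j then G.communityDegree v else 0).support

/-- The slack 1 is for a leader of degree 0 whose community degree is rounded up to 1; the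
background degree w - y is then a truncated subtraction. -/
theorem Compatible.degree_le {n l : ℕ} {w : Fin n → ℕ} {G : Graph n l} (h : Compatible w G)
    {v : Fin n} (hy : G.communityDegree v ≤ w v + 1) : G.degree v ≤ w v + 1 := by
  have h2 : ∑ j, multidegree (G.communityEdges j) v ≤ G.communityDegree v := by
    calc _ ≤ ∑ j, if G.label v = j then G.communityDegree v else 0 :=
          Finset.sum_le_sum fun j _ => multidegree_le_of_mem_support (h.community j) v
      _ = _ := by simp
  have h1 := multidegree_le_of_mem_support h.background v
  rw [Graph.degree_eq]
  omega

/-- Even community sums add up to an even total, so the background sum is even as well and every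
configuration model is exact. -/
theorem Compatible.degree_eq {n l : ℕ} {w : Fin n → ℕ} {G : Graph n l} (h : Compatible w G)
    (hw : Even (∑ v, w v)) (hyw : ∀ v, G.communityDegree v ≤ w v)
    (hy : ∀ j, Even (∑ v, if G.label v = j then G.communityDegree v else 0)) (v : Fin n) :
    G.degree v = w v := by
  have h0 : Even (∑ v, G.communityDegree v) := by
    have : ∑ v, G.communityDegree v =
        ∑ j, ∑ v, if G.label v = j then G.communityDegree v else 0 := by
      rw [Finset.sum_comm]; simp
    rw [this]
    exact Finset.even_sum _ fun j _ => hy j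
  have h3 : Even (∑ v, (w v - G.communityDegree v)) := by
    rw [Finset.sum_tsub_distrib _ fun v _ => hyw v]
    exact hw.tsub h0
  have h2 : ∑ j, multidegree (G.communityEdges j) v = G.communityDegree v := by
    rw [Finset.sum_congr rfl fun j _ => multidegree_of_mem_support (hy j) (h.community j) v]
    simp
  rw [Graph.degree_eq, h2, multidegree_of_mem_support h3 h.background v]
  exact Nat.sub_add_cancel (hyw v)

end ABCD

namespace ABCD
open scoped ENNReal

theorem exists_leader {n : ℕ} (w : Fin n → ℕ) {A : Finset (Fin n)} (hA : A.Nonempty) :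
    ∃ v ∈ A, leader w A = some v ∧ ∀ u ∈ A, w u ≤ w v := by
  have h := (A.exists_max_image w hA).choose_spec
  exact ⟨_, h.1, by rw [leader, dif_pos hA], h.2⟩

/-! ### Random rounding -/

section rounding

theorem mean_randomRound (x : ℝ) (g : ℕ → ℝ≥0∞) :
    mean (randomRound x) g = ENNReal.ofReal (1 - Int.fract x) * g ⌊x⌋₊ +
      ENNReal.ofReal (Int.fract x) * g (⌊x⌋₊ + 1) := by
  rw [randomRound, mean_map, mean, tsum_fintype, Fintype.sum_bool, add_comm]
  simp [PMF.ofFintype_apply]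

theorem eq_of_mem_support_randomRound {x : ℝ} {r : ℕ} (h : r ∈ (randomRound x).support) :
    r = ⌊x⌋₊ ∨ (r = ⌊x⌋₊ + 1 ∧ Int.fract x ≠ 0) := by
  rw [randomRound, PMF.mem_support_map_iff] at h
  obtain ⟨b, hb, rfl⟩ := h
  rw [PMF.mem_support_ofFintype_iff] at hb
  cases b
  · simp
  · right
    refine ⟨by simp, fun h0 => hb ?_⟩
    simp [h0]

theorem natFloor_add_fract {x : ℝ} (hx : 0 ≤ x) : (⌊x⌋₊ : ℝ) = x - Int.fract x := by
  rw [natCast_floor_eq_intCast_floor hx, ← Int.self_sub_fract]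

theorem abs_sub_le_of_mem_support_randomRound {x : ℝ} (hx : 0 ≤ x) {r : ℕ}
    (h : r ∈ (randomRound x).support) : |(r : ℝ) - x| ≤ 1 := by
  have h1 := natFloor_add_fract hx
  have h2 := Int.fract_nonneg x
  have h3 := (Int.fract_lt_one x).le
  rcases eq_of_mem_support_randomRound h with rfl | ⟨rfl, _⟩
  · rw [abs_le]; constructor <;> linarith
  · push_cast; rw [abs_le]; constructor <;> linarith

theorem mean_randomRound_id {x : ℝ} (hx : 0 ≤ x) :
    mean (randomRound x) (fun r => ENNReal.ofReal r) = ENNReal.ofReal x := by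
  have h1 := natFloor_add_fract hx
  have h2 := Int.fract_nonneg x
  have h3 := (Int.fract_lt_one x).le
  rw [mean_randomRound, ← ENNReal.ofReal_mul (by linarith), ← ENNReal.ofReal_mul h2,
    ← ENNReal.ofReal_add (mul_nonneg (by linarith) (by positivity)) (by positivity)]
  congr 1
  push_cast
  rw [h1]; ring

/-- Random rounding is unbiased, so the linear term of exp x ≤ 1 + x + x² cancels and 1 + t² f (1 -
f) remains, f being the fractional part. -/
theorem mean_randomRound_exp_le {x t : ℝ} (hx : 0 ≤ x) (ht : |t| ≤ 1) :
    mean (randomRound x) (fun r => ENNReal.ofReal (Real.exp (t * (r - x)))) ≤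
      ENNReal.ofReal (Real.exp (t ^ 2)) := by
  have h1 := natFloor_add_fract hx
  set f := Int.fract x with hf
  have h2 : 0 ≤ f := Int.fract_nonneg x
  have h3 : f ≤ 1 := (Int.fract_lt_one x).le
  rw [mean_randomRound, ← hf, ← ENNReal.ofReal_mul (by linarith), ← ENNReal.ofReal_mul h2,
    ← ENNReal.ofReal_add (mul_nonneg (by linarith) (Real.exp_pos _).le) (by positivity)]
  apply ENNReal.ofReal_le_ofReal
  push_cast
  rw [h1, show x - f - x = -f by ring, show x - f + 1 - x = 1 - f by ring]
  have hb : ∀ u : ℝ, |u| ≤ 1 → Real.exp (t * u) ≤ 1 + t * u + t ^ 2 * u ^ 2 := by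
    intro u hu
    have h4 : |t * u| ≤ 1 := by
      rw [abs_mul]; exact mul_le_one₀ ht (abs_nonneg _) hu
    have := (abs_le.1 (Real.abs_exp_sub_one_sub_id_le h4)).2
    nlinarith
  have b1 := hb (-f) (by rw [abs_neg, abs_of_nonneg h2]; exact h3)
  have b2 := hb (1 - f) (by rw [abs_of_nonneg (by linarith)]; linarith)
  have h4 := Real.add_one_le_exp (t ^ 2)
  calc _ ≤ (1 - f) * (1 + t * -f + t ^ 2 * (-f) ^ 2) +
        f * (1 + t * (1 - f) + t ^ 2 * (1 - f) ^ 2) :=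
        add_le_add (mul_le_mul_of_nonneg_left b1 (by linarith)) (mul_le_mul_of_nonneg_left b2 h2)
    _ = 1 + t ^ 2 * (f * (1 - f)) := by ring
    _ ≤ 1 + t ^ 2 * 1 := by
        have : f * (1 - f) ≤ 1 := by nlinarith
        have := mul_le_mul_of_nonneg_left this (sq_nonneg t)
        linarith
    _ ≤ _ := by linarith

theorem outer_rounding_tail {n l : ℕ} (x : Fin n → ℝ) (hx : ∀ v, 0 ≤ x v) (σ : Fin n → Fin l)
    (j : Fin l) {y c : ℝ} (hc : 0 < c)
    (hcard : (∑ v, if σ v = j then (1 : ℝ) else 0) ≤ c) (hy : 0 ≤ y) (hyc : y ≤ 2 * c) :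
    (independent fun v => randomRound (x v)).toOuterMeasure
      {R | y ≤ |∑ v, if σ v = j then ((R v : ℝ) - x v) else 0|} ≤
      ENNReal.ofReal (2 * Real.exp (-(y ^ 2 / (4 * c)))) := by
  set t := y / (2 * c) with ht
  have ht0 : 0 ≤ t := by positivity
  have ht1 : t ≤ 1 := by rw [ht, div_le_one (by positivity)]; exact hyc
  -- The sign s = ±1 gives both tails at once; t is again the optimal exponent, now with variance
  -- bound c.
  have key : ∀ s : ℝ, |s| = 1 → (independent fun v => randomRound (x v)).toOuterMeasure
      {R | y ≤ ∑ v, if σ v = j then s * ((R v : ℝ) - x v) else 0} ≤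
      ENNReal.ofReal (Real.exp (-(y ^ 2 / (4 * c)))) := by
    intro s hs
    refine (outer_independent_tail (fun v => randomRound (x v))
      (fun v r => if σ v = j then s * ((r : ℝ) - x v) else 0)
      (fun v => if σ v = j then t ^ 2 else 0) ht0 fun v => ?_).trans ?_
    · by_cases h : σ v = j
      · simp only [h, if_true]
        have h1 := mean_randomRound_exp_le (hx v) (t := t * s)
          (by rw [abs_mul, hs, mul_one, abs_of_nonneg ht0]; exact ht1)
        rw [mul_pow, ← sq_abs s, hs, one_pow, mul_one] at h1
        simpa only [mul_assoc] using h1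
      · simp [h, mean_const]
    · apply ENNReal.ofReal_le_ofReal
      apply Real.exp_le_exp.2
      have : ∑ v, (if σ v = j then t ^ 2 else 0) ≤ t ^ 2 * c := by
        refine le_trans (le_of_eq ?_) (mul_le_mul_of_nonneg_left hcard (sq_nonneg t))
        rw [Finset.mul_sum]
        exact Finset.sum_congr rfl fun v _ => by split_ifs <;> simp
      have h2 : t ^ 2 * c - t * y = -(y ^ 2 / (4 * c)) := by
        rw [ht]; field_simp; ring
      linarith
  rw [two_mul, ENNReal.ofReal_add (Real.exp_pos _).le (Real.exp_pos _).le]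
  refine le_trans ?_ (add_le_add (key 1 (by simp)) (key (-1) (by simp)))
  refine le_trans (MeasureTheory.measure_mono fun R hR => ?_) (MeasureTheory.measure_union_le _ _)
  simp only [Set.mem_ofPred_eq, one_mul, neg_one_mul, Set.mem_union] at hR ⊢
  rcases le_abs.1 hR with h | h
  · exact Or.inl h
  · right
    rw [← Finset.sum_neg_distrib] at h
    refine h.trans_eq (Finset.sum_congr rfl fun v _ => ?_)
    split_ifs <;> simp

end rounding

/-! ### Splitting of the degrees and the leaders -/

section splitting
variable {n l : ℕ} {ξ : ℝ} {w : Fin n → ℕ} {σ : Fin n → Fin l}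

theorem abs_leaderDegree_sub_le {x : ℝ} (hx : 0 ≤ x) (S : ℕ) (coin : Bool) :
    |(leaderDegree x S coin : ℝ) - x| ≤ 1 := by
  have h1 := natFloor_add_fract hx
  have h2 := Int.fract_nonneg x
  have h3 := (Int.fract_lt_one x).le
  rw [leaderDegree]
  split_ifs with h4 h5
  · rw [abs_le]; constructor <;> linarith
  · rw [h5.1, sub_zero] at h1
    -- For x = 0 the subtraction is truncated and leaves 0, still within distance 1.
    rcases Nat.eq_zero_or_pos ⌊x⌋₊ with h6 | h6
    · rw [h6] at h1 ⊢
      simp at h1 ⊢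
      rw [← h1]; simp
    · rw [Nat.cast_sub h6, h1]; simp
  · push_cast; rw [abs_le]; constructor <;> linarith

/-- Positivity of x is essential: at x = 0 the truncated 0 - 1 would not change the parity. -/
theorem even_add_leaderDegree {x : ℝ} (hx : 0 < x) (S : ℕ) (coin : Bool) :
    Even (S + leaderDegree x S coin) := by
  rw [leaderDegree]
  split_ifs with h4 h5
  · exact h4
  · have h1 := natFloor_add_fract hx.le
    rw [h5.1, sub_zero] at h1
    have h6 : 0 < ⌊x⌋₊ := by exact_mod_cast h1 ▸ hx
    rw [Nat.not_even_iff_odd] at h4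
    rw [← Nat.add_sub_assoc h6]
    exact Nat.Odd.sub_odd h4 odd_one
  · rw [Nat.not_even_iff_odd] at h4
    exact h4.add_one

/-- The possible values of the rounding of `(1 - ξ) w`. -/
def roundings (ξ : ℝ) (w : Fin n → ℕ) : Set (Fin n → ℕ) :=
  (independent fun v => randomRound ((1 - ξ) * w v)).support

/-- As ξ > 0, even the value rounded up stays at most k. Hence w - y is a genuine subtraction for
nodes of positive degree. -/
theorem lt_of_rounding (hξ : 0 < ξ ∧ ξ < 1) {k : ℕ} (hk : 1 ≤ k) : ⌊(1 - ξ) * (k : ℝ)⌋₊ < k := by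
  have hk' : (1 : ℝ) ≤ k := by exact_mod_cast hk
  rw [Nat.floor_lt (mul_nonneg (by linarith) (by linarith))]
  nlinarith

theorem rounding_le (hξ : 0 < ξ ∧ ξ < 1) {R : Fin n → ℕ} (hR : R ∈ roundings ξ w) (v : Fin n) :
    R v ≤ w v := by
  have h1 := mem_support_of_independent hR v
  rcases Nat.eq_zero_or_pos (w v) with h0 | h0
  · rcases eq_of_mem_support_randomRound h1 with h | ⟨_, h⟩
    · rw [h, h0]; simp
    · rw [h0] at h; simp at h
  · have := lt_of_rounding hξ h0
    rcases eq_of_mem_support_randomRound h1 with h | ⟨h, _⟩ <;> omega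

theorem leaderDegree_le (hξ : 0 < ξ ∧ ξ < 1) (k S : ℕ) (coin : Bool) :
    leaderDegree ((1 - ξ) * k) S coin ≤ k + 1 ∧ (1 ≤ k → leaderDegree ((1 - ξ) * k) S coin ≤ k) := by
  have h1 : leaderDegree ((1 - ξ) * k) S coin ≤ ⌊(1 - ξ) * (k : ℝ)⌋₊ + 1 := by
    rw [leaderDegree]; split_ifs <;> omega
  have h2 : 1 ≤ k → leaderDegree ((1 - ξ) * k) S coin ≤ k := fun h => by
    have := lt_of_rounding hξ h
    omega
  refine ⟨?_, h2⟩
  rcases Nat.eq_zero_or_pos k with h0 | h0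
  · subst h0; simpa using h1
  · exact (h2 h0).trans (Nat.le_succ k)

theorem communityDegrees_le (hξ : 0 < ξ ∧ ξ < 1) {R : Fin n → ℕ} (hR : R ∈ roundings ξ w)
    (coin : Fin l → Bool) (v : Fin n) :
    communityDegrees ξ w σ R coin v ≤ w v + 1 ∧
      (1 ≤ w v → communityDegrees ξ w σ R coin v ≤ w v) := by
  have h1 := rounding_le hξ hR v
  simp only [communityDegrees]
  split_ifs
  · exact leaderDegree_le hξ _ _ _
  · exact ⟨h1.trans (Nat.le_succ _), fun _ => h1⟩

open Classical in
theorem exists_communityDegrees_eq (ξ : ℝ) (w : Fin n → ℕ) (R : Fin n → ℕ) (coin : Fin l → Bool)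
    {j : Fin l} (hne : (Finset.univ.filter fun u => σ u = j).Nonempty) :
    ∃ v₀, σ v₀ = j ∧ (∀ v, σ v = j → w v ≤ w v₀) ∧
      communityDegrees ξ w σ R coin v₀ = leaderDegree ((1 - ξ) * w v₀)
        (∑ u ∈ (Finset.univ.filter fun u => σ u = j).erase v₀, R u) (coin j) ∧
      ∀ v, σ v = j → v ≠ v₀ → communityDegrees ξ w σ R coin v = R v := by
  obtain ⟨v₀, h1, h2, h3⟩ := exists_leader w hne
  have h4 : σ v₀ = j := by simpa using h1
  refine ⟨v₀, h4, fun v hv => h3 v (by simpa using hv), ?_, ?_⟩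
  · simp only [communityDegrees, h4]
    rw [if_pos]
    · convert h2
  · intro v hv hvv
    simp only [communityDegrees, hv]
    rw [if_neg]
    intro h
    have h5 : leader w (Finset.univ.filter fun u => σ u = j) = some v := by convert h
    rw [h2] at h5
    exact hvv (Option.some.inj h5).symm

theorem sum_ite_eq_add {M : Type} [AddCommMonoid M] {j : Fin l} {v₀ : Fin n} (hv : σ v₀ = j)
    (f : Fin n → M) :
    (∑ v, if σ v = j then f v else 0) =
      f v₀ + ∑ u ∈ (Finset.univ.filter fun u => σ u = j).erase v₀, f u := by
  classical
  rw [← Finset.sum_filter, Finset.add_sum_erase]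
  simpa using hv

theorem even_communityDegrees (hξ : 0 < ξ ∧ ξ < 1) (R : Fin n → ℕ)
    (coin : Fin l → Bool) (j : Fin l) (hw : ∀ v, σ v = j → ∃ u, σ u = j ∧ 1 ≤ w u) :
    Even (∑ v, if σ v = j then communityDegrees ξ w σ R coin v else 0) := by
  classical
  rcases (Finset.univ.filter fun u => σ u = j).eq_empty_or_nonempty with h | h
  · rw [← Finset.sum_filter, h]; simp
  · obtain ⟨v₀, h1, h2, h3, h4⟩ := exists_communityDegrees_eq ξ w R coin h
    rw [sum_ite_eq_add h1, h3, add_comm]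
    rw [Finset.sum_congr rfl (g := R)]
    · obtain ⟨u, hu, hu1⟩ := hw v₀ h1
      have h5 : (1 : ℝ) ≤ w v₀ := by exact_mod_cast hu1.trans (h2 u hu)
      convert even_add_leaderDegree (x := (1 - ξ) * w v₀) (mul_pos (by linarith) (by linarith)) _
        (coin j)
    · intro u hu
      simp only [Finset.mem_erase, Finset.mem_filter, Finset.mem_univ, true_and] at hu
      exact h4 u hu.2 hu.1

/-- Only the leader departs from the independent rounding R, and both its values lie within 1 of (1
- ξ) w. -/
theorem abs_sum_communityDegrees_sub_le (hξ : 0 < ξ ∧ ξ < 1) {R : Fin n → ℕ}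
    (hR : R ∈ roundings ξ w) (coin : Fin l → Bool) (j : Fin l) :
    |(∑ v, if σ v = j then (communityDegrees ξ w σ R coin v : ℝ) else 0) -
      ∑ v, if σ v = j then (R v : ℝ) else 0| ≤ 2 := by
  classical
  rcases (Finset.univ.filter fun u => σ u = j).eq_empty_or_nonempty with h | h
  · simp only [← Finset.sum_filter, h]; simp
  · obtain ⟨v₀, h1, h2, h3, h4⟩ := exists_communityDegrees_eq ξ w R coin h
    have h5 : (∑ u ∈ (Finset.univ.filter fun u => σ u = j).erase v₀,
        (communityDegrees ξ w σ R coin u : ℝ)) =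
        ∑ u ∈ (Finset.univ.filter fun u => σ u = j).erase v₀, (R u : ℝ) := by
      refine Finset.sum_congr rfl fun u hu => ?_
      simp only [Finset.mem_erase, Finset.mem_filter, Finset.mem_univ, true_and] at hu
      rw [h4 u hu.2 hu.1]
    rw [sum_ite_eq_add h1, sum_ite_eq_add h1, h5, h3, add_sub_add_right_eq_sub]
    have hx : 0 ≤ (1 - ξ) * (w v₀ : ℝ) := mul_nonneg (by linarith) (by positivity)
    have a1 := abs_le.1 (abs_leaderDegree_sub_le hx
      (∑ u ∈ (Finset.univ.filter fun u => σ u = j).erase v₀, R u) (coin j))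
    have a2 := abs_le.1 (abs_sub_le_of_mem_support_randomRound hx (mem_support_of_independent hR v₀))
    rw [abs_le]
    constructor <;> linarith [a1.1, a1.2, a2.1, a2.2]

theorem mem_support_splitLaw {y : Fin n → ℕ} (hy : y ∈ (splitLaw ξ w σ).support) :
    ∃ R ∈ roundings ξ w, ∃ coin, y = communityDegrees ξ w σ R coin := by
  simp only [splitLaw, PMF.mem_support_bind_iff, PMF.mem_support_map_iff] at hy
  obtain ⟨R, hR, coin, _, rfl⟩ := hy
  exact ⟨R, hR, coin, rfl⟩

theorem outer_splitLaw_le (hξ : 0 < ξ ∧ ξ < 1) (j : Fin l) {y c : ℝ} (hc : 0 < c)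
    (hcard : (∑ v, if σ v = j then (1 : ℝ) else 0) ≤ c) (hy : 0 ≤ y) (hyc : y ≤ 2 * c) :
    (splitLaw ξ w σ).toOuterMeasure {Y | y + 2 ≤ |(∑ v, if σ v = j then (Y v : ℝ) else 0) -
      (1 - ξ) * ∑ v, if σ v = j then (w v : ℝ) else 0|} ≤
      ENNReal.ofReal (2 * Real.exp (-(y ^ 2 / (4 * c)))) := by
  have hx : ∀ v, 0 ≤ (1 - ξ) * (w v : ℝ) := fun v => mul_nonneg (by linarith) (by positivity)
  have h1 := outer_rounding_tail (fun v => (1 - ξ) * (w v : ℝ)) hx σ j hc hcard hy hyc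
  refine (outer_bind_le (b := 0) {R | y ≤ |∑ v, if σ v = j then
    ((R v : ℝ) - (1 - ξ) * (w v : ℝ)) else 0|}ᶜ fun R hR hG => ?_).trans ?_
  · rw [PMF.toOuterMeasure_map_apply, nonpos_iff_eq_zero, PMF.toOuterMeasure_apply_eq_zero_iff,
      Set.disjoint_left]
    intro coin _ hcoin
    apply hG
    simp only [Set.mem_preimage, Set.mem_ofPred_eq] at hcoin ⊢
    have h2 := abs_sum_communityDegrees_sub_le (σ := σ) hξ hR coin j
    have h3 : (∑ v, if σ v = j then ((R v : ℝ) - (1 - ξ) * (w v : ℝ)) else 0) =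
        (∑ v, if σ v = j then (R v : ℝ) else 0) -
          (1 - ξ) * ∑ v, if σ v = j then (w v : ℝ) else 0 := by
      rw [Finset.mul_sum, ← Finset.sum_sub_distrib]
      exact Finset.sum_congr rfl fun v _ => by split_ifs <;> simp
    rw [h3]
    have h4 := hcoin.trans (abs_sub_le _ (∑ v, if σ v = j then (R v : ℝ) else 0) _)
    linarith
  · rw [compl_compl, zero_add]
    exact h1

/-- The independent rounding has mean exactly (1 - ξ) w; the leader correction costs at most 2. -/
theorem mean_splitLaw_bounds (hξ : 0 < ξ ∧ ξ < 1) (j : Fin l) :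
    mean (splitLaw ξ w σ) (fun Y => ENNReal.ofReal (∑ v, if σ v = j then (Y v : ℝ) else 0)) ≤
      ENNReal.ofReal ((1 - ξ) * (∑ v, if σ v = j then (w v : ℝ) else 0) + 2) ∧
    ENNReal.ofReal ((1 - ξ) * (∑ v, if σ v = j then (w v : ℝ) else 0) - 2) ≤
      mean (splitLaw ξ w σ) (fun Y => ENNReal.ofReal (∑ v, if σ v = j then (Y v : ℝ) else 0)) := by
  have hx : ∀ v, 0 ≤ (1 - ξ) * (w v : ℝ) := fun v => mul_nonneg (by linarith) (by positivity)
  have h0 : mean (independent fun v => randomRound ((1 - ξ) * (w v : ℝ)))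
      (fun R => ENNReal.ofReal (∑ v, if σ v = j then (R v : ℝ) else 0)) =
      ENNReal.ofReal ((1 - ξ) * (∑ v, if σ v = j then (w v : ℝ) else 0)) := by
    have h1 : ∀ R : Fin n → ℕ, ENNReal.ofReal (∑ v, if σ v = j then (R v : ℝ) else 0) =
        ∑ v, if σ v = j then ENNReal.ofReal (R v : ℝ) else 0 := by
      intro R
      rw [ENNReal.ofReal_sum_of_nonneg fun v _ => by positivity]
      exact Finset.sum_congr rfl fun v _ => by split_ifs <;> simp
    simp only [h1]
    rw [mean_sum, Finset.mul_sum, ENNReal.ofReal_sum_of_nonneg fun v _ => by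
      split_ifs; exacts [hx v, by simp]]
    refine Finset.sum_congr rfl fun v _ => ?_
    split_ifs
    · rw [mean_independent_apply (fun v => randomRound ((1 - ξ) * (w v : ℝ))) v
        (fun r => ENNReal.ofReal (r : ℝ)), mean_randomRound_id (hx v)]
    · simp [mean_const]
  have hS : 0 ≤ (1 - ξ) * (∑ v, if σ v = j then (w v : ℝ) else 0) :=
    mul_nonneg (by linarith) (Finset.sum_nonneg fun v _ => by positivity)
  have hm : mean (splitLaw ξ w σ)
      (fun Y => ENNReal.ofReal (∑ v, if σ v = j then (Y v : ℝ) else 0)) =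
      mean (independent fun v => randomRound ((1 - ξ) * (w v : ℝ))) fun R =>
        mean (independent fun _ : Fin l => PMF.uniformOfFintype Bool) fun coin =>
          ENNReal.ofReal (∑ v, if σ v = j then (communityDegrees ξ w σ R coin v : ℝ) else 0) := by
    rw [splitLaw, mean_bind]
    simp only [mean_map]
  rw [hm]
  have h2 : ENNReal.ofReal 2 = mean (independent fun v => randomRound ((1 - ξ) * (w v : ℝ)))
      fun _ => ENNReal.ofReal 2 := (mean_const _ _).symm
  constructor
  · rw [ENNReal.ofReal_add hS (by norm_num), ← h0, h2, ← mean_add]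
    refine mean_mono fun R hR => ?_
    rw [← mean_const (independent fun _ : Fin l => PMF.uniformOfFintype Bool)
      (ENNReal.ofReal (∑ v, if σ v = j then (R v : ℝ) else 0) + ENNReal.ofReal 2)]
    refine mean_mono fun coin _ => ?_
    rw [← ENNReal.ofReal_add (Finset.sum_nonneg fun v _ => by positivity) (by norm_num)]
    apply ENNReal.ofReal_le_ofReal
    have := (abs_le.1 (abs_sum_communityDegrees_sub_le (σ := σ) hξ hR coin j)).2
    linarith
  · rw [ENNReal.ofReal_sub _ (by norm_num), tsub_le_iff_right, ← h0]
    rw [h2, ← mean_add]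
    refine mean_mono fun R hR => ?_
    rw [← mean_const (independent fun _ : Fin l => PMF.uniformOfFintype Bool) (ENNReal.ofReal 2),
      ← mean_add, ← mean_const (independent fun _ : Fin l => PMF.uniformOfFintype Bool)
      (ENNReal.ofReal (∑ v, if σ v = j then (R v : ℝ) else 0))]
    refine mean_mono fun coin _ => ?_
    rw [← ENNReal.ofReal_add (Finset.sum_nonneg fun v _ => by positivity) (by norm_num)]
    apply ENNReal.ofReal_le_ofReal
    have := (abs_le.1 (abs_sum_communityDegrees_sub_le (σ := σ) hξ hR coin j)).1
    linarith

end splitting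
end ABCD

namespace ABCD
open scoped ENNReal

/-! ### Parameter ranges and asymptotic comparisons -/

/-- The ranges of the parameters. -/
structure Params.Valid (P : Params) : Prop where
  two_lt_γ : 2 < P.γ
  γ_lt : P.γ < 3
  one_le_δ : 1 ≤ P.δ
  ζ_pos : 0 < P.ζ
  ζ_lt_one : P.ζ < 1
  one_lt_β : 1 < P.β
  β_lt : P.β < 2
  δ_lt_s : P.δ + 1 ≤ P.s
  ζ_lt_τ : P.ζ < P.τ
  τ_lt_one : P.τ < 1
  ξ_pos : 0 < P.ξ
  ξ_lt_one : P.ξ < 1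

section asymptotics

theorem tendsto_log_natCast : Tendsto (fun n : ℕ => Real.log n) atTop atTop :=
  Real.tendsto_log_atTop.comp tendsto_natCast_atTop_atTop

theorem eventually_le_log (C : ℝ) : ∀ᶠ n : ℕ in atTop, C ≤ Real.log n :=
  tendsto_log_natCast.eventually_ge_atTop C

theorem eventually_log_rpow_le (C a : ℝ) {b : ℝ} (hb : 0 < b) :
    ∀ᶠ n : ℕ in atTop, C * Real.log n ^ a ≤ (n : ℝ) ^ b := by
  have h := (isLittleO_log_rpow_rpow_atTop a hb).comp_tendsto
    (tendsto_natCast_atTop_atTop (R := ℝ))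
  have h1 := h.bound (show 0 < 1 / (|C| + 1) by positivity)
  filter_upwards [h1, eventually_le_log 0] with n hn hL
  simp only [Function.comp_apply, Real.norm_eq_abs] at hn
  have h2 : 0 ≤ Real.log n ^ a := Real.rpow_nonneg hL a
  have h3 : (0 : ℝ) ≤ (n : ℝ) ^ b := by positivity
  rw [abs_of_nonneg h2, abs_of_nonneg h3, div_mul_eq_mul_div, one_mul,
    le_div_iff₀ (by positivity)] at hn
  nlinarith [le_abs_self C]

theorem eventually_log_pow_le (C : ℝ) (a : ℕ) {b : ℝ} (hb : 0 < b) :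
    ∀ᶠ n : ℕ in atTop, C * Real.log n ^ a ≤ (n : ℝ) ^ b := by
  simpa using eventually_log_rpow_le C a hb

end asymptotics

/-! ### Power-law sums compared with integrals -/

section powerLaw

theorem mul_integral_rpow_le (e : ℝ) {k : ℕ} (hk : 1 ≤ k) :
    (k : ℝ) * (∫ x in (k : ℝ)..(k + 1 : ℕ), x ^ (-e)) ≤ ∫ x in (k : ℝ)..(k + 1 : ℕ), x ^ (1 - e) := by
  have h0 : (0 : ℝ) < k := by exact_mod_cast hk
  have h1 : (k : ℝ) ≤ (k + 1 : ℕ) := by push_cast; linarith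
  rw [← intervalIntegral.integral_const_mul]
  refine intervalIntegral.integral_mono_on h1 ((powerLaw_integrable h0 h1).const_mul _)
    (powerLaw_integrable h0 h1) fun x hx => ?_
  have hx0 : 0 < x := h0.trans_le hx.1
  rw [sub_eq_add_neg, Real.rpow_add hx0, Real.rpow_one]
  exact mul_le_mul_of_nonneg_right hx.1 (Real.rpow_nonneg hx0.le _)

/-- On [k, k+1] one has x ≤ k + 1 ≤ 2 k. Together with `mul_integral_rpow_le` this makes first
moments comparable with integrals of x^(1-e), which have a closed form. -/
theorem integral_rpow_le_two_mul (e : ℝ) {k : ℕ} (hk : 1 ≤ k) :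
    (∫ x in (k : ℝ)..(k + 1 : ℕ), x ^ (1 - e)) ≤
      2 * ((k : ℝ) * ∫ x in (k : ℝ)..(k + 1 : ℕ), x ^ (-e)) := by
  have h0 : (0 : ℝ) < k := by exact_mod_cast hk
  have h1 : (k : ℝ) ≤ (k + 1 : ℕ) := by push_cast; linarith
  rw [← mul_assoc, ← intervalIntegral.integral_const_mul]
  refine intervalIntegral.integral_mono_on h1 (powerLaw_integrable h0 h1)
    ((powerLaw_integrable h0 h1).const_mul _) fun x hx => ?_
  have hx0 : 0 < x := h0.trans_le hx.1
  rw [sub_eq_add_neg, Real.rpow_add hx0, Real.rpow_one]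
  refine mul_le_mul_of_nonneg_right ?_ (Real.rpow_nonneg hx0.le _)
  have := hx.2
  have : (1 : ℝ) ≤ k := by exact_mod_cast hk
  push_cast at *
  linarith

theorem sum_Ico_integral_rpow (e : ℝ) {a b : ℕ} (ha : 1 ≤ a) (hab : a ≤ b) :
    ∑ k ∈ Finset.Ico a b, (∫ x in (k : ℝ)..(k + 1 : ℕ), x ^ e) = ∫ x in (a : ℝ)..b, x ^ e := by
  refine intervalIntegral.sum_integral_adjacent_intervals_Ico (a := fun k : ℕ => (k : ℝ)) hab ?_
  intro k hk
  have hk1 : 1 ≤ k := ha.trans hk.1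
  exact powerLaw_integrable (by exact_mod_cast hk1) (by push_cast; linarith)

theorem integral_rpow_of_pos {e a b : ℝ} (he : e ≠ -1) (ha : 0 < a) (hab : a ≤ b) :
    ∫ x in a..b, x ^ e = (b ^ (e + 1) - a ^ (e + 1)) / (e + 1) := by
  rw [integral_rpow]
  right
  refine ⟨he, ?_⟩
  rw [Set.uIcc_of_le hab]
  exact fun h => absurd h.1 (not_le.2 ha)

end powerLaw

/-! ### Moments of the degree distribution -/

section degreeDistribution
variable {P : Params}

theorem Params.Valid.normalizer_pos (hP : P.Valid) :
    0 < ∫ x in (P.δ : ℝ)..(P.δ + 1 : ℕ), x ^ (-P.γ) :=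
  powerLaw_integral_pos (by exact_mod_cast hP.one_le_δ) (by push_cast; linarith)

/-- A constant for the tail of the first moment of the degree distribution. -/
noncomputable def Params.tailConst (P : Params) : ℝ :=
  1 / ((P.γ - 2) * ∫ x in (P.δ : ℝ)..(P.δ + 1 : ℕ), x ^ (-P.γ))

theorem Params.Valid.tailConst_pos (hP : P.Valid) : 0 < P.tailConst :=
  one_div_pos.2 (mul_pos (by linarith [hP.two_lt_γ]) hP.normalizer_pos)

/-- The summands are at most those of ∫ x^(1-γ), which add up to an integral from ⌈T⌉ of size at
most T^(-(γ-2)) / (γ-2). The normalizer is at least its part over [δ, δ+1], so the constant does not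
depend on D. -/
theorem sum_tail_le (hP : P.Valid) {D : ℕ} (hD : P.δ ≤ D) {T : ℝ} (hT : 0 < T) :
    ∑ k ∈ (Finset.Icc P.δ D).filter (fun k : ℕ => T ≤ k), (k : ℝ) * powerLawMass P.γ P.δ D k ≤
      P.tailConst * T ^ (-(P.γ - 2)) := by
  have hδ := hP.one_le_δ
  have hγ : 0 < P.γ - 2 := by linarith [hP.two_lt_γ]
  have hδ0 : (0 : ℝ) < P.δ := by exact_mod_cast hδ
  have hZ : (∫ x in (P.δ : ℝ)..(P.δ + 1 : ℕ), x ^ (-P.γ)) ≤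
      ∫ x in (P.δ : ℝ)..(D + 1 : ℕ), x ^ (-P.γ) := by
    rw [← sum_Ico_integral_rpow _ hδ (Nat.le_succ_of_le hD)]
    refine Finset.single_le_sum (f := fun k : ℕ => ∫ x in (k : ℝ)..(k + 1 : ℕ), x ^ (-P.γ))
      (fun k hk => ?_) (Finset.mem_Ico.2 ⟨le_rfl, Nat.lt_succ_of_le hD⟩)
    have hk1 : 1 ≤ k := hδ.trans (Finset.mem_Ico.1 hk).1
    exact (powerLaw_integral_pos (by exact_mod_cast hk1) (by push_cast; linarith)).le
  set Z0 := ∫ x in (P.δ : ℝ)..(P.δ + 1 : ℕ), x ^ (-P.γ) with hZ0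
  set Z := ∫ x in (P.δ : ℝ)..(D + 1 : ℕ), x ^ (-P.γ)
  have hZ0p : 0 < Z0 := hP.normalizer_pos
  have hT2 : 0 ≤ T ^ (-(P.γ - 2)) := Real.rpow_nonneg hT.le _
  have main : ∑ k ∈ (Finset.Icc P.δ D).filter (fun k : ℕ => T ≤ k),
      (k : ℝ) * (∫ x in (k : ℝ)..(k + 1 : ℕ), x ^ (-P.γ)) ≤ T ^ (-(P.γ - 2)) / (P.γ - 2) := by
    set m := ⌈T⌉₊ with hm
    have hm1 : 1 ≤ m := Nat.one_le_ceil_iff.2 hT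
    have hm0 : (0 : ℝ) < m := by exact_mod_cast hm1
    rcases le_total m (D + 1) with hmD | hmD
    · calc _ ≤ ∑ k ∈ (Finset.Icc P.δ D).filter (fun k : ℕ => T ≤ k),
            (∫ x in (k : ℝ)..(k + 1 : ℕ), x ^ (1 - P.γ)) := by
            refine Finset.sum_le_sum fun k hk => mul_integral_rpow_le _ ?_
            exact hδ.trans (Finset.mem_Icc.1 (Finset.mem_filter.1 hk).1).1
        _ ≤ ∑ k ∈ Finset.Ico m (D + 1), (∫ x in (k : ℝ)..(k + 1 : ℕ), x ^ (1 - P.γ)) := by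
            refine Finset.sum_le_sum_of_subset_of_nonneg (fun k hk => ?_) fun k hk _ => ?_
            · rw [Finset.mem_filter, Finset.mem_Icc] at hk
              exact Finset.mem_Ico.2 ⟨Nat.ceil_le.2 hk.2, Nat.lt_succ_of_le hk.1.2⟩
            · have hk1 : 1 ≤ k := hm1.trans (Finset.mem_Ico.1 hk).1
              exact (powerLaw_integral_pos (by exact_mod_cast hk1) (by push_cast; linarith)).le
        _ = ((m : ℝ) ^ (-(P.γ - 2)) - ((D + 1 : ℕ) : ℝ) ^ (-(P.γ - 2))) / (P.γ - 2) := by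
            rw [sum_Ico_integral_rpow _ hm1 hmD,
              integral_rpow_of_pos (by linarith) hm0 (by exact_mod_cast hmD),
              show 1 - P.γ + 1 = -(P.γ - 2) by ring, div_neg, ← neg_div, neg_sub]
        _ ≤ _ := by
            refine div_le_div_of_nonneg_right ?_ hγ.le
            have h1 : (m : ℝ) ^ (-(P.γ - 2)) ≤ T ^ (-(P.γ - 2)) :=
              Real.rpow_le_rpow_of_nonpos hT (Nat.le_ceil T) (by linarith)
            have h2 : (0 : ℝ) ≤ ((D + 1 : ℕ) : ℝ) ^ (-(P.γ - 2)) := by positivity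
            linarith
    · rw [Finset.sum_eq_zero]
      · positivity
      · intro k hk
        rw [Finset.mem_filter, Finset.mem_Icc] at hk
        have := Nat.ceil_le.2 hk.2
        omega
  calc _ = (∑ k ∈ (Finset.Icc P.δ D).filter (fun k : ℕ => T ≤ k),
      (k : ℝ) * (∫ x in (k : ℝ)..(k + 1 : ℕ), x ^ (-P.γ))) / Z := by
        rw [Finset.sum_div]
        exact Finset.sum_congr rfl fun k _ => by rw [powerLawMass, mul_div_assoc]
    _ ≤ (T ^ (-(P.γ - 2)) / (P.γ - 2)) / Z0 :=
        div_le_div₀ (by positivity) main hZ0p hZ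
    _ = _ := by
        rw [Params.tailConst, ← hZ0]
        field_simp

/-- Truncation loses nothing below T and at most k above it, which is the tail of the first moment.
-/
theorem sum_mul_min_ge (hP : P.Valid) {D : ℕ} (hD : P.δ ≤ D) {T : ℝ} (hT : 0 < T) :
    ∑ k ∈ Finset.Icc P.δ D, (k : ℝ) * powerLawMass P.γ P.δ D k - P.tailConst * T ^ (-(P.γ - 2)) ≤
      ∑ k ∈ Finset.Icc P.δ D, powerLawMass P.γ P.δ D k * min (k : ℝ) T := by
  have h := sum_tail_le hP hD hT
  rw [Finset.sum_filter] at h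
  have h2 : ∑ k ∈ Finset.Icc P.δ D, (k : ℝ) * powerLawMass P.γ P.δ D k ≤
      ∑ k ∈ Finset.Icc P.δ D, (powerLawMass P.γ P.δ D k * min (k : ℝ) T +
        if T ≤ (k : ℝ) then (k : ℝ) * powerLawMass P.γ P.δ D k else 0) := by
    refine Finset.sum_le_sum fun k hk => ?_
    have h3 := powerLawMass_nonneg (e := P.γ) hP.one_le_δ hk
    split_ifs with h4
    · rw [min_eq_right h4]
      have := mul_nonneg h3 hT.le
      linarith
    · rw [min_eq_left (not_le.1 h4).le]
      linarith
  rw [Finset.sum_add_distrib] at h2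
  linarith

theorem meanDegree_le (hP : P.Valid) {n : ℕ} (hD : P.δ ≤ P.maxDegree n) :
    P.meanDegree n ≤ P.tailConst := by
  have h := sum_tail_le hP hD one_pos
  rw [Real.one_rpow, mul_one, Finset.filter_true_of_mem] at h
  · exact h
  · intro k hk
    exact_mod_cast hP.one_le_δ.trans (Finset.mem_Icc.1 hk).1

theorem one_le_meanDegree (hP : P.Valid) {n : ℕ} (hD : P.δ ≤ P.maxDegree n) :
    1 ≤ P.meanDegree n := by
  rw [Params.meanDegree, ← sum_powerLawMass_real P.γ hP.one_le_δ hD]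
  refine Finset.sum_le_sum fun k hk => ?_
  have h1 : (1 : ℝ) ≤ k := by exact_mod_cast hP.one_le_δ.trans (Finset.mem_Icc.1 hk).1
  exact le_mul_of_one_le_left (powerLawMass_nonneg hP.one_le_δ hk) h1

/-- A lower bound on the probability of the smallest degree. -/
noncomputable def Params.lowMass (P : Params) : ℝ :=
  (P.γ - 1) * ∫ x in (P.δ : ℝ)..(P.δ + 1 : ℕ), x ^ (-P.γ)

theorem Params.Valid.lowMass_pos (hP : P.Valid) : 0 < P.lowMass :=
  mul_pos (by linarith [hP.two_lt_γ]) hP.normalizer_pos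

/-- The normalizer is at most 1/(γ-1) whatever D is, because δ ≥ 1. -/
theorem lowMass_le (hP : P.Valid) {D : ℕ} (hD : P.δ ≤ D) :
    P.lowMass ≤ powerLawMass P.γ P.δ D P.δ := by
  have hγ : 0 < P.γ - 1 := by linarith [hP.two_lt_γ]
  have hδ0 : (0 : ℝ) < P.δ := by exact_mod_cast hP.one_le_δ
  have hδD : (P.δ : ℝ) < (D + 1 : ℕ) := by exact_mod_cast Nat.lt_succ_of_le hD
  have hZ : (∫ x in (P.δ : ℝ)..(D + 1 : ℕ), x ^ (-P.γ)) ≤ 1 / (P.γ - 1) := by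
    rw [integral_rpow_of_pos (by linarith) hδ0 hδD.le, show -P.γ + 1 = -(P.γ - 1) by ring, div_neg,
      ← neg_div, neg_sub]
    refine div_le_div_of_nonneg_right ?_ hγ.le
    have h1 : (P.δ : ℝ) ^ (-(P.γ - 1)) ≤ 1 :=
      Real.rpow_le_one_of_one_le_of_nonpos (by exact_mod_cast hP.one_le_δ) (by linarith)
    have h2 : (0 : ℝ) ≤ ((D + 1 : ℕ) : ℝ) ^ (-(P.γ - 1)) := by positivity
    linarith
  rw [powerLawMass, le_div_iff₀ (powerLaw_integral_pos hδ0 hδD), Params.lowMass]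
  calc _ ≤ (P.γ - 1) * (∫ x in (P.δ : ℝ)..(P.δ + 1 : ℕ), x ^ (-P.γ)) * (1 / (P.γ - 1)) :=
        mul_le_mul_of_nonneg_left hZ (mul_pos hγ hP.normalizer_pos).le
    _ = _ := by field_simp

end degreeDistribution

/-! ### Concentration of additive functions of the degrees -/

section concentration

/-- The second moment is replaced by b times the first, since f² ≤ b f. The bound thus needs only a
finite mean, and the power law has no bounded variance for γ < 3. -/
theorem mean_powerLaw_exp_le {e : ℝ} {a N : ℕ} (ha : 0 < a) (haN : a ≤ N) {f : ℕ → ℝ} {b C t : ℝ}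
    (hf : ∀ k ∈ Finset.Icc a N, 0 ≤ f k ∧ f k ≤ b) (htb : |t| * b ≤ 1)
    (hC : ∑ k ∈ Finset.Icc a N, powerLawMass e a N k * f k ≤ C) (hb : 0 ≤ b) :
    mean (powerLaw e a N) (fun k => ENNReal.ofReal (Real.exp (t * f k))) ≤
      ENNReal.ofReal (Real.exp (t * (∑ k ∈ Finset.Icc a N, powerLawMass e a N k * f k) +
        t ^ 2 * b * C)) := by
  rw [mean_powerLaw_ofReal ha haN _ fun k => (Real.exp_pos _).le]
  apply ENNReal.ofReal_le_ofReal
  refine le_trans ?_ (Real.add_one_le_exp _)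
  calc _ ≤ ∑ k ∈ Finset.Icc a N, powerLawMass e a N k * (1 + t * f k + t ^ 2 * b * f k) := by
        refine Finset.sum_le_sum fun k hk =>
          mul_le_mul_of_nonneg_left ?_ (powerLawMass_nonneg ha hk)
        obtain ⟨h1, h2⟩ := hf k hk
        have h3 : |t * f k| ≤ 1 := by
          rw [abs_mul, abs_of_nonneg h1]
          exact (mul_le_mul_of_nonneg_left h2 (abs_nonneg t)).trans htb
        have h4 := (abs_le.1 (Real.abs_exp_sub_one_sub_id_le h3)).2
        have h5 : (t * f k) ^ 2 ≤ t ^ 2 * b * f k := by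
          rw [mul_pow, pow_two (f k), mul_assoc (t ^ 2)]
          exact mul_le_mul_of_nonneg_left (mul_le_mul_of_nonneg_right h2 h1) (sq_nonneg t)
        linarith
    _ = 1 + t * (∑ k ∈ Finset.Icc a N, powerLawMass e a N k * f k) +
        t ^ 2 * b * (∑ k ∈ Finset.Icc a N, powerLawMass e a N k * f k) := by
        have h1 := sum_powerLawMass_real e ha haN
        conv_rhs => rw [← h1]
        rw [Finset.mul_sum, Finset.mul_sum, ← Finset.sum_add_distrib, ← Finset.sum_add_distrib]
        exact Finset.sum_congr rfl fun k _ => by ring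
    _ ≤ _ := by
        have := mul_le_mul_of_nonneg_left hC (mul_nonneg (sq_nonneg t) hb)
        linarith

theorem outer_powerLaw_tail {e : ℝ} {a N n : ℕ} (ha : 0 < a) (haN : a ≤ N) {f : ℕ → ℝ}
    {b C y : ℝ} (hf : ∀ k ∈ Finset.Icc a N, 0 ≤ f k ∧ f k ≤ b)
    (hC : ∑ k ∈ Finset.Icc a N, powerLawMass e a N k * f k ≤ C) (hb : 0 < b) (hC0 : 0 < C)
    (hy : 0 ≤ y) (hyC : y ≤ 2 * C) :
    (independent fun _ : Fin n => powerLaw e a N).toOuterMeasure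
      {v | n * y ≤ |∑ i, f (v i) - n * ∑ k ∈ Finset.Icc a N, powerLawMass e a N k * f k|} ≤
      ENNReal.ofReal (2 * Real.exp (-(n * y ^ 2 / (4 * b * C)))) := by
  set M := ∑ k ∈ Finset.Icc a N, powerLawMass e a N k * f k with hM
  set t := y / (2 * b * C) with ht
  have ht0 : 0 ≤ t := by positivity
  have htb : t * b ≤ 1 := by
    rw [ht, div_mul_eq_mul_div, div_le_one (by positivity)]; nlinarith
  have key : ∀ s : ℝ, |s| = 1 → (independent fun _ : Fin n => powerLaw e a N).toOuterMeasure
      {v | n * y + n * (s * M) ≤ ∑ i, s * f (v i)} ≤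
      ENNReal.ofReal (Real.exp (-(n * y ^ 2 / (4 * b * C)))) := by
    intro s hs
    refine (outer_independent_tail (fun _ => powerLaw e a N) (fun _ k => s * f k)
      (fun _ => t * s * M + t ^ 2 * b * C) ht0 fun i => ?_).trans (le_of_eq ?_)
    · have h1 := mean_powerLaw_exp_le (e := e) (t := t * s) ha haN hf
        (by rw [abs_mul, hs, mul_one, abs_of_nonneg ht0]; exact htb) hC hb.le
      rw [mul_pow, ← sq_abs s, hs, one_pow, mul_one] at h1
      simpa only [mul_assoc] using h1
    · congr 2
      rw [Finset.sum_const, Finset.card_univ, Fintype.card_fin, nsmul_eq_mul, ht]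
      field_simp; ring
  rw [two_mul, ENNReal.ofReal_add (Real.exp_pos _).le (Real.exp_pos _).le]
  refine le_trans ?_ (add_le_add (key 1 (by simp)) (key (-1) (by simp)))
  refine le_trans (MeasureTheory.measure_mono fun R hR => ?_) (MeasureTheory.measure_union_le _ _)
  simp only [Set.mem_ofPred_eq, one_mul, neg_one_mul, Set.mem_union, Finset.sum_neg_distrib] at hR ⊢
  rcases le_abs.1 hR with h | h
  · left; linarith
  · right; linarith

end concentration

/-! ### The parity correction -/

section fixParity
variable {n : ℕ} (w : Fin n → ℕ)

theorem fixParity_le (v : Fin n) : fixParity w v ≤ w v := by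
  rw [fixParity]; split_ifs <;> omega

theorem sum_le_sum_fixParity_add_one {f : ℕ → ℝ} (hf : ∀ k, f k ≤ f (k - 1) + 1) :
    ∑ v, f (w v) ≤ ∑ v, f (fixParity w v) + 1 := by
  classical
  have h1 : ∀ v, f (w v) ≤ f (fixParity w v) + if leader w Finset.univ = some v then 1 else 0 := by
    intro v
    rw [fixParity]
    by_cases h : leader w Finset.univ = some v
    · by_cases h2 : Odd (∑ u, w u)
      · rw [if_pos ⟨h2, h⟩, if_pos h]; exact hf _
      · rw [if_neg (fun h3 => h2 h3.1), if_pos h]; linarith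
    · rw [if_neg (fun h3 => h h3.2), if_neg h]; linarith
  have h2 : ∑ v, (if leader w Finset.univ = some v then (1 : ℝ) else 0) ≤ 1 := by
    rcases h : leader w Finset.univ with _ | v₀
    · simp
    · simp
  have h3 := Finset.sum_le_sum fun v (_ : v ∈ Finset.univ) => h1 v
  rw [Finset.sum_add_distrib] at h3
  linarith

/-- All drawn degrees are at least 1, so only the one corrected node can reach 0. -/
theorem fixParity_zeros (hw : ∀ v, 1 ≤ w v) {u v : Fin n} (hu : fixParity w u = 0)
    (hv : fixParity w v = 0) : u = v := by
  have key : ∀ u, fixParity w u = 0 → leader w Finset.univ = some u := by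
    intro u hu
    rw [fixParity] at hu
    split_ifs at hu with h
    · exact h.2
    · have := hw u; omega
  have := (key u hu).symm.trans (key v hv)
  exact Option.some.inj this

theorem even_sum_fixParity : Even (∑ v, fixParity w v) := by
  classical
  by_cases h : Odd (∑ u, w u)
  · have hne : (Finset.univ : Finset (Fin n)).Nonempty := by
      rw [Finset.nonempty_iff_ne_empty]
      intro h0
      rw [h0] at h
      simp at h
    obtain ⟨v₀, -, h1, h2⟩ := exists_leader w hne
    -- An odd sum forces the largest degree to be positive, so the subtraction is not truncated and
    -- does change the parity.
    have h3 : 1 ≤ w v₀ := by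
      by_contra h4
      have h5 : ∑ u, w u = 0 := Finset.sum_eq_zero fun u hu => by have := h2 u hu; omega
      rw [h5] at h
      simp at h
    have h4 : ∑ v, fixParity w v + 1 = ∑ v, w v := by
      rw [← Finset.add_sum_erase _ (fixParity w) (Finset.mem_univ v₀),
        ← Finset.add_sum_erase _ w (Finset.mem_univ v₀),
        Finset.sum_congr rfl (g := fun v => w v)]
      · have : fixParity w v₀ = w v₀ - 1 := by rw [fixParity, if_pos ⟨h, h1⟩]
        omega
      · intro v hv
        rw [fixParity, if_neg]
        rintro ⟨_, h5⟩
        rw [h1] at h5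
        exact (Finset.mem_erase.1 hv).1 (Option.some.inj h5).symm
    rw [← h4] at h
    exact Nat.not_odd_iff_even.1 fun h6 => Nat.not_even_iff_odd.2 h h6.add_one
  · have : fixParity w = w := funext fun v => by rw [fixParity, if_neg fun h2 => h h2.1]
    rw [this]
    exact Nat.not_odd_iff_even.1 h

end fixParity
end ABCD

namespace ABCD
open scoped ENNReal

/-! ### Typical degree sequences -/

/-- The truncation of the degrees that makes the tail of their sum `O(n (log n)^{-2})`. -/
noncomputable def Params.cutoff (P : Params) (n : ℕ) : ℝ := Real.log n ^ (2 / (P.γ - 2))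

/-- The typical properties of the degree sequence. -/
structure GoodDegrees (P : Params) (n : ℕ) (w : Fin n → ℕ) : Prop where
  le_maxDegree : ∀ v, w v ≤ P.maxDegree n
  even_sum : Even (∑ v, w v)
  zeros : ∀ u v, w u = 0 → w v = 0 → u = v
  sum_le : ∑ v, (w v : ℝ) ≤ n * P.meanDegree n + n / Real.log n ^ 2
  sum_min_log_ge : n * P.meanDegree n - (P.tailConst + 2) * n * Real.log n ^ (-(P.γ - 2)) ≤
    ∑ v, min (w v : ℝ) (Real.log n)
  sum_min_cutoff_ge : n * P.meanDegree n - (P.tailConst + 2) * n / Real.log n ^ 2 ≤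
    ∑ v, min (w v : ℝ) (P.cutoff n)
  low_ge : P.lowMass / 2 * n ≤ ∑ v, if w v ≤ P.δ then (1 : ℝ) else 0

variable {P : Params}

theorem maxDegree_le (P : Params) (n : ℕ) : (P.maxDegree n : ℝ) ≤ (n : ℝ) ^ P.ζ :=
  Nat.floor_le (by positivity)

theorem eventually_le_maxDegree (hP : P.Valid) (k : ℕ) : ∀ᶠ n in atTop, k ≤ P.maxDegree n := by
  have := (tendsto_rpow_atTop hP.ζ_pos).comp tendsto_natCast_atTop_atTop (α := ℕ)
  filter_upwards [this.eventually_ge_atTop (k : ℝ)] with n hn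
  exact Nat.le_floor hn

/-- The bound on the deviation probability of additive functions of the degrees. -/
theorem eventually_outer_degrees_tail_le (hP : P.Valid) : ∀ᶠ n : ℕ in atTop, ∀ f : ℕ → ℝ,
    (∀ k ∈ Finset.Icc P.δ (P.maxDegree n), 0 ≤ f k ∧ f k ≤ k) →
    (independent fun _ : Fin n => powerLaw P.γ P.δ (P.maxDegree n)).toOuterMeasure
      {v | n / Real.log n ^ 2 ≤ |∑ i, f (v i) - n * ∑ k ∈ Finset.Icc P.δ (P.maxDegree n),
        powerLawMass P.γ P.δ (P.maxDegree n) k * f k|} ≤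
      ENNReal.ofReal (2 * Real.exp (-(2 * Real.log n ^ 2))) := by
  filter_upwards [eventually_le_maxDegree hP P.δ, eventually_le_log 1, eventually_ge_atTop 1,
    eventually_log_pow_le (8 * P.tailConst) 6 (show 0 < 1 - P.ζ by linarith [hP.ζ_lt_one])]
    with n hD hL hn hlog f hf
  have hδ := hP.one_le_δ
  have hD1 : (1 : ℝ) ≤ P.maxDegree n := by exact_mod_cast hδ.trans hD
  have hC := hP.tailConst_pos
  have hC1 : 1 ≤ P.tailConst := (one_le_meanDegree hP hD).trans (meanDegree_le hP hD)
  have hn0 : (0 : ℝ) < n := by exact_mod_cast hn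
  have hy : 1 / Real.log n ^ 2 ≤ 1 := by
    rw [div_le_one (by positivity)]; exact one_le_pow₀ hL
  have h := outer_powerLaw_tail (e := P.γ) (n := n) (y := 1 / Real.log n ^ 2) (b := P.maxDegree n)
    (C := P.tailConst) hδ hD (f := f)
    (fun k hk => ⟨(hf k hk).1, (hf k hk).2.trans (by exact_mod_cast (Finset.mem_Icc.1 hk).2)⟩)
    ?_ (by linarith) hC (by positivity) (by linarith)
  · rw [mul_one_div] at h
    refine h.trans (ENNReal.ofReal_le_ofReal ?_)
    refine mul_le_mul_of_nonneg_left (Real.exp_le_exp.2 (neg_le_neg ?_)) (by norm_num)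
    rw [le_div_iff₀ (by positivity)]
    have h1 : (n : ℝ) = (n : ℝ) ^ (1 - P.ζ) * (n : ℝ) ^ P.ζ := by
      rw [← Real.rpow_add hn0]; simp
    -- This says exactly that the exponent n / (4 (log n)^4 D C) is at least 2 (log n)²; it holds
    -- because D ≤ n^ζ with ζ < 1.
    have h2 : 8 * P.tailConst * Real.log n ^ 6 * P.maxDegree n ≤ n := by
      conv_rhs => rw [h1]
      exact mul_le_mul hlog (maxDegree_le P n) (by linarith) (by positivity)
    have h3 : 0 < Real.log n := by linarith
    rw [div_pow, one_pow, mul_one_div, le_div_iff₀ (by positivity)]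
    calc _ = 8 * P.tailConst * Real.log n ^ 6 * P.maxDegree n := by ring
      _ ≤ n := h2
  · refine le_trans (Finset.sum_le_sum fun k hk => ?_) (meanDegree_le hP hD)
    rw [mul_comm]
    exact mul_le_mul_of_nonneg_right (hf k hk).2 (powerLawMass_nonneg hδ hk)

theorem min_le_min_pred_add_one (T : ℝ) (k : ℕ) :
    min (k : ℝ) T ≤ min ((k - 1 : ℕ) : ℝ) T + 1 := by
  have h : (k : ℝ) ≤ ((k - 1 : ℕ) : ℝ) + 1 := by exact_mod_cast (by omega : k ≤ k - 1 + 1)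
  rcases le_total ((k - 1 : ℕ) : ℝ) T with h1 | h1
  · rw [min_eq_left h1]; exact (min_le_left _ _).trans h
  · rw [min_eq_right h1]; exact (min_le_right _ _).trans (by linarith)

/-- A union bound over four additive functions: the degree, its truncations at log n and at the
cutoff, and the indicator of degree at most δ. The parity correction shifts each sum by at most 1 or
in the favourable direction. -/
theorem eventually_goodDegrees (hP : P.Valid) : ∀ᶠ n : ℕ in atTop,
    (degreeLaw P n).toOuterMeasure {w | GoodDegrees P n w}ᶜ ≤
      ENNReal.ofReal (Real.exp (-(Real.log n ^ 2))) := by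
  have hγ : 0 < P.γ - 2 := by linarith [hP.two_lt_γ]
  filter_upwards [eventually_le_maxDegree hP P.δ, eventually_le_log 3, eventually_ge_atTop 1,
    eventually_outer_degrees_tail_le hP, eventually_log_pow_le 1 2 one_pos,
    tendsto_log_natCast.eventually_ge_atTop (2 / P.lowMass)]
    with n hD hL hn hdev hlog hlow
  have hL1 : 1 ≤ Real.log n := by linarith
  have hL0 : 0 < Real.log n := by linarith
  have hδ := hP.one_le_δ
  have hC := hP.tailConst_pos
  have hn0 : (0 : ℝ) < n := by exact_mod_cast hn
  have hcut : 0 < P.cutoff n := Real.rpow_pos_of_pos hL0 _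
  rw [one_mul, Real.rpow_one] at hlog
  set D := P.maxDegree n with hDdef
  let q := powerLawMass P.γ P.δ D
  -- Lets the parity correction hide in a second copy of n / (log n)²; hence the 2 in `tailConst +
  -- 2`.
  have hn1 : 1 ≤ n / Real.log n ^ 2 := by rwa [le_div_iff₀ (by positivity), one_mul]
  let B : (ℕ → ℝ) → Set (Fin n → ℕ) := fun f => {v | n / Real.log n ^ 2 ≤
    |∑ i, f (v i) - n * ∑ k ∈ Finset.Icc P.δ D, q k * f k|}
  let f1 : ℕ → ℝ := fun k => k
  let f2 : ℕ → ℝ := fun k => min (k : ℝ) (Real.log n)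
  let f3 : ℕ → ℝ := fun k => min (k : ℝ) (P.cutoff n)
  let f4 : ℕ → ℝ := fun k => if k ≤ P.δ then 1 else 0
  have b1 := hdev f1 fun k _ => ⟨Nat.cast_nonneg k, le_rfl⟩
  have b2 := hdev f2 fun k _ => ⟨le_min (Nat.cast_nonneg k) hL0.le, min_le_left _ _⟩
  have b3 := hdev f3 fun k _ => ⟨le_min (Nat.cast_nonneg k) hcut.le, min_le_left _ _⟩
  have b4 := hdev f4 fun k hk => by
    have h1 : (1 : ℝ) ≤ k := by exact_mod_cast hδ.trans (Finset.mem_Icc.1 hk).1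
    simp only [f4]
    split_ifs
    · exact ⟨zero_le_one, h1⟩
    · exact ⟨le_rfl, by linarith⟩
  have hB : (independent fun _ : Fin n => powerLaw P.γ P.δ D).toOuterMeasure
      (B f1 ∪ B f2 ∪ (B f3 ∪ B f4)) ≤ ENNReal.ofReal (Real.exp (-(Real.log n ^ 2))) := by
    -- Four events of probability at most 2 exp(-2 (log n)²) each.
    have h8 : 8 * Real.exp (-(2 * Real.log n ^ 2)) ≤ Real.exp (-(Real.log n ^ 2)) := by
      have h9 : (8 : ℝ) ≤ Real.exp (Real.log n ^ 2) := by
        have := Real.add_one_le_exp (Real.log n ^ 2)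
        nlinarith
      calc _ ≤ Real.exp (Real.log n ^ 2) * Real.exp (-(2 * Real.log n ^ 2)) :=
            mul_le_mul_of_nonneg_right h9 (Real.exp_pos _).le
        _ = _ := by rw [← Real.exp_add]; ring_nf
    refine le_trans ?_ (ENNReal.ofReal_le_ofReal h8)
    refine (MeasureTheory.measure_union_le _ _).trans ((add_le_add
      ((MeasureTheory.measure_union_le _ _).trans (add_le_add b1 b2))
      ((MeasureTheory.measure_union_le _ _).trans (add_le_add b3 b4))).trans (le_of_eq ?_))
    rw [← ENNReal.ofReal_add (by positivity) (by positivity),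
      ← ENNReal.ofReal_add (by positivity) (by positivity)]
    ring_nf
  rw [degreeLaw, PMF.toOuterMeasure_map_apply]
  refine (outer_le_of_imp _ fun w hw hbad => ?_).trans hB
  by_contra hnot
  apply hbad
  have hwI : ∀ v, w v ∈ Finset.Icc P.δ D := fun v =>
    mem_Icc_of_mem_support_powerLaw hδ hD (mem_support_of_independent hw v)
  simp only [B, Set.mem_union, Set.mem_ofPred_eq, not_or, not_le] at hnot
  obtain ⟨⟨n1, n2⟩, n3, n4⟩ := hnot
  rw [abs_lt] at n1 n2 n3 n4
  have hmean : ∑ k ∈ Finset.Icc P.δ D, q k * f1 k = P.meanDegree n := by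
    rw [Params.meanDegree]
    exact Finset.sum_congr rfl fun k _ => mul_comm _ _
  have hmin : ∀ T : ℝ, 0 < T → P.meanDegree n - P.tailConst * T ^ (-(P.γ - 2)) ≤
      ∑ k ∈ Finset.Icc P.δ D, q k * min (k : ℝ) T := fun T hT => sum_mul_min_ge hP hD hT
  -- As γ - 2 ≤ 2, the deviation n / (log n)² is absorbed in the truncation error n (log
  -- n)^(-(γ-2)).
  have hlt : Real.log n ^ 2 * Real.log n ^ (-(P.γ - 2)) ≥ 1 := by
    rw [← Real.rpow_two, ← Real.rpow_add hL0]
    exact Real.one_le_rpow hL1 (by linarith [hP.γ_lt])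
  refine ⟨fun v => (fixParity_le w v).trans (Finset.mem_Icc.1 (hwI v)).2,
    even_sum_fixParity w, fun u v => fixParity_zeros w
      (fun v => hδ.trans (Finset.mem_Icc.1 (hwI v)).1), ?_, ?_, ?_, ?_⟩
  · have h1 : ∑ v, (fixParity w v : ℝ) ≤ ∑ v, f1 (w v) :=
      Finset.sum_le_sum fun v _ => Nat.cast_le.2 (fixParity_le w v)
    rw [hmean] at n1
    linarith [n1.2]
  · have h1 := sum_le_sum_fixParity_add_one w (min_le_min_pred_add_one (Real.log n))
    have h2 := mul_le_mul_of_nonneg_left (hmin _ hL0) hn0.le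
    have h3 : n / Real.log n ^ 2 ≤ n * Real.log n ^ (-(P.γ - 2)) := by
      rw [div_le_iff₀ (by positivity)]
      nlinarith
    have h4 := n2.1
    simp only [f2] at h4
    nlinarith
  · have h1 := sum_le_sum_fixParity_add_one w (min_le_min_pred_add_one (P.cutoff n))
    have h2 := mul_le_mul_of_nonneg_left (hmin _ hcut) hn0.le
    have h3 : P.cutoff n ^ (-(P.γ - 2)) = 1 / Real.log n ^ 2 := by
      rw [Params.cutoff, ← Real.rpow_mul hL0.le, show 2 / (P.γ - 2) * -(P.γ - 2) = -2 by
        field_simp, Real.rpow_neg hL0.le, Real.rpow_two, one_div]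
    rw [h3] at h2
    have h4 := n3.1
    simp only [f3] at h4
    have h5 : (P.tailConst + 2) * n / Real.log n ^ 2 =
        n * (P.tailConst * (1 / Real.log n ^ 2)) + 2 * (n / Real.log n ^ 2) := by
      field_simp
    linarith
  · have h1 : ∑ v, f4 (w v) ≤ ∑ v, if fixParity w v ≤ P.δ then (1 : ℝ) else 0 := by
      refine Finset.sum_le_sum fun v _ => ?_
      simp only [f4]
      have := fixParity_le w v
      split_ifs <;> first | omega | norm_num
    have h2 : P.lowMass ≤ ∑ k ∈ Finset.Icc P.δ D, q k * f4 k := by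
      refine (lowMass_le hP hD).trans ?_
      have := Finset.single_le_sum (f := fun k => q k * f4 k) (s := Finset.Icc P.δ D)
        (fun k hk => mul_nonneg (powerLawMass_nonneg hδ hk) (by simp only [f4]; split_ifs <;> norm_num))
        (Finset.mem_Icc.2 ⟨le_rfl, hD⟩)
      simpa [f4] using this
    have h3 := mul_le_mul_of_nonneg_left h2 hn0.le
    have h4 : n / Real.log n ^ 2 ≤ P.lowMass / 2 * n := by
      rw [div_le_iff₀ (by positivity)]
      have h5 := hP.lowMass_pos
      rw [div_le_iff₀ h5] at hlow
      have h6 : (2 : ℝ) ≤ Real.log n ^ 2 * P.lowMass := by nlinarith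
      nlinarith
    linarith [n4.1]

end ABCD

namespace ABCD
open scoped ENNReal

/-! ### Community sizes: the stopping rule and the final adjustment -/

section oldCommunities

theorem sum_oldCommunities_lt : ∀ {n : ℕ} (l : List ℕ), 0 < n → (oldCommunities n l).sum < n
  | n, [], hn => by simpa [oldCommunities] using hn
  | n, x :: l, hn => by
    rw [oldCommunities]
    split_ifs with h
    · have := sum_oldCommunities_lt (n := n - x) l (by omega)
      rw [List.sum_cons]; omega
    · simpa using hn

theorem oldCommunities_prefix : ∀ (n : ℕ) (l : List ℕ), oldCommunities n l <+: l
  | n, [] => by simp [oldCommunities]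
  | n, x :: l => by
    rw [oldCommunities]
    split_ifs with h
    · exact List.cons_prefix_cons.2 ⟨rfl, oldCommunities_prefix _ l⟩
    · exact List.nil_prefix

/-- The next size, at most S, would have closed the gap. -/
theorem le_sum_oldCommunities_add : ∀ {n : ℕ} {l : List ℕ} {S : ℕ}, n ≤ l.sum → (∀ x ∈ l, x ≤ S) →
    n ≤ (oldCommunities n l).sum + S
  | n, [], S, h, _ => by simp at h; omega
  | n, x :: l, S, h, hS => by
    rw [oldCommunities]
    rw [List.sum_cons] at h
    split_ifs with hx
    · have := le_sum_oldCommunities_add (n := n - x) (l := l) (S := S) (by omega)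
        fun y hy => hS y (List.mem_cons_of_mem _ hy)
      rw [List.sum_cons]; omega
    · have := hS x List.mem_cons_self
      simp; omega

end oldCommunities

/-- The total size of the communities of size less than `t`. -/
noncomputable def smallMass (t : ℝ) (c : List ℕ) : ℝ :=
  (c.map fun x : ℕ => if (x : ℝ) < t then (x : ℝ) else 0).sum

theorem smallMass_eq_sum (t : ℝ) (c : List ℕ) :
    smallMass t c = ∑ j : Fin c.length, if (c.get j : ℝ) < t then (c.get j : ℝ) else 0 := by
  rw [smallMass]
  conv_lhs => rw [← List.ofFn_get c]
  rw [List.map_ofFn, List.sum_ofFn]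
  rfl

theorem smallMass_append (t : ℝ) (c c' : List ℕ) :
    smallMass t (c ++ c') = smallMass t c + smallMass t c' := by
  simp [smallMass]

/-- The typical properties of the community sizes. -/
structure GoodSizes (P : Params) (n : ℕ) (θ : ℝ) (c : List ℕ) : Prop where
  sum_eq : c.sum = n
  s_le : ∀ x ∈ c, P.s ≤ x
  smallMass_le : smallMass (P.veryLargeThreshold n) c ≤ θ * n

theorem goodSizes_append {P : Params} {n : ℕ} {θ : ℝ} {c : List ℕ}
    (hlt : c.sum < n) (hs : ∀ x ∈ c, P.s ≤ x) (hsn : P.s ≤ n - c.sum)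
    (hm : smallMass (P.veryLargeThreshold n) c + max (P.veryLargeThreshold n) 0 ≤ θ * n) :
    GoodSizes P n θ (c ++ [n - c.sum]) := by
  refine ⟨by simp; omega, fun x hx => ?_, ?_⟩
  · rcases List.mem_append.1 hx with h | h
    · exact hs x h
    · rw [List.mem_singleton.1 h]; exact hsn
  · rw [smallMass_append]
    refine le_trans ?_ hm
    gcongr
    simp only [smallMass, List.map_cons, List.map_nil, List.sum_singleton]
    split_ifs with h
    · exact h.le.trans (le_max_left _ _)
    · exact le_max_right _ _

/-- Growing by one at most doubles a size, and can only lift a community over the threshold, so the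
mass below it at most doubles. -/
theorem goodSizes_grow {P : Params} {n : ℕ} {θ : ℝ} {c : List ℕ}
    (hlt : c.sum < n) (hs : ∀ x ∈ c, P.s ≤ x) (hs1 : 1 ≤ P.s) {T : Finset (Fin c.length)}
    (hT : T.card = n - c.sum)
    (hm : 2 * smallMass (P.veryLargeThreshold n) c ≤ θ * n) :
    GoodSizes P n θ (List.ofFn fun j : Fin c.length => c.get j + if j ∈ T then 1 else 0) := by
  have hget : ∀ j, P.s ≤ c.get j := fun j => hs _ (List.get_mem c j)
  refine ⟨?_, fun x hx => ?_, ?_⟩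
  · have h1 : ∑ j, c.get j = c.sum := by
      conv_rhs => rw [← List.ofFn_get c]
      rw [List.sum_ofFn]
    rw [List.sum_ofFn, Finset.sum_add_distrib, h1]
    simp [hT]
    omega
  · rw [List.mem_ofFn] at hx
    obtain ⟨j, rfl⟩ := hx
    exact (hget j).trans (Nat.le_add_right _ _)
  · refine le_trans ?_ hm
    rw [smallMass_eq_sum _ c, smallMass, List.map_ofFn, List.sum_ofFn, Finset.mul_sum]
    refine Finset.sum_le_sum fun j _ => ?_
    have h1 : (1 : ℝ) ≤ c.get j := by exact_mod_cast hs1.trans (hget j)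
    simp only [Function.comp_apply]
    have h2 : ((c.get j : ℕ) : ℝ) ≤ ((c.get j + if j ∈ T then 1 else 0 : ℕ) : ℝ) := by
      exact_mod_cast Nat.le_add_right _ _
    have h3 : ((c.get j + if j ∈ T then 1 else 0 : ℕ) : ℝ) ≤ 2 * c.get j := by
      push_cast; split_ifs <;> linarith
    by_cases h4 : ((c.get j + if j ∈ T then 1 else 0 : ℕ) : ℝ) < P.veryLargeThreshold n
    · rw [if_pos h4, if_pos (h2.trans_lt h4)]; exact h3
    · rw [if_neg h4]; split_ifs <;> linarith

/-! ### Mass of the communities below a threshold -/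

section sizes

/-- With the scale 1/S every exponent is at most 1 in absolute value. A size below t then adds at
most 2k/S to the exponential, and a size above t removes at least θk/(2S). -/
theorem sizes_exp_pointwise {S k t θ : ℝ} (hk : 0 ≤ k) (hkS : k ≤ S) (hS : 0 < S)
    (hθ : 0 ≤ θ) (hθ2 : θ ≤ 1 / 2) :
    Real.exp (1 / S * ((if k < t then k else 0) - θ * k)) ≤
      1 + 2 / S * (if k < t then k else 0) - θ / (2 * S) * (if k < t then 0 else k) := by
  have hkS1 : k / S ≤ 1 := (div_le_one hS).2 hkS
  have hkS0 : 0 ≤ k / S := by positivity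
  split_ifs with h
  · have e1 : 1 / S * (k - θ * k) = (1 - θ) * (k / S) := by field_simp
    have e2 : 1 + 2 / S * k - θ / (2 * S) * 0 = 1 + 2 * (k / S) := by field_simp; ring
    rw [e1, e2]
    have h1 : 0 ≤ (1 - θ) * (k / S) := mul_nonneg (by linarith) hkS0
    have h2 : (1 - θ) * (k / S) ≤ k / S := mul_le_of_le_one_left hkS0 (by linarith)
    have h3 := (abs_le.1 (Real.abs_exp_sub_one_sub_id_le
      (abs_le.2 ⟨by linarith, h2.trans hkS1⟩))).2
    nlinarith
  · have e1 : 1 / S * (0 - θ * k) = -(θ * (k / S)) := by field_simp; ring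
    have e2 : 1 + 2 / S * 0 - θ / (2 * S) * k = 1 - θ * (k / S) / 2 := by field_simp; ring
    rw [e1, e2]
    have h1 : 0 ≤ θ * (k / S) := by positivity
    have h2 : θ * (k / S) ≤ 1 / 2 := (mul_le_of_le_one_right hθ hkS1).trans hθ2
    have h3 := (abs_le.1 (Real.abs_exp_sub_one_sub_id_le (x := -(θ * (k / S)))
      (abs_le.2 ⟨by linarith, by linarith⟩))).2
    nlinarith

/-- If the mean contribution of sizes below t is at most θ/4 times that of the others, the gains do
not outweigh the losses: the exponential of (mass below t - θ · mass)/S is a supermartingale along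
the draws. -/
theorem mean_sizes_exp_le {β : ℝ} {s S : ℕ} (hs : 0 < s) (hsS : s ≤ S) {t θ : ℝ}
    (hθ : 0 ≤ θ) (hθ2 : θ ≤ 1 / 2)
    (h : 4 * ∑ k ∈ Finset.Icc s S, powerLawMass β s S k * (if (k : ℝ) < t then (k : ℝ) else 0) ≤
      θ * ∑ k ∈ Finset.Icc s S, powerLawMass β s S k * (if (k : ℝ) < t then 0 else (k : ℝ))) :
    mean (powerLaw β s S) (fun k => ENNReal.ofReal
      (Real.exp (1 / S * ((if (k : ℝ) < t then (k : ℝ) else 0) - θ * k)))) ≤ 1 := by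
  have hS0 : (0 : ℝ) < S := by exact_mod_cast hs.trans_le hsS
  rw [mean_powerLaw_ofReal hs hsS _ fun k => (Real.exp_pos _).le, ENNReal.ofReal_le_one]
  set E1 := ∑ k ∈ Finset.Icc s S, powerLawMass β s S k * (if (k : ℝ) < t then (k : ℝ) else 0)
    with hE1
  set E2 := ∑ k ∈ Finset.Icc s S, powerLawMass β s S k * (if (k : ℝ) < t then 0 else (k : ℝ))
    with hE2
  calc _ ≤ ∑ k ∈ Finset.Icc s S, powerLawMass β s S k *
        (1 + 2 / S * (if (k : ℝ) < t then (k : ℝ) else 0) -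
          θ / (2 * S) * (if (k : ℝ) < t then 0 else (k : ℝ))) := by
        refine Finset.sum_le_sum fun k hk =>
          mul_le_mul_of_nonneg_left ?_ (powerLawMass_nonneg hs hk)
        exact sizes_exp_pointwise (Nat.cast_nonneg k)
          (by exact_mod_cast (Finset.mem_Icc.1 hk).2) hS0 hθ hθ2
    _ = 1 + 2 / S * E1 - θ / (2 * S) * E2 := by
        have h1 := sum_powerLawMass_real β hs hsS
        conv_rhs => rw [← h1]
        rw [hE1, hE2, Finset.mul_sum, Finset.mul_sum, ← Finset.sum_add_distrib,
          ← Finset.sum_sub_distrib]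
        exact Finset.sum_congr rfl fun k _ => by ring
    _ = 1 + (4 * E1 - θ * E2) / (2 * S) := by field_simp; ring
    _ ≤ 1 := by
        have : (4 * E1 - θ * E2) / (2 * S) ≤ 0 :=
          div_nonpos_of_nonpos_of_nonneg (by linarith) (by positivity)
        linarith

/-- Comparison with ∫ x^(1-β): the first moment below t is of order t^(2-β), and the rest is of
order S^(2-β) as β < 2. -/
theorem sizes_moment_comparison {β : ℝ} (hβ : β < 2) {s S : ℕ} (hs : 0 < s) (hsS : s ≤ S)
    {t θ : ℝ} (hst : (s : ℝ) ≤ t) (htS : t ≤ S) (hθ : 0 ≤ θ) (hθ1 : θ ≤ 1)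
    (h : 9 * (⌈t⌉₊ : ℝ) ^ (2 - β) ≤ θ / 2 * (S + 1 : ℕ) ^ (2 - β)) :
    4 * ∑ k ∈ Finset.Icc s S, powerLawMass β s S k * (if (k : ℝ) < t then (k : ℝ) else 0) ≤
      θ * ∑ k ∈ Finset.Icc s S, powerLawMass β s S k * (if (k : ℝ) < t then 0 else (k : ℝ)) := by
  have hs0 : (0 : ℝ) < s := by exact_mod_cast hs
  have hb : 0 < 2 - β := by linarith
  set Z := ∫ x in (s : ℝ)..(S + 1 : ℕ), x ^ (-β) with hZ
  have hZ0 : 0 < Z := powerLaw_integral_pos hs0 (by exact_mod_cast Nat.lt_succ_of_le hsS)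
  set m := ⌈t⌉₊ with hm
  have hsm : s ≤ m := by
    have : (s : ℝ) ≤ m := hst.trans (Nat.le_ceil t)
    exact_mod_cast this
  have hmS : m ≤ S := Nat.ceil_le.2 htS
  have hkm : ∀ k : ℕ, (k : ℝ) < t ↔ k < m := fun k => Nat.lt_ceil.symm
  simp only [hkm]
  have hI : ∀ k ∈ Finset.Icc s S, 0 ≤ ∫ x in (k : ℝ)..(k + 1 : ℕ), x ^ (-β) := by
    intro k hk
    have hk1 : 0 < k := hs.trans_le (Finset.mem_Icc.1 hk).1
    exact (powerLaw_integral_pos (by exact_mod_cast hk1) (by push_cast; linarith)).le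
  have hm0 : (0 : ℝ) < m := by exact_mod_cast hs.trans_le hsm
  have up : ∑ k ∈ Finset.Icc s S, powerLawMass β s S k * (if k < m then (k : ℝ) else 0) ≤
      (m : ℝ) ^ (2 - β) / (2 - β) / Z := by
    rw [le_div_iff₀ hZ0, Finset.sum_mul]
    calc _ = ∑ k ∈ Finset.Icc s S, if k < m then
          (k : ℝ) * (∫ x in (k : ℝ)..(k + 1 : ℕ), x ^ (-β)) else 0 := by
          refine Finset.sum_congr rfl fun k _ => ?_
          rw [powerLawMass, ← hZ]
          split_ifs
          · field_simp
          · simp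
      _ = ∑ k ∈ Finset.Ico s m, (k : ℝ) * (∫ x in (k : ℝ)..(k + 1 : ℕ), x ^ (-β)) := by
          rw [← Finset.sum_filter]
          congr 1
          ext k
          simp only [Finset.mem_filter, Finset.mem_Icc, Finset.mem_Ico]
          omega
      _ ≤ ∑ k ∈ Finset.Ico s m, (∫ x in (k : ℝ)..(k + 1 : ℕ), x ^ (1 - β)) :=
          Finset.sum_le_sum fun k hk => mul_integral_rpow_le _ (hs.trans_le (Finset.mem_Ico.1 hk).1)
      _ = ((m : ℝ) ^ (2 - β) - (s : ℝ) ^ (2 - β)) / (2 - β) := by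
          rw [sum_Ico_integral_rpow _ hs hsm, integral_rpow_of_pos (by linarith) hs0
            (by exact_mod_cast hsm), show 1 - β + 1 = 2 - β by ring]
      _ ≤ _ := by
          refine div_le_div_of_nonneg_right ?_ hb.le
          have : (0 : ℝ) ≤ (s : ℝ) ^ (2 - β) := by positivity
          linarith
  have lo : ((S + 1 : ℕ) ^ (2 - β) - (m : ℝ) ^ (2 - β)) / (2 - β) / Z ≤
      2 * ∑ k ∈ Finset.Icc s S, powerLawMass β s S k * (if k < m then 0 else (k : ℝ)) := by
    rw [div_le_iff₀ hZ0, mul_assoc, Finset.sum_mul]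
    calc _ = ∑ k ∈ Finset.Ico m (S + 1), (∫ x in (k : ℝ)..(k + 1 : ℕ), x ^ (1 - β)) := by
          rw [sum_Ico_integral_rpow _ (hs.trans_le hsm) (Nat.le_succ_of_le hmS),
            integral_rpow_of_pos (by linarith) hm0 (by exact_mod_cast Nat.le_succ_of_le hmS),
            show 1 - β + 1 = 2 - β by ring]
      _ ≤ ∑ k ∈ Finset.Ico m (S + 1), 2 * ((k : ℝ) * (∫ x in (k : ℝ)..(k + 1 : ℕ), x ^ (-β))) :=
          Finset.sum_le_sum fun k hk =>
            integral_rpow_le_two_mul _ ((hs.trans_le hsm).trans_le (Finset.mem_Ico.1 hk).1)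
      _ = 2 * ∑ k ∈ Finset.Icc s S, if k < m then 0 else
          (k : ℝ) * (∫ x in (k : ℝ)..(k + 1 : ℕ), x ^ (-β)) := by
          rw [← Finset.mul_sum]
          congr 1
          rw [Finset.sum_congr rfl fun k _ => (ite_not (k < m)
            ((k : ℝ) * (∫ x in (k : ℝ)..(k + 1 : ℕ), x ^ (-β))) 0).symm, ← Finset.sum_filter]
          congr 1
          ext k
          simp only [Finset.mem_filter, Finset.mem_Icc, Finset.mem_Ico]
          omega
      _ = _ := by
          congr 1
          refine Finset.sum_congr rfl fun k _ => ?_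
          rw [powerLawMass, ← hZ]
          split_ifs
          · simp
          · field_simp
  -- The 8 is the desired 4 times the factor 2 lost in `lo`; the ninth copy in the hypothesis pays
  -- for the subtracted m^(2-β).
  have h1 : 8 * ((m : ℝ) ^ (2 - β) / (2 - β) / Z) ≤
      θ * (((S + 1 : ℕ) ^ (2 - β) - (m : ℝ) ^ (2 - β)) / (2 - β) / Z) := by
    rw [← mul_div_assoc, ← mul_div_assoc, ← mul_div_assoc, ← mul_div_assoc]
    refine div_le_div_of_nonneg_right (div_le_div_of_nonneg_right ?_ hb.le) hZ0.le
    have h2 : (0 : ℝ) ≤ (m : ℝ) ^ (2 - β) := by positivity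
    have h3 : θ * (m : ℝ) ^ (2 - β) ≤ (m : ℝ) ^ (2 - β) := mul_le_of_le_one_left h2 hθ1
    have h4 : (0 : ℝ) ≤ θ * (S + 1 : ℕ) ^ (2 - β) := by positivity
    linarith
  have h2 := mul_le_mul_of_nonneg_left lo hθ
  linarith

/-- The number of sizes used depends on the sizes themselves. A union bound over all prefix lengths
avoids a stopping-time argument, at the price of a factor n + 1. -/
theorem outer_prefix_le {β : ℝ} {s S n : ℕ} (hs : 0 < s) (hsS : s ≤ S) {t θ : ℝ}
    (hθ : 0 ≤ θ) (hθ2 : θ ≤ 1 / 2)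
    (h : 4 * ∑ k ∈ Finset.Icc s S, powerLawMass β s S k * (if (k : ℝ) < t then (k : ℝ) else 0) ≤
      θ * ∑ k ∈ Finset.Icc s S, powerLawMass β s S k * (if (k : ℝ) < t then 0 else (k : ℝ))) :
    (independent fun _ : Fin n => powerLaw β s S).toOuterMeasure
      {X | ∃ m ≤ n, θ * n ≤ ∑ i : Fin n, if i.val < m then
        ((if (X i : ℝ) < t then (X i : ℝ) else 0) - θ * X i) else 0} ≤
      ENNReal.ofReal ((n + 1) * Real.exp (-(θ * n / S))) := by
  have hS0 : (0 : ℝ) < S := by exact_mod_cast hs.trans_le hsS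
  let A : ℕ → Set (Fin n → ℕ) := fun m => {X | θ * n ≤ ∑ i : Fin n, if i.val < m then
        ((if (X i : ℝ) < t then (X i : ℝ) else 0) - θ * X i) else 0}
  have hA : ∀ m, (independent fun _ : Fin n => powerLaw β s S).toOuterMeasure (A m) ≤
      ENNReal.ofReal (Real.exp (-(θ * n / S))) := by
    intro m
    refine (outer_independent_tail (fun _ : Fin n => powerLaw β s S)
      (fun i k => if i.val < m then ((if (k : ℝ) < t then (k : ℝ) else 0) - θ * k) else 0)
      (fun _ => 0) (l := 1 / S) (by positivity) fun i => ?_).trans (le_of_eq ?_)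
    · by_cases hi : i.val < m
      · simp only [hi, if_true, Real.exp_zero, ENNReal.ofReal_one]
        exact mean_sizes_exp_le hs hsS hθ hθ2 h
      · simp [hi, mean_const]
    · congr 2
      simp; field_simp
  have hsub : {X : Fin n → ℕ | ∃ m ≤ n, θ * n ≤ ∑ i : Fin n, if i.val < m then
        ((if (X i : ℝ) < t then (X i : ℝ) else 0) - θ * X i) else 0} ⊆
      ⋃ m ∈ Finset.range (n + 1), A m := by
    rintro X ⟨m, hm, hX⟩
    simp only [Set.mem_iUnion, Finset.mem_range]
    exact ⟨m, Nat.lt_succ_of_le hm, hX⟩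
  refine (MeasureTheory.measure_mono hsub).trans
    ((MeasureTheory.measure_biUnion_finset_le _ _).trans
      ((Finset.sum_le_sum fun m _ => hA m).trans (le_of_eq ?_)))
  rw [Finset.sum_const, Finset.card_range, nsmul_eq_mul, ENNReal.ofReal_mul (by positivity)]
  congr 1
  rw [ENNReal.ofReal_add (by positivity) zero_le_one]
  simp

end sizes
end ABCD

namespace ABCD
open scoped ENNReal
variable {P : Params}

/-! ### Typical community sizes -/

theorem map_take_ofFn_sum {n : ℕ} (X : Fin n → ℕ) (f : ℕ → ℝ) (m : ℕ) :
    (((List.ofFn X).take m).map f).sum = ∑ i : Fin n, if i.val < m then f (X i) else 0 := by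
  rw [List.map_take, List.map_ofFn, List.sum_take_ofFn, Finset.sum_filter]
  rfl

theorem sum_map_sub_mul (f : ℕ → ℝ) (θ : ℝ) (l : List ℕ) :
    (l.map fun k : ℕ => f k - θ * k).sum = (l.map f).sum - θ * (l.sum : ℕ) := by
  induction l with
  | nil => simp
  | cons x l ih => simp only [List.map_cons, List.sum_cons, ih, Nat.cast_add]; ring

/-- The old communities form a prefix of total size below n, so their mass below t is at most θ
times this total plus θ n. -/
theorem smallMass_oldCommunities_le {n : ℕ} (hn : 0 < n) {t θ : ℝ} (hθ : 0 ≤ θ) {X : Fin n → ℕ}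
    (h : ∀ m ≤ n, (∑ i : Fin n, if i.val < m then
        ((if (X i : ℝ) < t then (X i : ℝ) else 0) - θ * X i) else 0) < θ * n) :
    smallMass t (oldCommunities n (List.ofFn X)) ≤ 2 * θ * n := by
  set old := oldCommunities n (List.ofFn X) with hold
  have hpre : old = (List.ofFn X).take old.length :=
    List.prefix_iff_eq_take.1 (oldCommunities_prefix _ _)
  have hlen : old.length ≤ n := by
    simpa using (oldCommunities_prefix n (List.ofFn X)).length_le
  have h1 := h _ hlen
  rw [← map_take_ofFn_sum X (fun k => (if (k : ℝ) < t then (k : ℝ) else 0) - θ * k), ← hpre,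
    sum_map_sub_mul (fun k => if (k : ℝ) < t then (k : ℝ) else 0)] at h1
  have h2 : ((old.sum : ℕ) : ℝ) ≤ n := by
    exact_mod_cast (sum_oldCommunities_lt (List.ofFn X) hn).le
  have h3 := mul_le_mul_of_nonneg_left h2 hθ
  rw [smallMass]
  linarith

/-- Outside the bad prefix event every branch of the construction ends with good sizes: a last
community adds at most t to the mass below t, and growing doubles that mass at most. -/
theorem outer_sizeLaw_le {n : ℕ} (hn : 0 < n) (hs1 : 1 ≤ P.s) (hsS' : P.s ≤ P.maxSize n)
    {θ θ' : ℝ} (hθ0 : 0 ≤ θ) (ht0 : 0 ≤ P.veryLargeThreshold n)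
    (hθn : 4 * θ * n + P.veryLargeThreshold n ≤ θ' * n) (hsn : P.s * P.maxSize n < n) :
    (sizeLaw P n).toOuterMeasure {x | ∃ c, x = some c ∧ GoodSizes P n θ' c}ᶜ ≤
      (independent fun _ : Fin n => powerLaw P.β P.s (P.maxSize n)).toOuterMeasure
      {X | ∃ m ≤ n, θ * n ≤ ∑ i : Fin n, if i.val < m then
        ((if (X i : ℝ) < P.veryLargeThreshold n then (X i : ℝ) else 0) - θ * X i) else 0} := by
  set S := P.maxSize n with hS
  set t := P.veryLargeThreshold n with ht
  have hn0 : (0 : ℝ) < n := by exact_mod_cast hn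
  have hθn0 : 0 ≤ θ * n := by positivity
  rw [sizeLaw]
  refine (outer_bind_le (b := 0) {X | ∃ m ≤ n, θ * n ≤ ∑ i : Fin n, if i.val < m then
        ((if (X i : ℝ) < t then (X i : ℝ) else 0) - θ * X i) else 0}ᶜ fun X hX hG => ?_).trans
    (le_of_eq (by rw [compl_compl, zero_add]))
  rw [Set.mem_compl_iff, Set.mem_ofPred_eq] at hG
  push Not at hG
  have hXI : ∀ i, X i ∈ Finset.Icc P.s S := fun i =>
    mem_Icc_of_mem_support_powerLaw hs1 hsS' (mem_support_of_independent hX i)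
  have hmass := smallMass_oldCommunities_le hn hθ0 hG
  have hlt := sum_oldCommunities_lt (List.ofFn X) hn
  have hmem : ∀ x ∈ oldCommunities n (List.ofFn X), x ∈ Finset.Icc P.s S := by
    intro x hx
    obtain ⟨i, rfl⟩ := List.mem_ofFn.1 ((oldCommunities_prefix n (List.ofFn X)).subset hx)
    exact hXI i
  have hge : n ≤ (oldCommunities n (List.ofFn X)).sum + S := by
    refine le_sum_oldCommunities_add ?_ fun x hx => ?_
    · rw [List.sum_ofFn]
      calc n = ∑ _i : Fin n, 1 := by simp
        _ ≤ ∑ i, X i := Finset.sum_le_sum fun i _ => hs1.trans (Finset.mem_Icc.1 (hXI i)).1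
    · obtain ⟨i, rfl⟩ := List.mem_ofFn.1 hx
      exact (Finset.mem_Icc.1 (hXI i)).2
  set old := oldCommunities n (List.ofFn X) with hold
  have hs : ∀ x ∈ old, P.s ≤ x := fun x hx => (Finset.mem_Icc.1 (hmem x hx)).1
  -- The old communities and one more of size at most S cover n > s S, so at least s of them are
  -- old. In the growing branch fewer than s units are distributed, hence that branch cannot fail.
  have hlen : P.s ≤ old.length := by
    by_contra hcon
    have h1 : old.sum ≤ old.length • S := List.sum_le_card_nsmul _ _ fun x hx =>
      (Finset.mem_Icc.1 (hmem x hx)).2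
    have h2 : n ≤ P.s * S := by
      rw [smul_eq_mul] at h1
      have : (old.length + 1) * S ≤ P.s * S := Nat.mul_le_mul_right _ (by omega)
      linarith
    omega
  simp only
  split_ifs with h1 h2
  · rw [PMF.toOuterMeasure_pure_apply, if_neg]
    rw [Set.notMem_compl_iff]
    refine ⟨_, rfl, goodSizes_append hlt hs h1 ?_⟩
    rw [max_eq_left ht0]
    linarith
  · rw [PMF.toOuterMeasure_map_apply, nonpos_iff_eq_zero, PMF.toOuterMeasure_apply_eq_zero_iff,
      Set.disjoint_left]
    intro T hT hbad
    rw [PMF.mem_support_uniformOfFinset_iff, Finset.mem_powersetCard] at hT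
    apply hbad
    refine ⟨_, rfl, goodSizes_grow hlt hs hs1 hT.2 ?_⟩
    linarith
  · exact absurd (Finset.powersetCard_nonempty.2 (by
      rw [Finset.card_univ, Fintype.card_fin]; omega)) h2

-- At t = n^ζ (log n)^4 the ratio of the two first moments is n^(-(τ-ζ)(2-β)) up to logarithms, so θ
-- = n^(-η) is possible for a small η. The failure probability is then (n+1) exp(-θ n / S), where θ
-- n / S is at least n^(1-η-τ).
set_option maxHeartbeats 800000 in
theorem exists_eventually_goodSizes (hP : P.Valid) : ∃ ε : ℝ, 0 < ε ∧ ∀ᶠ n : ℕ in atTop,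
    (sizeLaw P n).toOuterMeasure {x | ∃ c, x = some c ∧ GoodSizes P n ((n : ℝ) ^ (-ε)) c}ᶜ ≤
      ENNReal.ofReal (Real.exp (-(Real.log n ^ 2))) := by
  have hβ : 0 < 2 - P.β := by linarith [hP.β_lt]
  have hτζ : 0 < P.τ - P.ζ := by linarith [hP.ζ_lt_τ]
  have hτ0 : 0 < P.τ := hP.ζ_pos.trans hP.ζ_lt_τ
  have hτ1 : 0 < 1 - P.τ := by linarith [hP.τ_lt_one]
  have hs1 : 1 ≤ P.s := by have := hP.δ_lt_s; omega
  -- The first bound leaves half the moment exponent to beat the logarithms; the second keeps 1 - η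
  -- - τ positive.
  obtain ⟨η, hη, hη1, hη2⟩ : ∃ η : ℝ, 0 < η ∧ η ≤ (P.τ - P.ζ) * (2 - P.β) / 2 ∧ η ≤ (1 - P.τ) / 2 :=
    ⟨min ((P.τ - P.ζ) * (2 - P.β) / 2) ((1 - P.τ) / 2),
      lt_min (half_pos (mul_pos hτζ hβ)) (half_pos hτ1), min_le_left _ _,
      min_le_right _ _⟩
  -- Passing from n^(-η) to n^(-η/2) absorbs the factor 4 and the threshold t of the last community.
  refine ⟨η / 2, by positivity, ?_⟩
  have hgap : 0 < (P.τ - P.ζ) * (2 - P.β) - η := by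
    have : 0 < (P.τ - P.ζ) * (2 - P.β) := mul_pos hτζ hβ
    linarith
  have hgap2 : 0 < 1 - η / 2 - P.ζ := by linarith
  have hgap3 : 0 < 1 - η - P.τ := by linarith
  filter_upwards [eventually_ge_atTop 1, eventually_le_log (P.s + 2),
    eventually_log_pow_le 8 0 (show 0 < η / 2 by positivity),
    eventually_log_rpow_le (18 * 2 ^ (2 - P.β)) (4 * (2 - P.β)) hgap,
    eventually_log_pow_le 2 4 hgap2, eventually_log_pow_le 2 2 hgap3,
    eventually_log_pow_le 2 4 hτζ, eventually_log_pow_le (P.s + 1) 0 hτ1,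
    eventually_log_pow_le (P.s + 1) 0 hτ0]
    with n hn hL hθ8 hmom ht2 hexp hzt hsn hsS
  have hL1 : 1 ≤ Real.log n := by
    have : (0 : ℝ) ≤ P.s := Nat.cast_nonneg _
    linarith
  have hL0 : 0 < Real.log n := by linarith
  have hn0 : (0 : ℝ) < n := by exact_mod_cast hn
  have hn1 : (1 : ℝ) ≤ n := by exact_mod_cast hn
  simp only [pow_zero, mul_one] at hθ8 hsn hsS
  set S := P.maxSize n with hS
  set t := P.veryLargeThreshold n with ht
  set θ : ℝ := (n : ℝ) ^ (-η) with hθ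
  have hθ0 : 0 < θ := by positivity
  have hhalf : (n : ℝ) ^ (-(η / 2)) * (n : ℝ) ^ (η / 2) = 1 := by
    rw [← Real.rpow_add hn0]; simp
  have hq0 : (0 : ℝ) < (n : ℝ) ^ (-(η / 2)) := by positivity
  have hθq : 8 * θ ≤ (n : ℝ) ^ (-(η / 2)) := by
    have : θ = (n : ℝ) ^ (-(η / 2)) * (n : ℝ) ^ (-(η / 2)) := by
      rw [hθ, ← Real.rpow_add hn0]; ring_nf
    rw [this]
    have h8 : 8 * (n : ℝ) ^ (-(η / 2)) ≤ 1 := by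
      rw [← hhalf, mul_comm]
      exact mul_le_mul_of_nonneg_left hθ8 hq0.le
    calc _ = 8 * (n : ℝ) ^ (-(η / 2)) * (n : ℝ) ^ (-(η / 2)) := by ring
      _ ≤ 1 * (n : ℝ) ^ (-(η / 2)) := mul_le_mul_of_nonneg_right h8 hq0.le
      _ = _ := one_mul _
  have hq1 : (n : ℝ) ^ (-(η / 2)) ≤ 1 := Real.rpow_le_one_of_one_le_of_nonpos hn1 (by linarith)
  have hθ2 : θ ≤ 1 / 2 := by linarith
  have hSle : (S : ℝ) ≤ (n : ℝ) ^ P.τ := Nat.floor_le (by positivity)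
  have hSlt : (n : ℝ) ^ P.τ < (S + 1 : ℕ) := by exact_mod_cast Nat.lt_floor_add_one _
  have hsS' : P.s ≤ S := Nat.le_floor (by linarith)
  have hS0 : (0 : ℝ) < S := by exact_mod_cast hs1.trans hsS'
  have hnζ : 1 ≤ (n : ℝ) ^ P.ζ := Real.one_le_rpow hn1 hP.ζ_pos.le
  have ht0 : 0 ≤ t := by rw [ht, Params.veryLargeThreshold]; positivity
  have hLt : Real.log n ≤ t := by
    rw [ht, Params.veryLargeThreshold]
    have h4 : Real.log n ≤ Real.log n ^ 4 := le_self_pow₀ hL1 (by norm_num)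
    exact h4.trans (le_mul_of_one_le_left (by positivity) hnζ)
  have hst : (P.s : ℝ) ≤ t := by linarith
  have hτeq : (n : ℝ) ^ P.τ = (n : ℝ) ^ P.ζ * (n : ℝ) ^ (P.τ - P.ζ) := by
    rw [← Real.rpow_add hn0]; ring_nf
  have htS : t ≤ S := by
    have h2 : 2 * t ≤ (n : ℝ) ^ P.τ := by
      rw [hτeq, ht, Params.veryLargeThreshold]
      have := mul_le_mul_of_nonneg_left hzt (zero_le_one.trans hnζ)
      linarith
    have h3 : (1 : ℝ) ≤ t := by linarith
    push_cast at hSlt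
    linarith
  have hmoment : 9 * (⌈t⌉₊ : ℝ) ^ (2 - P.β) ≤ θ / 2 * (S + 1 : ℕ) ^ (2 - P.β) := by
    have h1 : (⌈t⌉₊ : ℝ) ≤ 2 * t := by
      have := (Nat.ceil_lt_add_one ht0).le
      linarith
    have h2 : (⌈t⌉₊ : ℝ) ^ (2 - P.β) ≤ (2 * t) ^ (2 - P.β) :=
      Real.rpow_le_rpow (Nat.cast_nonneg _) h1 hβ.le
    have h3 : (n : ℝ) ^ (P.τ * (2 - P.β)) ≤ (S + 1 : ℕ) ^ (2 - P.β) := by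
      rw [Real.rpow_mul hn0.le]
      exact Real.rpow_le_rpow (by positivity) hSlt.le hβ.le
    have h4 : (2 * t) ^ (2 - P.β) =
        2 ^ (2 - P.β) * Real.log n ^ (4 * (2 - P.β)) * (n : ℝ) ^ (P.ζ * (2 - P.β)) := by
      rw [ht, Params.veryLargeThreshold, Real.mul_rpow (by norm_num) (by positivity),
        Real.mul_rpow (by positivity) (by positivity), ← Real.rpow_mul hn0.le,
        Real.rpow_mul hL0.le]
      norm_num
      ring
    have h5 : θ * (n : ℝ) ^ (P.τ * (2 - P.β)) =
        (n : ℝ) ^ ((P.τ - P.ζ) * (2 - P.β) - η) * (n : ℝ) ^ (P.ζ * (2 - P.β)) := by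
      rw [hθ, ← Real.rpow_add hn0, ← Real.rpow_add hn0]; ring_nf
    have h6 : (0 : ℝ) < (n : ℝ) ^ (P.ζ * (2 - P.β)) := by positivity
    have h7 := mul_le_mul_of_nonneg_right hmom h6.le
    have h8 := mul_le_mul_of_nonneg_left h3 hθ0.le
    rw [← h5] at h7
    rw [h4] at h2
    linarith
  have hcomp := sizes_moment_comparison hP.β_lt hs1 hsS' hst htS hθ0.le (by linarith) hmoment
  have hpre := outer_prefix_le (n := n) hs1 hsS' hθ0.le hθ2 hcomp
  have hθn : 4 * θ * n + t ≤ (n : ℝ) ^ (-(η / 2)) * n := by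
    have h1 : 2 * t ≤ (n : ℝ) ^ (-(η / 2)) * n := by
      have h2 : (n : ℝ) ^ (-(η / 2)) * n = (n : ℝ) ^ P.ζ * (n : ℝ) ^ (1 - η / 2 - P.ζ) := by
        conv_lhs => rw [← Real.rpow_one (n : ℝ), ← Real.rpow_mul hn0.le, ← Real.rpow_add hn0]
        rw [← Real.rpow_add hn0]; ring_nf
      rw [h2, ht, Params.veryLargeThreshold]
      have := mul_le_mul_of_nonneg_left ht2 (zero_le_one.trans hnζ)
      linarith
    have h3 := mul_le_mul_of_nonneg_right hθq hn0.le
    linarith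
  have hprob : (n + 1) * Real.exp (-(θ * n / S)) ≤ Real.exp (-(Real.log n ^ 2)) := by
    have h1 : 2 * Real.log n ^ 2 ≤ θ * n / S := by
      rw [le_div_iff₀ hS0]
      have h2 : θ * n = (n : ℝ) ^ (1 - η - P.τ) * (n : ℝ) ^ P.τ := by
        rw [hθ, ← Real.rpow_add hn0]
        conv_lhs => rw [← Real.rpow_one (n : ℝ), ← Real.rpow_mul hn0.le, ← Real.rpow_add hn0]
        ring_nf
      rw [h2]
      exact mul_le_mul hexp hSle hS0.le (by positivity)
    have h2 : (n : ℝ) + 1 ≤ Real.exp (Real.log n ^ 2) := by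
      have h3 : Real.exp (Real.log n + 1) ≤ Real.exp (Real.log n ^ 2) := by
        apply Real.exp_le_exp.2
        have h4 : (2 : ℝ) ≤ Real.log n := by
          have : (0 : ℝ) ≤ P.s := Nat.cast_nonneg _
          linarith
        have h5 := mul_le_mul_of_nonneg_right h4 hL0.le
        rw [pow_two]
        linarith
      rw [Real.exp_add, Real.exp_log hn0] at h3
      have h4 := mul_le_mul_of_nonneg_left (Real.add_one_le_exp (1 : ℝ)) hn0.le
      linarith
    calc _ ≤ Real.exp (Real.log n ^ 2) * Real.exp (-(2 * Real.log n ^ 2)) :=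
          mul_le_mul h2 (Real.exp_le_exp.2 (neg_le_neg h1)) (Real.exp_pos _).le
            (Real.exp_pos _).le
      _ = _ := by rw [← Real.exp_add]; ring_nf
  refine (outer_sizeLaw_le hn hs1 hsS' hθ0.le ht0 hθn ?_).trans
    (hpre.trans (ENNReal.ofReal_le_ofReal hprob))
  have h4 : (n : ℝ) = (n : ℝ) ^ (1 - P.τ) * (n : ℝ) ^ P.τ := by
    rw [← Real.rpow_add hn0]; simp
  have h5 : (P.s + 1) * (S : ℝ) ≤ n := by
    conv_rhs => rw [h4]
    exact mul_le_mul hsn hSle hS0.le (by positivity)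
  have h6 : (P.s * S : ℝ) < n := by linarith
  exact_mod_cast h6

end ABCD

namespace ABCD
open scoped ENNReal
variable {P : Params}

/-! ### Conditions on n, and their first consequences -/

/-- The requirements on `n` under which the estimates hold. -/
structure Large (P : Params) (ε : ℝ) (n : ℕ) : Prop where
  one_le : 1 ≤ n
  log_ge : 100 * (P.tailConst + 3) ≤ Real.log n
  δ_le : P.δ ≤ P.maxDegree n
  mass_le : (n : ℝ) ^ (-ε) ≤ 1 / Real.log n ^ 8
  cutoff_le : (n : ℝ) ^ (-ε) * P.cutoff n ≤ 1 / Real.log n ^ 2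
  low_le : (n : ℝ) ^ (-ε) ≤ P.lowMass / 2
  pow_le : Real.log n ^ 8 ≤ (n : ℝ) ^ P.ζ
  tiny_le : (P.maxDegree n + 1) * Real.exp (-(Real.log n ^ 2)) ≤ 1 / Real.log n

theorem eventually_large (hP : P.Valid) {ε : ℝ} (hε : 0 < ε) : ∀ᶠ n in atTop, Large P ε n := by
  filter_upwards [eventually_ge_atTop 1, eventually_le_log (100 * (P.tailConst + 3)),
    eventually_le_maxDegree hP P.δ, eventually_log_pow_le 1 8 hε,
    eventually_log_rpow_le 1 (2 / (P.γ - 2) + 2) hε, eventually_log_pow_le (2 / P.lowMass) 0 hε,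
    eventually_log_pow_le 1 8 hP.ζ_pos, eventually_log_pow_le 1 1 one_pos]
    with n h1 h2 h3 h4 h5 h6 h7 h8
  have hC := hP.tailConst_pos
  have hL0 : 0 < Real.log n := by linarith
  have hn0 : (0 : ℝ) < n := by exact_mod_cast h1
  have hp : (0 : ℝ) < (n : ℝ) ^ ε := by positivity
  refine ⟨h1, h2, h3, ?_, ?_, ?_, ?_, ?_⟩
  · rw [Real.rpow_neg hn0.le, inv_eq_one_div]
    exact one_div_le_one_div_of_le (by positivity) (by linarith)
  · rw [Real.rpow_add hL0, Real.rpow_two, one_mul, ← Params.cutoff] at h5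
    rw [Real.rpow_neg hn0.le, le_div_iff₀ (by positivity), mul_assoc, inv_mul_le_iff₀ hp, mul_one]
    exact h5
  · rw [pow_zero, mul_one, div_le_iff₀ hP.lowMass_pos] at h6
    rw [Real.rpow_neg hn0.le, inv_le_iff_one_le_mul₀ hp]
    linarith
  · linarith
  · rw [one_mul, pow_one, Real.rpow_one] at h8
    have hn1 : (1 : ℝ) ≤ n := by exact_mod_cast h1
    have hD : (P.maxDegree n : ℝ) ≤ n := by
      refine (maxDegree_le P n).trans ?_
      conv_rhs => rw [← Real.rpow_one (n : ℝ)]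
      exact Real.rpow_le_rpow_of_exponent_le hn1 hP.ζ_lt_one.le
    have h9 : Real.exp (-(Real.log n ^ 2)) ≤ 1 / (n ^ 2 * (2 : ℝ)) := by
      have h10 : (n : ℝ) ^ 2 * 2 ≤ Real.exp (Real.log n ^ 2) := by
        have h11 : Real.exp (2 * Real.log n + 1) ≤ Real.exp (Real.log n ^ 2) :=
          Real.exp_le_exp.2 (by nlinarith)
        have h12 := Real.add_one_le_exp (1 : ℝ)
        rw [Real.exp_add, two_mul, Real.exp_add, Real.exp_log hn0, ← pow_two] at h11
        refine le_trans (mul_le_mul_of_nonneg_left ?_ (by positivity)) h11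
        linarith
      rw [Real.exp_neg, inv_eq_one_div]
      exact one_div_le_one_div_of_le (by positivity) h10
    calc _ ≤ (n + n) * (1 / (n ^ 2 * (2 : ℝ))) := by gcongr
      _ = 1 / n := by field_simp; ring
      _ ≤ _ := one_div_le_one_div_of_le hL0 h8

namespace Large
variable {ε : ℝ} {n : ℕ}

theorem log_ge_hundred (hP : P.Valid) (h : Large P ε n) : 100 ≤ Real.log n := by
  linarith [h.log_ge, hP.tailConst_pos]

theorem natCast_pos (h : Large P ε n) : (0 : ℝ) < n := by exact_mod_cast h.one_le

theorem one_le_rpow (hP : P.Valid) (h : Large P ε n) : 1 ≤ (n : ℝ) ^ P.ζ :=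
  Real.one_le_rpow (by exact_mod_cast h.one_le) hP.ζ_pos.le

theorem maxDegree_lt (hP : P.Valid) (h : Large P ε n) :
    (P.maxDegree n : ℝ) < P.veryLargeThreshold n := by
  have h1 := maxDegree_le P n
  have h2 := h.log_ge_hundred hP
  have h3 := h.one_le_rpow hP
  have h4 : 1 < Real.log n ^ 4 := one_lt_pow₀ (by linarith) (by norm_num)
  rw [Params.veryLargeThreshold]
  nlinarith

theorem meanDegree_bounds (hP : P.Valid) (h : Large P ε n) :
    1 ≤ P.meanDegree n ∧ P.meanDegree n ≤ P.tailConst :=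
  ⟨one_le_meanDegree hP h.δ_le, meanDegree_le hP h.δ_le⟩

/-- The relative error is between `1 / log n` and `1`. -/
theorem error_bounds (hP : P.Valid) (h : Large P ε n) :
    1 / Real.log n ≤ Real.log n ^ (-(P.γ - 2)) ∧ Real.log n ^ (-(P.γ - 2)) ≤ 1 := by
  have h2 := h.log_ge_hundred hP
  constructor
  · rw [one_div, ← Real.rpow_neg_one]
    exact Real.rpow_le_rpow_of_exponent_le (by linarith) (by linarith [hP.γ_lt])
  · exact Real.rpow_le_one_of_one_le_of_nonpos (by linarith) (by linarith [hP.two_lt_γ])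

end Large

/-! ### Room for the nodes, and existence of admissible assignments -/

section sizes
variable {n : ℕ} {θ : ℝ} {c : List ℕ}

/-- In `phi` the list itself is coerced to real numbers, through a monadic bind; here the cast
stands inside the map. -/
theorem phi_eq (n : ℕ) (c : List ℕ) :
    phi n c = 1 - (c.map fun x : ℕ => ((x : ℝ) / n) ^ 2).sum := by
  simp only [phi, List.bind_eq_flatMap, sub_right_inj]
  induction c with
  | nil => simp
  | cons x l ih => simpa using ih

theorem phi_nonneg (hc : c.sum = n) : 0 ≤ phi n c := by
  rw [phi_eq, sub_nonneg]
  calc (c.map fun x : ℕ => ((x : ℝ) / n) ^ 2).sum ≤ (c.map fun x : ℕ => (x : ℝ) / n).sum := by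
        refine List.sum_le_sum fun x hx => ?_
        have h1 : x ≤ n := hc ▸ List.le_sum_of_mem hx
        have h2 : (x : ℝ) / n ≤ 1 := div_le_one_of_le₀ (by exact_mod_cast h1) (Nat.cast_nonneg _)
        rw [pow_two]
        exact mul_le_of_le_one_left (by positivity) h2
    _ = ((c.sum : ℕ) : ℝ) / n := by
        clear hc
        induction c with
        | nil => simp
        | cons x l ih => rw [List.map_cons, List.sum_cons, ih, List.sum_cons]; push_cast; ring
    _ ≤ 1 := by rw [hc]; exact div_self_le_one _

theorem GoodSizes.sum_get (hc : GoodSizes P n θ c) : ∑ j, c.get j = n := by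
  rw [← hc.sum_eq]
  conv_rhs => rw [← List.ofFn_get c]
  rw [List.sum_ofFn]

theorem GoodSizes.s_le_get (hc : GoodSizes P n θ c) (j : Fin c.length) : P.s ≤ c.get j :=
  hc.s_le _ (List.get_mem c j)

theorem GoodSizes.get_pos (hP : P.Valid) (hc : GoodSizes P n θ c) (j : Fin c.length) :
    1 < c.get j := by
  have := hc.s_le_get j
  have := hP.δ_lt_s
  have := hP.one_le_δ
  omega

theorem GoodSizes.length_le (hP : P.Valid) (hc : GoodSizes P n θ c) : c.length ≤ n := by
  calc c.length = ∑ _j : Fin c.length, 1 := by simp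
    _ ≤ ∑ j, c.get j := Finset.sum_le_sum fun j _ => (hc.get_pos hP j).le
    _ = n := hc.sum_get

/-- Since ξ φ ≥ 0, the required number of places is at most w v; no finer information on φ is
needed. -/
theorem fits_of_lt (hP : P.Valid) (hc : GoodSizes P n θ c) {w : Fin n → ℕ} {v : Fin n}
    {j : Fin c.length} (h : w v < c.get j) : Fits P.ξ w c v j := by
  have h1 : ⌈(1 - P.ξ * phi n c) * (w v : ℝ)⌉ ≤ (w v : ℤ) := by
    rw [Int.ceil_le]
    push_cast
    refine mul_le_of_le_one_left (Nat.cast_nonneg _) ?_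
    have := mul_nonneg hP.ξ_pos.le (phi_nonneg hc.sum_eq)
    linarith
  rw [Fits]
  have : (w v : ℤ) < c.get j := by exact_mod_cast h
  omega

theorem smallMass_filter (t : ℝ) (c : List ℕ) :
    ((∑ j ∈ Finset.univ.filter fun j : Fin c.length => (c.get j : ℝ) < t, c.get j : ℕ) : ℝ) =
      smallMass t c := by
  rw [smallMass_eq_sum, ← Finset.sum_filter]
  push_cast
  rfl

-- A community that rejects some node has size at most D, so it is not very large, and such
-- communities have total size at most θ n.
open Classical in
theorem fits_mass_ge {ε : ℝ} (hP : P.Valid) (hl : Large P ε n) (hc : GoodSizes P n θ c)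
    {w : Fin n → ℕ} (hw : GoodDegrees P n w) (v : Fin n) :
    (1 - θ) * n ≤ (∑ j ∈ Finset.univ.filter (fun j => Fits P.ξ w c v j), c.get j : ℕ) := by
  have h1 := hc.smallMass_le
  rw [← smallMass_filter] at h1
  have h2 : n ≤ ∑ j ∈ Finset.univ.filter (fun j => Fits P.ξ w c v j), c.get j +
      ∑ j ∈ Finset.univ.filter (fun j : Fin c.length => (c.get j : ℝ) < P.veryLargeThreshold n),
        c.get j := by
    calc n = ∑ j, c.get j := hc.sum_get.symm
      _ ≤ ∑ j ∈ Finset.univ.filter (fun j => Fits P.ξ w c v j) ∪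
          Finset.univ.filter (fun j : Fin c.length => (c.get j : ℝ) < P.veryLargeThreshold n),
          c.get j := by
          refine Finset.sum_le_sum_of_subset fun j _ => ?_
          simp only [Finset.mem_union, Finset.mem_filter, Finset.mem_univ, true_and]
          by_contra hcon
          rw [not_or, not_lt] at hcon
          refine hcon.1 (fits_of_lt hP hc ?_)
          have h3 : (w v : ℝ) ≤ P.maxDegree n := by exact_mod_cast hw.le_maxDegree v
          exact_mod_cast (h3.trans_lt (hl.maxDegree_lt hP)).trans_le hcon.2
      _ ≤ _ := by
          rw [← Finset.sum_union_inter]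
          exact Nat.le_add_right _ _
  have h3 : (n : ℝ) ≤ (∑ j ∈ Finset.univ.filter (fun j => Fits P.ξ w c v j), c.get j : ℕ) +
      (∑ j ∈ Finset.univ.filter (fun j : Fin c.length => (c.get j : ℝ) < P.veryLargeThreshold n),
        c.get j : ℕ) := by exact_mod_cast h2
  linarith

-- A node barred from j has degree at least its size, so there cannot be many of them.
open Classical in
theorem not_fits_card_mul_le (hP : P.Valid) (hc : GoodSizes P n θ c) (w : Fin n → ℕ)
    (j : Fin c.length) :
    ((Finset.univ.filter fun u => ¬ Fits P.ξ w c u j).card : ℝ) * c.get j ≤ ∑ v, (w v : ℝ) := by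
  rw [← nsmul_eq_mul]
  refine (Finset.card_nsmul_le_sum _ (fun v => (w v : ℝ)) _ fun u hu => ?_).trans
    (Finset.sum_le_sum_of_subset_of_nonneg (Finset.subset_univ _) fun v _ _ => Nat.cast_nonneg _)
  rw [Finset.mem_filter] at hu
  by_contra hcon
  exact hu.2 (fits_of_lt hP hc (by exact_mod_cast not_le.1 hcon))

/-- Nodes of degree above δ are injected into the places of very large communities, and the
injection is extended to a bijection onto all places. The count works because a positive fraction of
the nodes has degree at most δ, while the other communities have only n^(1-ε) places; nodes of
degree at most δ fit anywhere, as s > δ. -/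
theorem admissible_nonempty {ε : ℝ} (hP : P.Valid) (hl : Large P ε n)
    (hc : GoodSizes P n ((n : ℝ) ^ (-ε)) c) {w : Fin n → ℕ} (hw : GoodDegrees P n w) :
    (admissible P.ξ w c).Nonempty := by
  classical
  let Q := Σ j : Fin c.length, Fin (c.get j)
  have hcard : Fintype.card (Fin n) = (Finset.univ : Finset Q).card := by
    rw [Finset.card_univ, Fintype.card_sigma]
    simp only [Fintype.card_fin]
    exact hc.sum_get.symm
  let H := Finset.univ.filter fun v : Fin n => ¬ w v ≤ P.δ
  let B := Finset.univ.filter fun q : Q => ¬ (c.get q.1 : ℝ) < P.veryLargeThreshold n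
  have hH : (H.card : ℝ) ≤ n - P.lowMass / 2 * n := by
    have h1 := hw.low_ge
    have h2 : (Finset.univ.filter fun v : Fin n => w v ≤ P.δ).card + H.card = n := by
      rw [Finset.card_filter_add_card_filter_not]; simp
    have h3 : ((Finset.univ.filter fun v : Fin n => w v ≤ P.δ).card : ℝ) + H.card = n := by
      exact_mod_cast h2
    rw [← Finset.sum_filter, Finset.sum_const, nsmul_eq_mul, mul_one] at h1
    linarith
  have hB : (n : ℝ) - (n : ℝ) ^ (-ε) * n ≤ B.card := by
    have h1 := hc.smallMass_le
    rw [← smallMass_filter] at h1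
    have h2 : B.card = ∑ j ∈ Finset.univ.filter
        (fun j : Fin c.length => ¬ (c.get j : ℝ) < P.veryLargeThreshold n), c.get j := by
      rw [Finset.card_filter, Fintype.sum_sigma, Finset.sum_filter]
      refine Finset.sum_congr rfl fun j _ => ?_
      simp
    have h3 := Finset.sum_filter_add_sum_filter_not Finset.univ
      (fun j : Fin c.length => (c.get j : ℝ) < P.veryLargeThreshold n) (fun j => c.get j)
    rw [hc.sum_get, ← h2] at h3
    have h4 : ((∑ j ∈ Finset.univ.filter (fun j : Fin c.length =>
        (c.get j : ℝ) < P.veryLargeThreshold n), c.get j : ℕ) : ℝ) + B.card = n := by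
      exact_mod_cast h3
    linarith
  have hHB : H.card ≤ B.card := by
    have h1 := mul_le_mul_of_nonneg_right hl.low_le hl.natCast_pos.le
    have : (H.card : ℝ) ≤ B.card := by linarith
    exact_mod_cast this
  obtain ⟨B', hB', hcB'⟩ := Finset.exists_subset_card_eq hHB
  let e := Finset.equivOfCardEq hcB'.symm
  have hQ : Nonempty Q := by
    have : 0 < Fintype.card Q := by
      rw [← Finset.card_univ, ← hcard, Fintype.card_fin]; exact hl.one_le
    exact Fintype.card_pos_iff.1 this
  let f : Fin n → Q := fun v => if h : v ∈ H then (e ⟨v, h⟩ : Q) else hQ.some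
  have hf : ∀ v (h : v ∈ H), f v = e ⟨v, h⟩ := fun v h => by simp only [f]; rw [dif_pos h]
  obtain ⟨g, hg⟩ := Finset.exists_equiv_extend_of_card_eq hcard (s := H) (f := f)
    (Finset.subset_univ _) (by
      intro u hu v hv huv
      rw [hf u hu, hf v hv] at huv
      have := e.injective (Subtype.ext huv)
      exact congrArg Subtype.val this)
  refine ⟨fun v => (g v : Q).1, (mem_admissible _).2 ⟨fun j => ?_, fun v => ?_⟩⟩
  · have h1 : (Finset.univ.filter fun v => (g v : Q).1 = j).card =
        (Finset.univ.filter fun q : Q => q.1 = j).card := by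
      refine Finset.card_bij (fun v _ => (g v : Q)) ?_ ?_ ?_
      · intro v hv; simpa using hv
      · intro u _ v _ h; exact g.injective (Subtype.ext h)
      · intro q hq
        refine ⟨g.symm ⟨q, Finset.mem_univ _⟩, ?_, by simp⟩
        simpa using hq
    rw [h1, Finset.card_filter, Fintype.sum_sigma, Finset.sum_eq_single j]
    · simp
    · intro i _ hi; simp [hi]
    · simp
  · by_cases hv : v ∈ H
    · have h1 : (g v : Q) ∈ B := by
        rw [hg v hv, hf v hv]
        exact hB' (e ⟨v, hv⟩).2
      have h2 := not_lt.1 (Finset.mem_filter.1 h1).2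
      have h3 : (w v : ℝ) ≤ P.maxDegree n := by exact_mod_cast hw.le_maxDegree v
      exact fits_of_lt hP hc (by exact_mod_cast (h3.trans_lt (hl.maxDegree_lt hP)).trans_le h2)
    · have h1 : w v ≤ P.δ := by simpa [H] using hv
      refine fits_of_lt hP hc ?_
      have := hc.s_le_get (g v : Q).1
      have := hP.δ_lt_s
      omega

-- Supplies the m of the switching bound. The places closed to v number at most n^(1-ε), and the
-- nodes barred from j at most a constant times n / (log n)^8, so k/m exceeds k/n by a factor at
-- most 1 + 1/(log n)².
open Classical in
theorem exists_slots {ε : ℝ} (hP : P.Valid) (hl : Large P ε n)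
    (hc : GoodSizes P n ((n : ℝ) ^ (-ε)) c) {w : Fin n → ℕ} (hw : GoodDegrees P n w)
    {j : Fin c.length} (hj : smallThreshold n ≤ c.get j) :
    ∃ m : ℕ, 0 < m ∧ (∀ v, m + (Finset.univ.filter fun u => ¬ Fits P.ξ w c u j).card ≤
      ∑ i ∈ Finset.univ.filter (fun i => Fits P.ξ w c v i), c.get i) ∧
      (c.get j : ℝ) / m * n ≤ c.get j * (1 + 1 / Real.log n ^ 2) := by
  set N := (Finset.univ.filter fun u => ¬ Fits P.ξ w c u j).card with hN
  set θ : ℝ := (n : ℝ) ^ (-ε) with hθ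
  set L := Real.log n with hL
  have hL100 := hl.log_ge_hundred hP
  have hn0 := hl.natCast_pos
  obtain ⟨hd1, hd2⟩ := hl.meanDegree_bounds hP
  have hL0 : 0 < L := by linarith
  have hcj : L ^ 8 ≤ c.get j := hj
  have hcj0 : (0 : ℝ) < c.get j := (pow_pos hL0 8).trans_le hcj
  have hL2 : 1 ≤ L ^ 2 := one_le_pow₀ (by linarith)
  have hNle : (N : ℝ) * L ^ 8 ≤ (P.tailConst + 1) * n := by
    have h1 := (mul_le_mul_of_nonneg_left hcj (Nat.cast_nonneg N)).trans
      (not_fits_card_mul_le hP hc w j)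
    have h2 := hw.sum_le
    have h3 : n / L ^ 2 ≤ n := div_le_self hn0.le hL2
    nlinarith
  have hx : θ * n + N ≤ n / (2 * L ^ 2) := by
    have h1 : θ * n * L ^ 8 ≤ n := by
      have := hl.mass_le
      rw [le_div_iff₀ (by positivity)] at this
      nlinarith
    have h2 : (θ * n + N) * L ^ 8 ≤ (P.tailConst + 2) * n := by linarith
    rw [le_div_iff₀ (by positivity)]
    have h3 : (θ * n + N) * (2 * L ^ 2) * L ^ 6 ≤ n * L ^ 6 := by
      have h4 : L ≤ L ^ 6 := le_self_pow₀ (by linarith) (by norm_num)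
      have h5 : 2 * (P.tailConst + 2) ≤ L ^ 6 := by linarith [hl.log_ge, hP.tailConst_pos]
      calc _ = 2 * ((θ * n + N) * L ^ 8) := by ring
        _ ≤ 2 * ((P.tailConst + 2) * n) := by linarith
        _ = 2 * (P.tailConst + 2) * n := by ring
        _ ≤ L ^ 6 * n := mul_le_mul_of_nonneg_right h5 hn0.le
        _ = _ := mul_comm _ _
    exact le_of_mul_le_mul_right h3 (by positivity)
  have hhalf : n / (2 * L ^ 2) ≤ n / 2 := by
    apply div_le_div_of_nonneg_left hn0.le (by norm_num); linarith
  have hN' : N ≤ ⌈(1 - θ) * (n : ℝ)⌉₊ := by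
    have h1 : (N : ℝ) ≤ ⌈(1 - θ) * (n : ℝ)⌉₊ := by
      have := Nat.le_ceil ((1 - θ) * (n : ℝ))
      linarith
    exact_mod_cast h1
  have hm : n - n / (2 * L ^ 2) ≤ ((⌈(1 - θ) * (n : ℝ)⌉₊ - N : ℕ) : ℝ) := by
    rw [Nat.cast_sub hN']
    have := Nat.le_ceil ((1 - θ) * (n : ℝ))
    linarith
  have hm0 : (0 : ℝ) < ((⌈(1 - θ) * (n : ℝ)⌉₊ - N : ℕ) : ℝ) := by linarith
  -- A lower bound on the places open to any v, minus the nodes barred from j.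
  refine ⟨⌈(1 - θ) * (n : ℝ)⌉₊ - N, by exact_mod_cast hm0, fun v => ?_, ?_⟩
  · rw [Nat.sub_add_cancel hN']
    exact Nat.ceil_le.2 (fits_mass_ge hP hl hc hw v)
  · rw [div_mul_eq_mul_div, div_le_iff₀ hm0, mul_assoc]
    refine mul_le_mul_of_nonneg_left ?_ hcj0.le
    calc (n : ℝ) ≤ (1 + 1 / L ^ 2) * (n - n / (2 * L ^ 2)) := by
          have h1 : (1 + 1 / L ^ 2) * (n - n / (2 * L ^ 2)) =
              n + n / (2 * L ^ 2) * (1 - 1 / L ^ 2) := by field_simp; ring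
          rw [h1]
          have h2 : 1 / L ^ 2 ≤ 1 := by rw [div_le_one (by positivity)]; exact hL2
          have h3 : 0 ≤ n / (2 * L ^ 2) := by positivity
          nlinarith
      _ ≤ _ := mul_le_mul_of_nonneg_left hm (by positivity)

end sizes
end ABCD

namespace ABCD
open scoped ENNReal
variable {P : Params} {n : ℕ} {ε : ℝ} {c : List ℕ} {w : Fin n → ℕ}

/-! ### The total degree of a random community -/

/-- The sum of the degrees of the nodes that an assignment puts into the community `j`. -/
noncomputable def weight {n l : ℕ} (w : Fin n → ℕ) (σ : Fin n → Fin l) (j : Fin l) : ℝ :=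
  ∑ v, if σ v = j then (w v : ℝ) else 0

theorem weight_nonneg {l : ℕ} (w : Fin n → ℕ) (σ : Fin n → Fin l) (j : Fin l) :
    0 ≤ weight w σ j :=
  Finset.sum_nonneg fun v _ => by positivity

/-- The relative error `(log n)^{-(γ-2)}`. -/
noncomputable def Params.error (P : Params) (n : ℕ) : ℝ := Real.log n ^ (-(P.γ - 2))

theorem sum_ite_const {σ : Fin n → Fin c.length} (hσ : σ ∈ admissible P.ξ w c)
    (j : Fin c.length) (x : ℝ) : (∑ v, if σ v = j then x else 0) = c.get j * x := by
  classical
  rw [← Finset.sum_filter, Finset.sum_const, nsmul_eq_mul, ((mem_admissible σ).1 hσ).1 j]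

/-- As the community has exactly `c.get j` nodes, a lower bound on its weight is an upper bound on
the sum of the nonnegative complementary weights B - min(w, B). -/
theorem weight_ge {σ : Fin n → Fin c.length} (hσ : σ ∈ admissible P.ξ w c)
    (j : Fin c.length) (B : ℝ) :
    c.get j * B - (∑ v, if σ v = j then B - min (w v : ℝ) B else 0) ≤ weight w σ j := by
  rw [← sum_ite_const hσ j B, weight, ← Finset.sum_sub_distrib]
  refine Finset.sum_le_sum fun v _ => ?_
  split_ifs
  · linarith [min_le_left (w v : ℝ) B]
  · simp

theorem weighted_degree_sums_le (hP : P.Valid) (hl : Large P ε n) (hw : GoodDegrees P n w)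
    {k p : ℝ} (hk : 0 ≤ k) (hp0 : 0 ≤ p) (hp : p * n ≤ k * (1 + 1 / Real.log n ^ 2)) :
    p * ∑ v, (w v : ℝ) ≤ k * P.meanDegree n * (1 + P.error n) ∧
    p * ∑ v, (Real.log n - min (w v : ℝ) (Real.log n)) ≤
      k * (Real.log n - P.meanDegree n + (P.tailConst + 4) * P.error n) := by
  have hL := hl.log_ge_hundred hP
  have hLC := hl.log_ge
  have hC := hP.tailConst_pos
  have hn0 := hl.natCast_pos
  obtain ⟨hd1, hd2⟩ := hl.meanDegree_bounds hP
  obtain ⟨he1, he2⟩ := hl.error_bounds hP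
  have h1 := hw.sum_le
  have h2 := hw.sum_min_log_ge
  rw [← Params.error] at he1 he2 h2
  set L := Real.log n with hLdef
  set e := P.error n
  set d := P.meanDegree n
  set C := P.tailConst
  have hL0 : 0 < L := by linarith
  have hq : 1 / L ^ 2 = (1 / L) * (1 / L) := by field_simp
  set q := 1 / L with hqdef
  have hq0 : 0 < q := by positivity
  have hq1 : q * L = 1 := by rw [hqdef]; field_simp
  have hq2 : q ≤ 1 / 100 := one_div_le_one_div_of_le (by norm_num) hL
  rw [hq] at hp
  constructor
  · have h3 : ∑ v, (w v : ℝ) ≤ n * (d + q * q) := by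
      rw [← hq]; calc _ ≤ _ := h1
        _ = _ := by ring
    have hdq : 0 ≤ d + q * q := by positivity
    calc p * ∑ v, (w v : ℝ) ≤ p * (n * (d + q * q)) := mul_le_mul_of_nonneg_left h3 hp0
      _ = p * n * (d + q * q) := by ring
      _ ≤ k * (1 + q * q) * (d + q * q) := mul_le_mul_of_nonneg_right hp hdq
      _ = k * ((1 + q * q) * (d + q * q)) := by ring
      _ ≤ k * (d * (1 + e)) := by
          refine mul_le_mul_of_nonneg_left ?_ hk
          have h4 : d + q * q ≤ d * (1 + q * q) := by nlinarith
          have h5 : (1 + q * q) * (1 + q * q) ≤ 1 + e := by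
            have a1 : q * q ≤ q * (1 / 100) := mul_le_mul_of_nonneg_left hq2 hq0.le
            have a2 : (q * q) * (q * q) ≤ (q * q) * 1 :=
              mul_le_mul_of_nonneg_left (by linarith) (by positivity)
            linarith
          calc _ ≤ (1 + q * q) * (d * (1 + q * q)) := mul_le_mul_of_nonneg_left h4 (by positivity)
            _ = d * ((1 + q * q) * (1 + q * q)) := by ring
            _ ≤ _ := mul_le_mul_of_nonneg_left h5 (by linarith)
      _ = _ := by ring
  · have h3 : ∑ v, (L - min (w v : ℝ) L) ≤ n * (L - d + (C + 2) * e) := by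
      rw [Finset.sum_sub_distrib, Finset.sum_const, Finset.card_univ, Fintype.card_fin,
        nsmul_eq_mul]
      linarith
    have he0 : 0 < e := hq0.trans_le he1
    have hA : 0 ≤ L - d + (C + 2) * e := by
      have : 0 ≤ (C + 2) * e := by positivity
      linarith
    calc _ ≤ p * (n * (L - d + (C + 2) * e)) := mul_le_mul_of_nonneg_left h3 hp0
      _ = p * n * (L - d + (C + 2) * e) := by ring
      _ ≤ k * (1 + q * q) * (L - d + (C + 2) * e) := mul_le_mul_of_nonneg_right hp hA
      _ = k * ((1 + q * q) * (L - d + (C + 2) * e)) := by ring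
      _ ≤ k * (L - d + (C + 4) * e) := by
          refine mul_le_mul_of_nonneg_left ?_ hk
          have h4 : L - d + (C + 2) * e ≤ 2 * L := by
            have : (C + 2) * e ≤ C + 2 := mul_le_of_le_one_right (by linarith) he2
            linarith
          have h5 : q * q * (L - d + (C + 2) * e) ≤ q * q * (2 * L) :=
            mul_le_mul_of_nonneg_left h4 (by positivity)
          -- The factor 1 + 1/L² acts on a main term of size L and costs at most 2/L, hence twice
          -- the error: the constant grows from C + 2 to C + 4.
          have h6 : q * q * (2 * L) = 2 * q := by
            calc q * q * (2 * L) = 2 * q * (q * L) := by ring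
              _ = _ := by rw [hq1, mul_one]
          linarith

theorem sum_weight_bounds (hP : P.Valid) (hl : Large P ε n)
    (hc : GoodSizes P n ((n : ℝ) ^ (-ε)) c) (hw : GoodDegrees P n w)
    {j : Fin c.length} (hj : smallThreshold n ≤ c.get j) :
    (∑ σ ∈ admissible P.ξ w c, weight w σ j) / (admissible P.ξ w c).card ≤
      c.get j * P.meanDegree n * (1 + P.error n) ∧
    c.get j * (P.meanDegree n - (P.tailConst + 4) * P.error n) ≤
      (∑ σ ∈ admissible P.ξ w c, weight w σ j) / (admissible P.ξ w c).card := by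
  classical
  obtain ⟨m, hm0, hm, hp⟩ := exists_slots hP hl hc hw hj
  have hcard : (0 : ℝ) < (admissible P.ξ w c).card := by
    exact_mod_cast (admissible_nonempty hP hl hc hw).card_pos
  obtain ⟨b1, b2⟩ := weighted_degree_sums_le hP hl hw (Nat.cast_nonneg (c.get j))
    (by positivity : 0 ≤ (c.get j : ℝ) / m) hp
  constructor
  · rw [div_le_iff₀ hcard]
    refine (sum_assignments_sum_le (k := c.get) (ok := Fits P.ξ w c)
      (fun σ => by convert mem_admissible σ) j m hm0 (by convert hm)
      (fun v => (w v : ℝ)) fun v => Nat.cast_nonneg _).trans ?_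
    rw [mul_comm]
    exact mul_le_mul_of_nonneg_right b1 hcard.le
  · rw [le_div_iff₀ hcard]
    have h1 := sum_assignments_sum_le (k := c.get) (ok := Fits P.ξ w c)
      (fun σ => by convert mem_admissible σ) j m hm0 (by convert hm)
      (fun v => Real.log n - min (w v : ℝ) (Real.log n)) fun v => sub_nonneg.2 (min_le_right _ _)
    have h2 := h1.trans (mul_le_mul_of_nonneg_left b2 hcard.le)
    have h3 := Finset.sum_le_sum fun σ (hσ : σ ∈ admissible P.ξ w c) =>
      weight_ge hσ j (Real.log n)
    rw [Finset.sum_sub_distrib, Finset.sum_const, nsmul_eq_mul] at h3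
    have h4 : ((admissible P.ξ w c).card : ℝ) * (c.get j * Real.log n) -
        (admissible P.ξ w c).card * (c.get j * (Real.log n - P.meanDegree n +
          (P.tailConst + 4) * P.error n)) =
        c.get j * (P.meanDegree n - (P.tailConst + 4) * P.error n) *
          (admissible P.ξ w c).card := by ring
    linarith

theorem one_div_sq_le_error_sq (hP : P.Valid) (hl : Large P ε n) :
    1 ≤ P.error n ^ 2 * Real.log n ^ 2 := by
  have hL := hl.log_ge_hundred hP
  have h := (hl.error_bounds hP).1
  rw [← Params.error, div_le_iff₀ (by linarith)] at h
  rw [← mul_pow]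
  exact one_le_pow₀ h

/-- The parameter x stands for the size of a very large community, or for the threshold n^ζ (log
n)^4 when the community is merely large. In both cases D (log n)^4 ≤ x, which compensates for single
degrees as large as D. -/
theorem outer_weight_upper (hP : P.Valid) (hl : Large P ε n)
    (hc : GoodSizes P n ((n : ℝ) ^ (-ε)) c) (hw : GoodDegrees P n w)
    {j : Fin c.length} (hj : smallThreshold n ≤ c.get j) {x : ℝ} (hjx : c.get j ≤ x)
    (hx : P.veryLargeThreshold n ≤ x) (hne : (admissible P.ξ w c).Nonempty) :
    (PMF.uniformOfFinset (admissible P.ξ w c) hne).toOuterMeasure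
      {σ | x * P.meanDegree n * (1 + P.error n) + x * P.meanDegree n * P.error n ≤ weight w σ j} ≤
      ENNReal.ofReal (Real.exp (-(Real.log n ^ 2 / 16))) := by
  classical
  obtain ⟨m, hm0, hm, hp⟩ := exists_slots hP hl hc hw hj
  have b1 := (weighted_degree_sums_le hP hl hw (Nat.cast_nonneg (c.get j))
    (by positivity : 0 ≤ (c.get j : ℝ) / m) hp).1
  have hL := hl.log_ge_hundred hP
  obtain ⟨hd1, hd2⟩ := hl.meanDegree_bounds hP
  obtain ⟨he1, he2⟩ := hl.error_bounds hP
  have heL := one_div_sq_le_error_sq hP hl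
  rw [← Params.error] at he1 he2
  have hD := hl.maxDegree_lt hP
  have hDn := maxDegree_le P n
  have hD1 : (1 : ℝ) ≤ P.maxDegree n := by exact_mod_cast hP.one_le_δ.trans hl.δ_le
  set L := Real.log n with hLdef
  set e := P.error n
  set d := P.meanDegree n
  set D : ℝ := (P.maxDegree n : ℝ)
  have hL0 : 0 < L := by linarith
  have he0 : 0 < e := lt_of_lt_of_le (by positivity) he1
  have hx0 : 0 < x := by linarith
  have hd0 : 0 < d := by linarith
  have hDx : D * L ^ 4 ≤ x := by
    refine le_trans ?_ hx
    exact mul_le_mul_of_nonneg_right hDn (by positivity)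
  have h := outer_assignments_tail (k := c.get) (ok := Fits P.ξ w c)
    (fun σ => by convert mem_admissible σ) hne j m hm0 (by convert hm)
    (fun v => (w v : ℝ)) (b := D) (μ := x * d * (1 + e)) (y := x * d * e)
    (fun v => Nat.cast_nonneg _) (fun v => Nat.cast_le.2 (hw.le_maxDegree v)) (by linarith)
    (by positivity) ?_ (by positivity) ?_
  · refine h.trans (ENNReal.ofReal_le_ofReal (Real.exp_le_exp.2 (neg_le_neg ?_)))
    rw [le_div_iff₀ (by positivity)]
    calc L ^ 2 / 16 * (4 * D * (x * d * (1 + e))) ≤ L ^ 2 / 16 * (4 * D * (x * d * 2)) := by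
          gcongr; linarith
      _ = L ^ 2 * D * x * d / 2 * 1 := by ring
      -- The error e is at least 1/L because γ < 3.
      _ ≤ L ^ 2 * D * x * d / 2 * (e ^ 2 * L ^ 2) := by gcongr
      _ = D * L ^ 4 * (x * d * e ^ 2) / 2 := by ring
      _ ≤ x * (x * d * e ^ 2) / 2 := by gcongr
      _ = x * x * d * e ^ 2 * (1 / 2) := by ring
      _ ≤ x * x * d * e ^ 2 * d := by gcongr; linarith
      _ = _ := by ring
  · refine b1.trans ?_
    gcongr
  · have : 0 ≤ x * d := by positivity
    nlinarith

/-- The upper tail for the complementary weights. These are at most log n instead of D, so already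
|C| ≥ (log n)^12 is enough. -/
theorem outer_weight_lower (hP : P.Valid) (hl : Large P ε n)
    (hc : GoodSizes P n ((n : ℝ) ^ (-ε)) c) (hw : GoodDegrees P n w)
    {j : Fin c.length} (hj : smallThreshold n ≤ c.get j)
    (hx : P.veryLargeThreshold n ≤ c.get j) (hne : (admissible P.ξ w c).Nonempty) :
    (PMF.uniformOfFinset (admissible P.ξ w c) hne).toOuterMeasure
      {σ | weight w σ j ≤ c.get j * (P.meanDegree n - (P.tailConst + 5) * P.error n)} ≤
      ENNReal.ofReal (Real.exp (-(Real.log n ^ 2 / 16))) := by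
  classical
  obtain ⟨m, hm0, hm, hp⟩ := exists_slots hP hl hc hw hj
  have b1 := (weighted_degree_sums_le hP hl hw (Nat.cast_nonneg (c.get j))
    (by positivity : 0 ≤ (c.get j : ℝ) / m) hp).2
  have hL := hl.log_ge_hundred hP
  have hLC := hl.log_ge
  have hC := hP.tailConst_pos
  obtain ⟨hd1, hd2⟩ := hl.meanDegree_bounds hP
  obtain ⟨he1, he2⟩ := hl.error_bounds hP
  have heL := one_div_sq_le_error_sq hP hl
  have hpow := hl.pow_le
  rw [← Params.error] at he1 he2
  set L := Real.log n with hLdef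
  set e := P.error n
  set d := P.meanDegree n
  set C := P.tailConst
  have hL0 : 0 < L := by linarith
  have he0 : 0 < e := lt_of_lt_of_le (by positivity) he1
  have hk : L ^ 12 ≤ c.get j := by
    refine le_trans ?_ hx
    calc L ^ 12 = L ^ 8 * L ^ 4 := by ring
      _ ≤ _ := mul_le_mul_of_nonneg_right hpow (by positivity)
  set k : ℝ := (c.get j : ℝ)
  have hk0 : 0 < k := (pow_pos hL0 12).trans_le hk
  have hce : (C + 4) * e ≤ C + 4 := mul_le_of_le_one_right (by linarith) he2
  have hce0 : 0 ≤ (C + 4) * e := by positivity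
  have hM1 : L / 2 ≤ L - d + (C + 4) * e := by linarith
  have hM2 : L - d + (C + 4) * e ≤ 2 * L := by linarith
  have hM0 : 0 < L - d + (C + 4) * e := by linarith
  have h := outer_assignments_tail (k := c.get) (ok := Fits P.ξ w c)
    (fun σ => by convert mem_admissible σ) hne j m hm0 (by convert hm)
    (fun v => L - min (w v : ℝ) L) (b := L) (μ := k * (L - d + (C + 4) * e)) (y := k * e)
    (fun v => sub_nonneg.2 (min_le_right _ _))
    (fun v => sub_le_self _ (le_min (Nat.cast_nonneg _) hL0.le)) hL0
    (by positivity) b1 (by positivity) ?_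
  · refine le_trans (outer_le_of_imp _ fun σ hσ h1 => ?_)
      (h.trans (ENNReal.ofReal_le_ofReal (Real.exp_le_exp.2 (neg_le_neg ?_))))
    · rw [PMF.mem_support_uniformOfFinset_iff] at hσ
      have h2 := (weight_ge hσ j L).trans h1.out
      simp only [Set.mem_ofPred_eq]
      linarith
    · rw [le_div_iff₀ (by positivity)]
      calc L ^ 2 / 16 * (4 * L * (k * (L - d + (C + 4) * e))) ≤
            L ^ 2 / 16 * (4 * L * (k * (2 * L))) := by gcongr
        _ = k * L ^ 4 / 2 * 1 := by ring
        _ ≤ k * L ^ 4 / 2 * (e ^ 2 * L ^ 2) := by gcongr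
        _ = k * e ^ 2 * (L ^ 6 / 2) := by ring
        _ ≤ k * e ^ 2 * k := by
            gcongr
            refine le_trans ?_ hk
            have : L ^ 6 ≤ L ^ 12 := pow_le_pow_right₀ (by linarith) (by norm_num)
            have : 0 < L ^ 6 := by positivity
            linarith
        _ = _ := by ring
  · have : k * e ≤ k * (2 * (L - d + (C + 4) * e)) := by gcongr; linarith
    linarith

/-- Valid for every admissible assignment, without randomness: at most n^(1-ε) nodes contribute at
most T each, and the excess over T, summed over all nodes, is O(n (log n)^(-2)) by the choice of the
cutoff T. -/
theorem weight_notVeryLarge_le (hP : P.Valid) (hl : Large P ε n)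
    (hc : GoodSizes P n ((n : ℝ) ^ (-ε)) c) (hw : GoodDegrees P n w)
    {σ : Fin n → Fin c.length} (hσ : σ ∈ admissible P.ξ w c) :
    (∑ v, if (c.get (σ v) : ℝ) < P.veryLargeThreshold n then (w v : ℝ) else 0) ≤
      (P.tailConst + 4) * (n / Real.log n ^ 2) := by
  classical
  have hL := hl.log_ge_hundred hP
  have hn0 := hl.natCast_pos
  have h1 := hw.sum_le
  have h2 := hw.sum_min_cutoff_ge
  have h3 := hl.cutoff_le
  have hT0 : 0 < P.cutoff n := Real.rpow_pos_of_pos (by linarith) _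
  set T := P.cutoff n
  have hcount : (∑ v, if (c.get (σ v) : ℝ) < P.veryLargeThreshold n then (1 : ℝ) else 0) ≤
      (n : ℝ) ^ (-ε) * n := by
    refine le_trans (le_of_eq ?_) hc.smallMass_le
    rw [smallMass_eq_sum, ← Finset.sum_fiberwise Finset.univ σ]
    refine Finset.sum_congr rfl fun j _ => ?_
    rw [Finset.sum_congr rfl (g := fun _ =>
      if (c.get j : ℝ) < P.veryLargeThreshold n then (1 : ℝ) else 0)]
    · rw [Finset.sum_const, ((mem_admissible σ).1 hσ).1 j, nsmul_eq_mul, mul_ite, mul_one, mul_zero]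
    · intro v hv
      rw [(Finset.mem_filter.1 hv).2]
  calc _ ≤ ∑ v, (T * (if (c.get (σ v) : ℝ) < P.veryLargeThreshold n then (1 : ℝ) else 0) +
        ((w v : ℝ) - min (w v : ℝ) T)) := by
        refine Finset.sum_le_sum fun v _ => ?_
        have h4 := min_le_left (w v : ℝ) T
        have h5 := min_le_right (w v : ℝ) T
        split_ifs <;> linarith
    _ ≤ T * ((n : ℝ) ^ (-ε) * n) + (∑ v, (w v : ℝ) - ∑ v, min (w v : ℝ) T) := by
        rw [Finset.sum_add_distrib, ← Finset.mul_sum, Finset.sum_sub_distrib]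
        gcongr
    _ ≤ n / Real.log n ^ 2 + (n / Real.log n ^ 2 + (P.tailConst + 2) * n / Real.log n ^ 2) := by
        have h4 : T * ((n : ℝ) ^ (-ε) * n) ≤ n / Real.log n ^ 2 := by
          calc T * ((n : ℝ) ^ (-ε) * n) = (n : ℝ) ^ (-ε) * T * n := by ring
            _ ≤ 1 / Real.log n ^ 2 * n := mul_le_mul_of_nonneg_right h3 hn0.le
            _ = _ := by ring
        linarith
    _ = _ := by ring

end ABCD

namespace ABCD
open scoped ENNReal

/-! ### From assignments to graphs; conditional expectations -/

section edges
variable {n : ℕ} {ξ : ℝ} {c : List ℕ} {w : Fin n → ℕ}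

/-- The law of the graph, given the assignment and the community degrees. -/
noncomputable def edgesLaw {n l : ℕ} (w : Fin n → ℕ) (σ : Fin n → Fin l) (y : Fin n → ℕ) :
    PMF (Option (Graph n l)) :=
  (configurationModel fun v => w v - y v).bind fun E₀ =>
    (independent fun j => configurationModel fun v => if σ v = j then y v else 0).map
      fun E => some ⟨σ, y, E, E₀⟩

theorem graphLawGiven_eq (h : (admissible ξ w c).Nonempty) :
    graphLawGiven ξ w c = (PMF.uniformOfFinset _ h).bind fun σ =>
      (splitLaw ξ w σ).bind fun y => edgesLaw w σ y :=
  dif_pos h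

theorem mem_support_edgesLaw {l : ℕ} {σ : Fin n → Fin l} {y : Fin n → ℕ} {x : Option (Graph n l)}
    (hx : x ∈ (edgesLaw w σ y).support) :
    ∃ G, x = some G ∧ G.label = σ ∧ G.communityDegree = y ∧ Compatible w G := by
  simp only [edgesLaw, PMF.mem_support_bind_iff, PMF.mem_support_map_iff] at hx
  obtain ⟨E₀, hE₀, E, hE, rfl⟩ := hx
  exact ⟨_, rfl, rfl, rfl, hE₀, fun j => mem_support_of_independent hE j⟩

theorem mean_edgesLaw {l : ℕ} {σ : Fin n → Fin l} {y : Fin n → ℕ} {F : Option (Graph n l) → ℝ≥0∞}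
    {k : ℝ≥0∞}
    (h : ∀ G, G.label = σ → G.communityDegree = y → Compatible w G → F (some G) = k) :
    mean (edgesLaw w σ y) F = k := by
  rw [← mean_const (edgesLaw w σ y) k]
  refine mean_congr fun x hx => ?_
  obtain ⟨G, rfl, h1, h2, h3⟩ := mem_support_edgesLaw hx
  exact h G h1 h2 h3

/-- The total mass of a nonnegative function under the law of an experiment that may fail. -/
noncomputable def total {α : Type} (p : PMF (Option α)) (f : α → ℝ) : ℝ≥0∞ :=
  mean p fun x => x.elim 0 fun a => ENNReal.ofReal (f a)

theorem total_eq_tsum {α : Type} (p : PMF (Option α)) (f : α → ℝ) :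
    total p f = ∑' a, p (some a) * ENNReal.ofReal (f a) := by
  rw [total, mean, ← (Option.some_injective α).tsum_eq]
  · rfl
  · intro x hx
    cases x with
    | none => simp at hx
    | some a => exact ⟨a, rfl⟩

theorem expectation_eq {α : Type} (p : PMF (Option α)) {f : α → ℝ} (hf : ∀ a, 0 ≤ f a) :
    expectation p f = (total p f).toReal / (total p fun _ => 1).toReal := by
  have h1 : ∀ a, p (some a) ≠ ∞ := fun a => p.apply_ne_top _
  rw [expectation, total_eq_tsum, total_eq_tsum, ENNReal.tsum_toReal_eq, ENNReal.tsum_toReal_eq]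
  · congr 1
    · exact tsum_congr fun a => by rw [ENNReal.toReal_mul, ENNReal.toReal_ofReal (hf a)]
    · exact tsum_congr fun a => by simp
  · intro a; exact ENNReal.mul_ne_top (h1 a) ENNReal.ofReal_ne_top
  · intro a; exact ENNReal.mul_ne_top (h1 a) ENNReal.ofReal_ne_top

theorem total_one_le {α : Type} (p : PMF (Option α)) : total p (fun _ => 1) ≤ 1 := by
  rw [← mean_const p 1]
  refine mean_mono fun x _ => ?_
  cases x <;> simp

/-- Conditioning on success divides by a number in [z, 1], so only the upper bound has to pay for
it. -/
theorem expectation_bounds {α : Type} {p : PMF (Option α)} {f : α → ℝ} (hf : ∀ a, 0 ≤ f a)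
    {lo hi z : ℝ} (hlo : ENNReal.ofReal lo ≤ total p f) (hhi : total p f ≤ ENNReal.ofReal hi)
    (hhi0 : 0 ≤ hi) (hz : 0 < z) (hz1 : ENNReal.ofReal z ≤ total p fun _ => 1) :
    lo ≤ expectation p f ∧ expectation p f ≤ hi / z := by
  have hZ1 := total_one_le p
  have hZtop : total p (fun _ => 1) ≠ ∞ := (hZ1.trans_lt ENNReal.one_lt_top).ne
  have hNtop : total p f ≠ ∞ := (hhi.trans_lt ENNReal.ofReal_lt_top).ne
  have a1 : z ≤ (total p fun _ => 1).toReal := (ENNReal.ofReal_le_iff_le_toReal hZtop).1 hz1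
  have a2 : (total p fun _ => 1).toReal ≤ 1 := by
    simpa using ENNReal.toReal_mono ENNReal.one_ne_top hZ1
  have a3 : lo ≤ (total p f).toReal := (ENNReal.ofReal_le_iff_le_toReal hNtop).1 hlo
  have a4 : (total p f).toReal ≤ hi := by
    simpa [ENNReal.toReal_ofReal hhi0] using ENNReal.toReal_mono ENNReal.ofReal_ne_top hhi
  rw [expectation_eq p hf]
  constructor
  · rw [le_div_iff₀ (hz.trans_le a1)]
    rcases le_total 0 lo with h | h
    · exact (mul_le_of_le_one_right h a2).trans a3
    · exact (mul_nonpos_of_nonpos_of_nonneg h (hz.le.trans a1)).trans ENNReal.toReal_nonneg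
  · exact div_le_div₀ hhi0 a4 hz a1

/-- For functions determined by the assignment and the community degrees, such as volumes of
communities, the pairings integrate out. -/
theorem total_graphLawGiven (h : (admissible ξ w c).Nonempty) (f : Graph n c.length → ℝ)
    (H : (Fin n → Fin c.length) → (Fin n → ℕ) → ℝ)
    (hH : ∀ σ ∈ admissible ξ w c, ∀ y ∈ (splitLaw ξ w σ).support, ∀ G : Graph n c.length,
      G.label = σ → G.communityDegree = y → Compatible w G → f G = H σ y) :
    total (graphLawGiven ξ w c) f = mean (PMF.uniformOfFinset _ h) fun σ =>
      mean (splitLaw ξ w σ) fun y => ENNReal.ofReal (H σ y) := by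
  rw [total, graphLawGiven_eq h, mean_bind]
  refine mean_congr fun σ hσ => ?_
  rw [mean_bind]
  refine mean_congr fun y hy => mean_edgesLaw fun G h1 h2 h3 => ?_
  rw [PMF.mem_support_uniformOfFinset_iff] at hσ
  rw [Option.elim_some, hH σ hσ y hy G h1 h2 h3]

theorem cast_volC_community {l : ℕ} (G : Graph n l) (j : Fin l) :
    (G.volC (G.community j) : ℝ) =
      ∑ v, if G.label v = j then (G.communityDegree v : ℝ) else 0 := by
  rw [Graph.volC, Graph.community, Finset.sum_filter]
  push_cast
  exact Finset.sum_congr rfl fun v _ => by split_ifs <;> simp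

theorem card_community {G : Graph n c.length} (hG : G.label ∈ admissible ξ w c)
    (j : Fin c.length) : (G.community j).card = c.get j := by
  rw [Graph.community, ← ((mem_admissible _).1 hG).1 j]

end edges

/-! ### Realized degrees and crude volume bounds -/

section degrees
variable {P : Params} {n : ℕ} {θ : ℝ} {c : List ℕ} {w : Fin n → ℕ}

/-- At most one node has degree 0, while every community has at least s ≥ 2 nodes. -/
theorem exists_pos_degree (hP : P.Valid) (hc : GoodSizes P n θ c) (hw : GoodDegrees P n w)
    {σ : Fin n → Fin c.length} (hσ : σ ∈ admissible P.ξ w c) (j : Fin c.length) :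
    ∃ u, σ u = j ∧ 1 ≤ w u := by
  classical
  by_contra hcon
  push Not at hcon
  have h1 : (Finset.univ.filter fun v => σ v = j).card ≤ 1 := by
    refine Finset.card_le_one.2 fun u hu v hv => hw.zeros u v ?_ ?_
    · have := hcon u (by simpa using hu); omega
    · have := hcon v (by simpa using hv); omega
  rw [((mem_admissible σ).1 hσ).1 j] at h1
  have := hc.get_pos hP j
  omega

theorem communityDegree_le_of_support (hP : P.Valid) {l : ℕ} {σ : Fin n → Fin l}
    {y : Fin n → ℕ} (hy : y ∈ (splitLaw P.ξ w σ).support) (v : Fin n) : y v ≤ w v + 1 := by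
  obtain ⟨R, hR, coin, rfl⟩ := mem_support_splitLaw hy
  exact (communityDegrees_le ⟨hP.ξ_pos, hP.ξ_lt_one⟩ hR coin v).1

/-- The leader has the largest degree of its community, hence a positive one. So community degrees
never exceed degrees, community sums are even, and all configuration models are exact. -/
theorem degree_eq_of_good (hP : P.Valid) (hc : GoodSizes P n θ c) (hw : GoodDegrees P n w)
    {G : Graph n c.length} (hσ : G.label ∈ admissible P.ξ w c)
    (hy : G.communityDegree ∈ (splitLaw P.ξ w G.label).support) (hG : Compatible w G) (v : Fin n) :
    G.degree v = w v := by
  have hξ : 0 < P.ξ ∧ P.ξ < 1 := ⟨hP.ξ_pos, hP.ξ_lt_one⟩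
  obtain ⟨R, hR, coin, hyR⟩ := mem_support_splitLaw hy
  refine hG.degree_eq hw.even_sum (fun v => ?_) (fun j => ?_) v
  · by_cases h : leader w (Finset.univ.filter fun u => G.label u = G.label v) = some v
    · rw [hyR]
      refine (communityDegrees_le hξ hR coin v).2 ?_
      obtain ⟨u, hu, hu1⟩ := exists_pos_degree hP hc hw hσ (G.label v)
      obtain ⟨v₀, h1, h2, h3⟩ := exists_leader w
        (⟨u, by simpa using hu⟩ : (Finset.univ.filter fun u => G.label u = G.label v).Nonempty)
      rw [h] at h2
      rw [Option.some.inj h2]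
      exact hu1.trans (h3 u (by simpa using hu))
    · rw [hyR]
      simp only [communityDegrees]
      rw [if_neg]
      · exact rounding_le hξ hR v
      · intro h2; exact h (by convert h2)
  · rw [hyR]
    exact even_communityDegrees hξ R coin j fun v _ => exists_pos_degree hP hc hw hσ j

theorem cast_vol_eq_weight (hP : P.Valid) (hc : GoodSizes P n θ c) (hw : GoodDegrees P n w)
    {G : Graph n c.length} (hσ : G.label ∈ admissible P.ξ w c)
    (hy : G.communityDegree ∈ (splitLaw P.ξ w G.label).support) (hG : Compatible w G)
    (j : Fin c.length) : (G.vol (G.community j) : ℝ) = weight w G.label j := by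
  rw [Graph.vol, Graph.community, Finset.sum_filter, weight]
  push_cast
  exact Finset.sum_congr rfl fun v _ => by
    rw [degree_eq_of_good hP hc hw hσ hy hG v]

theorem le_maxDegree_of_mem_support (hP : P.Valid) (hD : P.δ ≤ P.maxDegree n)
    (hw : w ∈ (degreeLaw P n).support) (v : Fin n) : w v ≤ P.maxDegree n := by
  rw [degreeLaw, PMF.mem_support_map_iff] at hw
  obtain ⟨u, hu, rfl⟩ := hw
  exact (fixParity_le u v).trans (Finset.mem_Icc.1
    (mem_Icc_of_mem_support_powerLaw hP.one_le_δ hD (mem_support_of_independent hu v))).2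

theorem crude_volume_bounds (hP : P.Valid) {D : ℕ} (hwD : ∀ v, w v ≤ D)
    {G : Graph n c.length} (hσ : G.label ∈ admissible P.ξ w c)
    (hy : G.communityDegree ∈ (splitLaw P.ξ w G.label).support) (hG : Compatible w G)
    (j : Fin c.length) :
    G.vol (G.community j) ≤ c.get j * (D + 1) ∧ G.volC (G.community j) ≤ c.get j * (D + 1) := by
  have h1 : ∀ v, G.communityDegree v ≤ w v + 1 := communityDegree_le_of_support hP hy
  rw [← card_community hσ j, ← smul_eq_mul]
  exact ⟨Finset.sum_le_card_nsmul _ _ _ fun v _ =>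
      (hG.degree_le (h1 v)).trans (Nat.succ_le_succ (hwD v)),
    Finset.sum_le_card_nsmul _ _ _ fun v _ => (h1 v).trans (Nat.succ_le_succ (hwD v))⟩

theorem total_graphLawGiven_le (hP : P.Valid) {D : ℕ} (hwD : ∀ v, w v ≤ D)
    (j : Fin c.length) (f : Graph n c.length → ℝ)
    (hf : ∀ G : Graph n c.length, f G ≤ max (G.vol (G.community j)) (G.volC (G.community j))) :
    total (graphLawGiven P.ξ w c) f ≤ ENNReal.ofReal (c.get j * (D + 1)) := by
  set k := ENNReal.ofReal (c.get j * (D + 1)) with hk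
  by_cases h : (admissible P.ξ w c).Nonempty
  · rw [total, graphLawGiven_eq h, mean_bind, ← mean_const (PMF.uniformOfFinset _ h) k]
    refine mean_mono fun σ hσ => ?_
    rw [PMF.mem_support_uniformOfFinset_iff] at hσ
    rw [mean_bind, ← mean_const (splitLaw P.ξ w σ) k]
    refine mean_mono fun y hy => ?_
    rw [← mean_const (edgesLaw w σ y) k]
    refine mean_mono fun x hx => ?_
    obtain ⟨G, rfl, rfl, rfl, hG⟩ := mem_support_edgesLaw hx
    obtain ⟨h1, h2⟩ := crude_volume_bounds hP hwD hσ hy hG j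
    rw [Option.elim_some, hk]
    exact ENNReal.ofReal_le_ofReal ((hf G).trans (by exact_mod_cast max_le h1 h2))
  · rw [total, graphLawGiven, dif_neg h, mean_pure]
    simp

end degrees
end ABCD

namespace ABCD
open scoped ENNReal
variable {P : Params} {n : ℕ} {ε : ℝ} {c : List ℕ} {w : Fin n → ℕ}

/-! ### Expected volumes -/

/-- The implied constant for the expectations, given the degrees. -/
noncomputable def Params.baseConst (P : Params) : ℝ := P.tailConst + 5 + 3 / (1 - P.ξ)

theorem total_one_graphLawGiven (h : (admissible P.ξ w c).Nonempty) :
    total (graphLawGiven P.ξ w c) (fun _ => 1) = 1 := by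
  rw [total_graphLawGiven h (fun _ => 1) (fun _ _ => 1) fun _ _ _ _ _ _ _ _ => rfl]
  simp [mean_const]

theorem smallThreshold_pos (hP : P.Valid) (hl : Large P ε n) : 0 < smallThreshold n := by
  have := hl.log_ge_hundred hP
  exact pow_pos (by linarith) 8

/-- Lets the additive leader error 2 be absorbed in the relative error, as |C| ≥ (log n)^8 and the
error is at least 1 / log n. -/
theorem two_le_error_mul (hP : P.Valid) (hl : Large P ε n) {k : ℝ} (hk : smallThreshold n ≤ k) :
    2 ≤ k * P.error n := by
  have hL := hl.log_ge_hundred hP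
  have h1 := (hl.error_bounds hP).1
  rw [← Params.error] at h1
  have hk0 := (smallThreshold_pos hP hl).trans_le hk
  have h2 : Real.log n ^ 8 * (1 / Real.log n) = Real.log n ^ 7 := by
    have : Real.log n ≠ 0 := by linarith
    field_simp
  calc (2 : ℝ) ≤ Real.log n := by linarith
    _ ≤ Real.log n ^ 7 := le_self_pow₀ (by linarith) (by norm_num)
    _ = Real.log n ^ 8 * (1 / Real.log n) := h2.symm
    _ ≤ k * P.error n := mul_le_mul hk h1 (by positivity) hk0.le

theorem total_vol_bounds (hP : P.Valid) (hl : Large P ε n)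
    (hc : GoodSizes P n ((n : ℝ) ^ (-ε)) c) (hw : GoodDegrees P n w)
    {j : Fin c.length} (hj : smallThreshold n ≤ c.get j) :
    ENNReal.ofReal (P.meanDegree n * c.get j * (1 - P.baseConst * P.error n)) ≤
      total (graphLawGiven P.ξ w c) (fun G => G.vol (G.community j)) ∧
    total (graphLawGiven P.ξ w c) (fun G => G.vol (G.community j)) ≤
      ENNReal.ofReal (P.meanDegree n * c.get j * (1 + P.baseConst * P.error n)) := by
  have hne := admissible_nonempty hP hl hc hw
  obtain ⟨b1, b2⟩ := sum_weight_bounds hP hl hc hw hj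
  obtain ⟨hd1, hd2⟩ := hl.meanDegree_bounds hP
  have hL := hl.log_ge_hundred hP
  have he1 := (hl.error_bounds hP).1
  rw [← Params.error] at he1
  have he0 : 0 < P.error n := lt_of_lt_of_le (by positivity) he1
  have hC := hP.tailConst_pos
  have hr : 0 < 3 / (1 - P.ξ) := div_pos (by norm_num) (by linarith [hP.ξ_lt_one])
  have hk0 : (0 : ℝ) ≤ c.get j := Nat.cast_nonneg _
  rw [total_graphLawGiven hne _ (fun σ _ => weight w σ j)]
  · simp only [mean_const]
    rw [mean_uniformOfFinset hne _ fun σ _ => weight_nonneg w σ j]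
    constructor
    · refine ENNReal.ofReal_le_ofReal (le_trans ?_ b2)
      have h1 : (c.get j : ℝ) * ((P.tailConst + 4) * P.error n) ≤
          c.get j * (P.meanDegree n * (P.baseConst * P.error n)) := by
        refine mul_le_mul_of_nonneg_left ?_ hk0
        have h2 : (P.tailConst + 4) * P.error n ≤ P.baseConst * P.error n :=
          mul_le_mul_of_nonneg_right (by rw [Params.baseConst]; linarith) he0.le
        have h3 : 0 ≤ P.baseConst * P.error n :=
          mul_nonneg (by rw [Params.baseConst]; linarith) he0.le
        exact h2.trans (le_mul_of_one_le_left h3 hd1)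
      linarith
    · refine ENNReal.ofReal_le_ofReal (b1.trans ?_)
      rw [mul_comm (c.get j : ℝ)]
      refine mul_le_mul_of_nonneg_left ?_ (by positivity)
      have : 1 * P.error n ≤ P.baseConst * P.error n :=
        mul_le_mul_of_nonneg_right (by rw [Params.baseConst]; linarith) he0.le
      linarith
  · rintro σ hσ y hy G rfl rfl hG
    exact cast_vol_eq_weight hP hc hw hσ hy hG j

theorem total_volC_bounds (hP : P.Valid) (hl : Large P ε n)
    (hc : GoodSizes P n ((n : ℝ) ^ (-ε)) c) (hw : GoodDegrees P n w)
    {j : Fin c.length} (hj : smallThreshold n ≤ c.get j) :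
    ENNReal.ofReal ((1 - P.ξ) * P.meanDegree n * c.get j * (1 - P.baseConst * P.error n)) ≤
      total (graphLawGiven P.ξ w c) (fun G => G.volC (G.community j)) ∧
    total (graphLawGiven P.ξ w c) (fun G => G.volC (G.community j)) ≤
      ENNReal.ofReal ((1 - P.ξ) * P.meanDegree n * c.get j * (1 + P.baseConst * P.error n)) := by
  have hne := admissible_nonempty hP hl hc hw
  obtain ⟨b1, b2⟩ := sum_weight_bounds hP hl hc hw hj
  obtain ⟨hd1, hd2⟩ := hl.meanDegree_bounds hP
  have hξ : 0 < P.ξ ∧ P.ξ < 1 := ⟨hP.ξ_pos, hP.ξ_lt_one⟩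
  have hξ1 : 0 < 1 - P.ξ := by linarith
  have hC := hP.tailConst_pos
  have htwo := two_le_error_mul hP hl hj
  have hL := hl.log_ge_hundred hP
  have he1 := (hl.error_bounds hP).1
  rw [← Params.error] at he1
  have he0 : 0 < P.error n := lt_of_lt_of_le (by positivity) he1
  have hk0 : (0 : ℝ) ≤ c.get j := Nat.cast_nonneg _
  set A := (∑ σ ∈ admissible P.ξ w c, weight w σ j) / (admissible P.ξ w c).card with hA
  have hA0 : 0 ≤ A := div_nonneg (Finset.sum_nonneg fun σ _ => weight_nonneg w σ j)
    (Nat.cast_nonneg _)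
  have hmean : mean (PMF.uniformOfFinset (admissible P.ξ w c) hne)
      (fun σ => ENNReal.ofReal ((1 - P.ξ) * weight w σ j)) = ENNReal.ofReal ((1 - P.ξ) * A) := by
    rw [mean_uniformOfFinset hne _ fun σ _ => mul_nonneg hξ1.le (weight_nonneg w σ j),
      ← Finset.mul_sum, mul_div_assoc]
  -- The term 3/(1-ξ) of the constant is there to absorb the leader error 2 ≤ |C| e in a main term
  -- carrying the factor 1 - ξ.
  have hB : (1 - P.ξ) * P.baseConst = (1 - P.ξ) * (P.tailConst + 5) + 3 := by
    rw [Params.baseConst]; field_simp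
  have hdk : (c.get j : ℝ) * P.error n ≤ P.meanDegree n * (c.get j * P.error n) :=
    le_mul_of_one_le_left (by positivity) hd1
  rw [total_graphLawGiven hne _ (fun σ y => ∑ v, if σ v = j then (y v : ℝ) else 0)]
  · constructor
    · refine le_trans (ENNReal.ofReal_le_ofReal (q := (1 - P.ξ) * A - 2) ?_) ?_
      · have h1 := mul_le_mul_of_nonneg_left b2 hξ1.le
        have h2 : (1 - P.ξ) * P.meanDegree n * c.get j * (1 - P.baseConst * P.error n) =
            (1 - P.ξ) * (P.meanDegree n * c.get j) - (1 - P.ξ) * P.baseConst *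
              (P.meanDegree n * (c.get j * P.error n)) := by ring
        rw [h2, hB]
        have h3 : (1 - P.ξ) * (P.tailConst + 4) * (c.get j * P.error n) ≤
            (1 - P.ξ) * (P.tailConst + 5) * (P.meanDegree n * (c.get j * P.error n)) := by
          refine mul_le_mul ?_ hdk (by positivity) (by positivity)
          exact mul_le_mul_of_nonneg_left (by linarith) hξ1.le
        linarith
      · rw [ENNReal.ofReal_sub _ (by norm_num), tsub_le_iff_right, ← hmean,
          ← mean_const (PMF.uniformOfFinset (admissible P.ξ w c) hne) (ENNReal.ofReal 2),
          ← mean_add]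
        refine mean_mono fun σ _ => ?_
        rw [← tsub_le_iff_right, ← ENNReal.ofReal_sub _ (by norm_num)]
        exact (mean_splitLaw_bounds hξ j).2
    · refine le_trans ?_ (ENNReal.ofReal_le_ofReal (p := (1 - P.ξ) * A + 2) ?_)
      · rw [ENNReal.ofReal_add (mul_nonneg hξ1.le hA0) (by norm_num), ← hmean,
          ← mean_const (PMF.uniformOfFinset (admissible P.ξ w c) hne) (ENNReal.ofReal 2),
          ← mean_add]
        refine mean_mono fun σ _ => ?_
        rw [← ENNReal.ofReal_add (mul_nonneg hξ1.le (weight_nonneg w σ j)) (by norm_num)]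
        exact (mean_splitLaw_bounds hξ j).1
      · have h1 := mul_le_mul_of_nonneg_left b1 hξ1.le
        have h2 : (1 - P.ξ) * P.meanDegree n * c.get j * (1 + P.baseConst * P.error n) =
            (1 - P.ξ) * (P.meanDegree n * c.get j) + (1 - P.ξ) * P.baseConst *
              (P.meanDegree n * (c.get j * P.error n)) := by ring
        rw [h2, hB]
        have h3 : (1 - P.ξ) * 1 * (P.meanDegree n * (c.get j * P.error n)) ≤
            (1 - P.ξ) * (P.tailConst + 5) * (P.meanDegree n * (c.get j * P.error n)) := by
          refine mul_le_mul_of_nonneg_right ?_ (by positivity)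
          exact mul_le_mul_of_nonneg_left (by linarith) hξ1.le
        linarith
  · rintro σ hσ y hy G rfl rfl hG
    exact cast_volC_community G j

theorem expectedVolumes_given (hP : P.Valid) (hl : Large P ε n)
    (hc : GoodSizes P n ((n : ℝ) ^ (-ε)) c) (hw : GoodDegrees P n w) :
    P.ExpectedVolumes P.baseConst n c (graphLawGiven P.ξ w c) := by
  intro j hj
  obtain ⟨hd1, hd2⟩ := hl.meanDegree_bounds hP
  have hξ1 : 0 < 1 - P.ξ := by linarith [hP.ξ_lt_one]
  have hC := hP.tailConst_pos
  have hL := hl.log_ge_hundred hP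
  have hB : 0 ≤ P.baseConst := by rw [Params.baseConst]; positivity
  have he : 0 ≤ P.error n := Real.rpow_nonneg (by linarith) _
  have h1 : ENNReal.ofReal 1 ≤ total (graphLawGiven P.ξ w c) fun _ => 1 := by
    rw [total_one_graphLawGiven (admissible_nonempty hP hl hc hw)]; simp
  obtain ⟨a1, a2⟩ := total_vol_bounds hP hl hc hw hj
  obtain ⟨a3, a4⟩ := total_volC_bounds hP hl hc hw hj
  have e1 := expectation_bounds (fun G : Graph n c.length => Nat.cast_nonneg _) a1 a2
    (by positivity) one_pos h1
  have e2 := expectation_bounds (fun G : Graph n c.length => Nat.cast_nonneg _) a3 a4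
    (by positivity) one_pos h1
  rw [div_one] at e1 e2
  rw [Params.Approx, Params.Approx, ← Params.error, abs_le, abs_le]
  refine ⟨⟨?_, ?_⟩, ?_, ?_⟩ <;> linarith [e1.1, e1.2, e2.1, e2.2]

/-- The implied constant for the expectations, given the community sizes. -/
noncomputable def Params.sizesConst (P : Params) : ℝ := 4 * (P.baseConst + 1 / (1 - P.ξ)) + 4

/-- Typical degree sequences give M (1 ± B e). The others have probability at most q = exp(-(log
n)²) and contribute at most |C| (D+1) q ≤ |C| e; the hypothesis `hM` turns this into an error
relative to M. Normalizing by the success probability costs a factor 1/(1-q). -/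
theorem approx_of_total_bounds (hP : P.Valid) (hl : Large P ε n)
    (hdeg : (degreeLaw P n).toOuterMeasure {w | GoodDegrees P n w}ᶜ ≤
      ENNReal.ofReal (Real.exp (-(Real.log n ^ 2))))
    (hc : GoodSizes P n ((n : ℝ) ^ (-ε)) c) {j : Fin c.length} {M : ℝ}
    (hM : (1 - P.ξ) * c.get j ≤ M) {f : Graph n c.length → ℝ} (hf0 : ∀ G, 0 ≤ f G)
    (hf : ∀ G : Graph n c.length, f G ≤ max (G.vol (G.community j)) (G.volC (G.community j)))
    (hgood : ∀ w, GoodDegrees P n w →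
      ENNReal.ofReal (M * (1 - P.baseConst * P.error n)) ≤ total (graphLawGiven P.ξ w c) f ∧
      total (graphLawGiven P.ξ w c) f ≤ ENNReal.ofReal (M * (1 + P.baseConst * P.error n))) :
    P.Approx P.sizesConst n (expectation (graphLawGivenSizes P n c) f) M := by
  have hξ1 : 0 < 1 - P.ξ := by linarith [hP.ξ_lt_one]
  have hC := hP.tailConst_pos
  have hL := hl.log_ge_hundred hP
  obtain ⟨he1, he2⟩ := hl.error_bounds hP
  rw [← Params.error] at he1 he2
  have htiny := hl.tiny_le
  have hexp := Real.exp_pos (-(Real.log n ^ 2))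
  set q := Real.exp (-(Real.log n ^ 2)) with hq
  have he0 : 0 < P.error n := lt_of_lt_of_le (by positivity) he1
  set e := P.error n with he
  have hr0 : 0 < 1 / (1 - P.ξ) := by positivity
  set r := 1 / (1 - P.ξ) with hr
  have hB : 1 ≤ P.baseConst := by
    have : 0 < 3 / (1 - P.ξ) := by positivity
    rw [Params.baseConst]; linarith
  set B := P.baseConst with hBdef
  have hk : (1 : ℝ) < c.get j := by exact_mod_cast hc.get_pos hP j
  have hM0 : 0 < M := lt_of_lt_of_le (by positivity) hM
  have hD1 : (1 : ℝ) ≤ P.maxDegree n := by exact_mod_cast hP.one_le_δ.trans hl.δ_le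
  have hqe : 2 * q ≤ e := by nlinarith
  have htot : ∀ g : Graph n c.length → ℝ, total (graphLawGivenSizes P n c) g =
      mean (degreeLaw P n) fun w => total (graphLawGiven P.ξ w c) g := fun g => by
    rw [total, graphLawGivenSizes, mean_bind]; rfl
  have hgoodprob : ∀ (g : Graph n c.length → ℝ) (lo : ℝ), (∀ w, GoodDegrees P n w →
      ENNReal.ofReal lo ≤ total (graphLawGiven P.ξ w c) g) →
      ENNReal.ofReal (lo * (1 - q)) ≤ total (graphLawGivenSizes P n c) g := by
    intro g lo h
    classical
    have h1 := one_sub_le_outer (degreeLaw P n) hexp.le hdeg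
    have h2 : ENNReal.ofReal (1 - q) ≤
        (degreeLaw P n).toOuterMeasure {w | GoodDegrees P n w} :=
      (ENNReal.ofReal_le_iff_le_toReal
        ((outer_le_one _ _).trans_lt ENNReal.one_lt_top).ne).2 h1
    rcases le_total lo 0 with hlo | hlo
    · rw [ENNReal.ofReal_of_nonpos (mul_nonpos_of_nonpos_of_nonneg hlo (by linarith))]
      exact zero_le
    rw [ENNReal.ofReal_mul hlo, htot]
    refine (mul_le_mul_right h2 _).trans ?_
    rw [toOuterMeasure_eq_mean, ← mean_const_mul]
    refine mean_mono fun w _ => ?_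
    split_ifs with hw
    · rw [mul_one]; exact h w hw
    · rw [mul_zero]; exact zero_le
  have hlo := hgoodprob f _ fun w hw => (hgood w hw).1
  have hz := hgoodprob (fun _ => 1) 1 fun w hw => by
    rw [total_one_graphLawGiven (admissible_nonempty hP hl hc hw)]; simp
  rw [one_mul] at hz
  have hhi : total (graphLawGivenSizes P n c) f ≤
      ENNReal.ofReal (M * (1 + B * e) + c.get j * (P.maxDegree n + 1) * q) := by
    rw [htot, ENNReal.ofReal_add (by positivity) (by positivity),
      ENNReal.ofReal_mul (by positivity) (q := q)]
    refine (mean_le_add {w | GoodDegrees P n w} (fun w _ hw => (hgood w hw).2) fun w hw =>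
      total_graphLawGiven_le hP (le_maxDegree_of_mem_support hP hl.δ_le hw) j f hf).trans ?_
    exact add_le_add_right (mul_le_mul_right hdeg _) _
  obtain ⟨b1, b2⟩ := expectation_bounds hf0 hlo hhi (by positivity) (by linarith) hz
  have hcrude : c.get j * (P.maxDegree n + 1) * q ≤ M * (r * e) := by
    calc c.get j * (P.maxDegree n + 1) * q = c.get j * ((P.maxDegree n + 1) * q) := by ring
      _ ≤ c.get j * e := mul_le_mul_of_nonneg_left (htiny.trans he1) (by linarith)
      _ = (1 - P.ξ) * c.get j * (r * e) := by rw [hr]; field_simp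
      _ ≤ M * (r * e) := mul_le_mul_of_nonneg_right hM (by positivity)
  have hS : P.sizesConst = 4 * (B + r) + 4 := rfl
  rw [Params.Approx, ← Params.error, ← he, hS, abs_le]
  constructor
  · have h1 : M * (1 - (B + 1) * e) ≤ M * (1 - B * e) * (1 - q) := by
      rw [mul_assoc]
      refine mul_le_mul_of_nonneg_left ?_ hM0.le
      have : 0 ≤ B * e * q := by positivity
      linarith
    have h2 : (B + 1) * e * M ≤ (4 * (B + r) + 4) * e * M :=
      mul_le_mul_of_nonneg_right (mul_le_mul_of_nonneg_right (by linarith) he0.le) hM0.le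
    linarith
  · have h1 : (M * (1 + B * e) + c.get j * (P.maxDegree n + 1) * q) / (1 - q) ≤
        M * (1 + (4 * (B + r) + 4) * e) := by
      rw [div_le_iff₀ (by linarith)]
      refine le_trans (b := M * (1 + (B + r) * e)) (by linarith) ?_
      rw [mul_assoc]
      refine mul_le_mul_of_nonneg_left ?_ hM0.le
      -- With q ≤ 1/2 at least half of the enlarged constant survives the factor 1 - q, and 2 q ≤ e
      -- covers the main term.
      have h3 : (4 * (B + r) + 4) * e * q ≤ (4 * (B + r) + 4) * e * (1 / 2) := by
        gcongr; linarith
      have h4 : 0 ≤ (B + r) * e := mul_nonneg (by linarith) he0.le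
      linarith
    linarith

theorem expectedVolumes_givenSizes (hP : P.Valid) (hl : Large P ε n)
    (hdeg : (degreeLaw P n).toOuterMeasure {w | GoodDegrees P n w}ᶜ ≤
      ENNReal.ofReal (Real.exp (-(Real.log n ^ 2))))
    (hc : GoodSizes P n ((n : ℝ) ^ (-ε)) c) :
    P.ExpectedVolumes P.sizesConst n c (graphLawGivenSizes P n c) := by
  intro j hj
  obtain ⟨hd1, hd2⟩ := hl.meanDegree_bounds hP
  have hξ0 := hP.ξ_pos
  have hξ1 : 0 < 1 - P.ξ := by linarith [hP.ξ_lt_one]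
  have hk : (0 : ℝ) ≤ c.get j := Nat.cast_nonneg _
  constructor
  · refine approx_of_total_bounds hP hl hdeg hc (j := j) ?_ (fun G => Nat.cast_nonneg _)
      (fun G => Nat.cast_le.2 (le_max_left _ _)) fun w hw => total_vol_bounds hP hl hc hw hj
    exact mul_le_mul_of_nonneg_right (by linarith) hk
  · refine approx_of_total_bounds hP hl hdeg hc (j := j) ?_ (fun G => Nat.cast_nonneg _)
      (fun G => Nat.cast_le.2 (le_max_right _ _)) fun w hw => total_volC_bounds hP hl hc hw hj
    exact mul_le_mul_of_nonneg_right (le_mul_of_one_le_right hξ1.le hd1) hk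

end ABCD

namespace ABCD
open scoped ENNReal

/-! ### Simultaneous volume bounds -/

theorem outer_compl_forall_le {α : Type} (μ : PMF α) {l : ℕ} {good : Fin l → α → Prop} {b : ℝ≥0∞}
    (h : ∀ j, μ.toOuterMeasure {a | ¬ good j a} ≤ b) :
    μ.toOuterMeasure {a | ∀ j, good j a}ᶜ ≤ l * b := by
  have h1 : {a | ∀ j, good j a}ᶜ = ⋃ j, {a | ¬ good j a} := by ext a; simp
  rw [h1]
  refine (MeasureTheory.measure_iUnion_fintype_le _ _).trans ?_
  simpa using Finset.sum_le_sum fun j (_ : j ∈ Finset.univ) => h j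

variable {P : Params} {n : ℕ} {ε : ℝ} {c : List ℕ} {w : Fin n → ℕ}

/-- The volumes of all communities, and of the union of those that are not very large, are as
expected, up to the constant `K`. -/
def Params.GoodVolumes (P : Params) (K : ℝ) {n l : ℕ} (G : Graph n l) : Prop :=
  (∀ j : Fin l,
    (P.veryLargeThreshold n ≤ (G.community j).card →
      P.Approx K n (G.vol (G.community j)) (P.meanDegree n * (G.community j).card) ∧
      P.Approx K n (G.volC (G.community j))
        ((1 - P.ξ) * P.meanDegree n * (G.community j).card)) ∧
    (smallThreshold n ≤ (G.community j).card →
      (G.community j).card < P.veryLargeThreshold n →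
      (G.vol (G.community j) : ℝ) ≤ K * ((n : ℝ) ^ P.ζ * Real.log n ^ 4)) ∧
    ((G.community j).card < smallThreshold n →
      G.vol (G.community j) ≤ P.maxDegree n * (G.community j).card ∧
      (P.maxDegree n : ℝ) * (G.community j).card < (n : ℝ) ^ P.ζ * Real.log n ^ 8)) ∧
  (G.vol (P.notVeryLarge G) : ℝ) ≤ K * (n / Real.log n ^ 2)

/-- The total degree of the community `j` is typical. -/
def GoodWeight (P : Params) {n : ℕ} (w : Fin n → ℕ) (c : List ℕ) (σ : Fin n → Fin c.length)
    (j : Fin c.length) : Prop :=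
  (P.veryLargeThreshold n ≤ c.get j →
    weight w σ j ≤ c.get j * P.meanDegree n * (1 + 2 * P.error n) ∧
    c.get j * (P.meanDegree n - (P.tailConst + 5) * P.error n) ≤ weight w σ j) ∧
  (smallThreshold n ≤ c.get j → c.get j < P.veryLargeThreshold n →
    weight w σ j ≤ P.veryLargeThreshold n * P.meanDegree n * (1 + 2 * P.error n))

/-- The total community degree of the community `j` is typical. -/
def GoodSplit (P : Params) {n : ℕ} (w : Fin n → ℕ) (c : List ℕ) (σ : Fin n → Fin c.length)
    (j : Fin c.length) (y : Fin n → ℕ) : Prop :=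
  P.veryLargeThreshold n ≤ c.get j →
    |(∑ v, if σ v = j then (y v : ℝ) else 0) - (1 - P.ξ) * weight w σ j| ≤
      c.get j / Real.log n + 2

theorem smallThreshold_le (hP : P.Valid) (hl : Large P ε n) :
    smallThreshold n ≤ P.veryLargeThreshold n := by
  have hL := hl.log_ge_hundred hP
  have h1 : 1 ≤ Real.log n ^ 4 := one_le_pow₀ (by linarith)
  have h2 := hl.one_le_rpow hP
  exact hl.pow_le.trans (le_mul_of_one_le_right (by linarith) h1)

theorem outer_not_goodWeight_le (hP : P.Valid) (hl : Large P ε n)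
    (hc : GoodSizes P n ((n : ℝ) ^ (-ε)) c) (hw : GoodDegrees P n w)
    (hne : (admissible P.ξ w c).Nonempty) (j : Fin c.length) :
    (PMF.uniformOfFinset (admissible P.ξ w c) hne).toOuterMeasure {σ | ¬ GoodWeight P w c σ j} ≤
      2 * ENNReal.ofReal (Real.exp (-(Real.log n ^ 2 / 16))) := by
  have ht := smallThreshold_le hP hl
  rw [two_mul]
  by_cases h1 : P.veryLargeThreshold n ≤ c.get j
  · refine le_trans ?_ ((MeasureTheory.measure_union_le _ _).trans (add_le_add
      (outer_weight_upper hP hl hc hw (ht.trans h1) le_rfl h1 hne)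
      (outer_weight_lower hP hl hc hw (ht.trans h1) h1 hne)))
    refine outer_le_of_imp _ fun σ _ hσ => ?_
    by_contra hcon
    simp only [Set.mem_union, Set.mem_ofPred_eq, not_or, not_le] at hcon
    exact hσ ⟨fun _ => ⟨by linarith [hcon.1], hcon.2.le⟩, fun _ h => absurd h1 h.not_ge⟩
  · by_cases h2 : smallThreshold n ≤ c.get j
    · refine le_trans ?_ ((outer_weight_upper hP hl hc hw h2 (not_le.1 h1).le le_rfl hne).trans
        le_self_add)
      refine outer_le_of_imp _ fun σ _ hσ => ?_
      by_contra hcon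
      rw [Set.mem_ofPred_eq, not_le] at hcon
      exact hσ ⟨fun h => absurd h h1, fun _ _ => by linarith⟩
    · have h3 : {σ | ¬ GoodWeight P w c σ j} = ∅ :=
        Set.eq_empty_of_forall_notMem fun σ hσ =>
          hσ ⟨fun h => absurd h h1, fun h => absurd h h2⟩
      rw [h3]
      simp

theorem outer_not_goodSplit_le (hP : P.Valid) (hl : Large P ε n)
    {σ : Fin n → Fin c.length} (hσ : σ ∈ admissible P.ξ w c) (j : Fin c.length) :
    (splitLaw P.ξ w σ).toOuterMeasure {y | ¬ GoodSplit P w c σ j y} ≤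
      2 * ENNReal.ofReal (Real.exp (-(Real.log n ^ 2 / 16))) := by
  have hL := hl.log_ge_hundred hP
  by_cases h1 : P.veryLargeThreshold n ≤ c.get j
  · have hs := (smallThreshold_le hP hl).trans h1
    have hk := (smallThreshold_pos hP hl).trans_le hs
    rw [smallThreshold] at hs
    have hcard := sum_ite_const hσ j 1
    rw [mul_one] at hcard
    have hL0 : 0 < Real.log n := by linarith
    have hle : (c.get j : ℝ) / Real.log n ≤ 2 * c.get j := by
      rw [div_le_iff₀ hL0]
      nlinarith
    refine le_trans ?_ ((outer_splitLaw_le (w := w) ⟨hP.ξ_pos, hP.ξ_lt_one⟩ j hk hcard.le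
      (by positivity : 0 ≤ (c.get j : ℝ) / Real.log n) hle).trans ?_)
    · refine outer_le_of_imp _ fun y _ hy => ?_
      by_contra hcon
      rw [Set.mem_ofPred_eq, not_le] at hcon
      exact hy fun _ => hcon.le
    · rw [ENNReal.ofReal_mul two_pos.le, ENNReal.ofReal_ofNat]
      refine mul_le_mul_right (ENNReal.ofReal_le_ofReal (Real.exp_le_exp.2 (neg_le_neg ?_))) _
      -- Deviations of size |C| / log n have exponent |C| / (4 (log n)²), ample since |C| ≥ (log
      -- n)^8.
      have h2 : ((c.get j : ℝ) / Real.log n) ^ 2 / (4 * c.get j) =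
          c.get j / (4 * Real.log n ^ 2) := by
        field_simp
      rw [h2, le_div_iff₀ (by positivity)]
      have h3 : Real.log n ^ 4 ≤ Real.log n ^ 8 :=
        pow_le_pow_right₀ (by linarith) (by norm_num)
      have h4 : 0 ≤ Real.log n ^ 4 := by positivity
      calc Real.log n ^ 2 / 16 * (4 * Real.log n ^ 2) = Real.log n ^ 4 / 4 := by ring
        _ ≤ (c.get j : ℝ) := by linarith
  · have h3 : {y | ¬ GoodSplit P w c σ j y} = ∅ :=
      Set.eq_empty_of_forall_notMem fun y hy => hy fun h => absurd h h1
    rw [h3]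
    simp

theorem cast_vol_notVeryLarge (hP : P.Valid) {θ : ℝ} (hc : GoodSizes P n θ c)
    (hw : GoodDegrees P n w) {G : Graph n c.length} (hσ : G.label ∈ admissible P.ξ w c)
    (hy : G.communityDegree ∈ (splitLaw P.ξ w G.label).support) (hG : Compatible w G) :
    (G.vol (P.notVeryLarge G) : ℝ) =
      ∑ v, if (c.get (G.label v) : ℝ) < P.veryLargeThreshold n then (w v : ℝ) else 0 := by
  classical
  have h1 : P.notVeryLarge G =
      Finset.univ.filter fun v => (c.get (G.label v) : ℝ) < P.veryLargeThreshold n := by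
    ext v
    simp only [Params.notVeryLarge, Finset.mem_biUnion, Finset.mem_filter, Finset.mem_univ,
      true_and, card_community hσ]
    simp [Graph.community]
  rw [Graph.vol, h1, Finset.sum_filter]
  push_cast
  exact Finset.sum_congr rfl fun v _ => by rw [degree_eq_of_good hP hc hw hσ hy hG v]

/-- The deterministic half of part (b): once weights and splittings are typical, all volume bounds
follow without further randomness. -/
theorem goodVolumes (hP : P.Valid) (hl : Large P ε n)
    (hc : GoodSizes P n ((n : ℝ) ^ (-ε)) c) (hw : GoodDegrees P n w)
    {G : Graph n c.length} (hσ : G.label ∈ admissible P.ξ w c)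
    (hy : G.communityDegree ∈ (splitLaw P.ξ w G.label).support) (hG : Compatible w G)
    (hgw : ∀ j, GoodWeight P w c G.label j)
    (hgs : ∀ j, GoodSplit P w c G.label j G.communityDegree) :
    P.GoodVolumes P.sizesConst G := by
  have hL := hl.log_ge_hundred hP
  have hC := hP.tailConst_pos
  have hξ0 := hP.ξ_pos
  have hξ1 : 0 < 1 - P.ξ := by linarith [hP.ξ_lt_one]
  obtain ⟨hd1, hd2⟩ := hl.meanDegree_bounds hP
  obtain ⟨he1, he2⟩ := hl.error_bounds hP
  rw [← Params.error] at he1 he2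
  have he0 : 0 < P.error n := lt_of_lt_of_le (by positivity) he1
  have hr : 0 < 1 / (1 - P.ξ) := by positivity
  have hB : P.baseConst = P.tailConst + 5 + 3 * (1 / (1 - P.ξ)) := by
    rw [Params.baseConst]; ring
  have hK : P.baseConst ≤ P.sizesConst := by rw [Params.sizesConst]; linarith
  have hK3 : 3 * P.tailConst ≤ P.sizesConst := by rw [Params.sizesConst]; linarith
  have hK4 : P.tailConst + 4 ≤ P.sizesConst := by rw [Params.sizesConst]; linarith
  have hD := maxDegree_le P n
  have hpos := hl.one_le_rpow hP
  refine ⟨fun j => ⟨fun h => ?_, fun h1 h2 => ?_, fun h => ?_⟩, ?_⟩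
  · rw [card_community hσ] at h ⊢
    obtain ⟨u1, u2⟩ := (hgw j).1 h
    have u3 := hgs j h
    rw [← cast_volC_community] at u3
    have hs := (smallThreshold_le hP hl).trans h
    have hk := (smallThreshold_pos hP hl).trans_le hs
    have h2e := two_le_error_mul hP hl hs
    have hLe : (c.get j : ℝ) / Real.log n ≤ c.get j * P.error n := by
      rw [div_eq_mul_one_div]
      exact mul_le_mul_of_nonneg_left he1 hk.le
    have hke : 0 < c.get j * P.error n := by positivity
    have hked : c.get j * P.error n ≤ P.meanDegree n * (c.get j * P.error n) :=
      le_mul_of_one_le_left hke.le hd1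
    set k : ℝ := (c.get j : ℝ)
    set e := P.error n with he
    set d := P.meanDegree n
    set W := weight w G.label j with hW
    have hwd : |W - d * k| ≤ (P.tailConst + 5) * (d * (k * e)) := by
      have a1 : (P.tailConst + 5) * (k * e) ≤ (P.tailConst + 5) * (d * (k * e)) :=
        mul_le_mul_of_nonneg_left hked (by linarith)
      have a2 : 2 * (d * (k * e)) ≤ (P.tailConst + 5) * (d * (k * e)) :=
        mul_le_mul_of_nonneg_right (by linarith) (by linarith)
      rw [abs_le]
      constructor <;> linarith
    have hdke : 0 ≤ d * (k * e) := by linarith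
    constructor
    · rw [Params.Approx, ← Params.error, ← he, cast_vol_eq_weight hP hc hw hσ hy hG, ← hW]
      have a3 : (P.tailConst + 5) * (d * (k * e)) ≤ P.sizesConst * (d * (k * e)) :=
        mul_le_mul_of_nonneg_right (by linarith) hdke
      linarith
    · rw [Params.Approx, ← Params.error, ← he]
      have b1 : |(1 - P.ξ) * W - (1 - P.ξ) * d * k| ≤
          (1 - P.ξ) * ((P.tailConst + 5) * (d * (k * e))) := by
        rw [mul_assoc (1 - P.ξ) d k, ← mul_sub, abs_mul, abs_of_pos hξ1]
        exact mul_le_mul_of_nonneg_left hwd hξ1.le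
      have b2 := abs_sub_le (G.volC (G.community j) : ℝ) ((1 - P.ξ) * W) ((1 - P.ξ) * d * k)
      have b3 : (1 - P.ξ) * P.baseConst = (1 - P.ξ) * (P.tailConst + 5) + 3 := by
        rw [hB]; field_simp
      have b4 : (1 - P.ξ) * P.baseConst * (d * (k * e)) ≤
          (1 - P.ξ) * P.sizesConst * (d * (k * e)) := by gcongr
      rw [b3] at b4
      linarith
  · rw [card_community hσ] at h1 h2
    rw [cast_vol_eq_weight hP hc hw hσ hy hG]
    refine ((hgw j).2 h1 h2).trans ?_
    rw [← Params.veryLargeThreshold]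
    have ht : 0 ≤ P.veryLargeThreshold n := by rw [Params.veryLargeThreshold]; positivity
    calc P.veryLargeThreshold n * P.meanDegree n * (1 + 2 * P.error n) ≤
          P.veryLargeThreshold n * P.tailConst * 3 := by gcongr; linarith
      _ = 3 * P.tailConst * P.veryLargeThreshold n := by ring
      _ ≤ P.sizesConst * P.veryLargeThreshold n := mul_le_mul_of_nonneg_right hK3 ht
  · constructor
    · rw [Graph.vol, mul_comm, ← smul_eq_mul]
      refine Finset.sum_le_card_nsmul _ _ _ fun v _ => ?_
      rw [degree_eq_of_good hP hc hw hσ hy hG]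
      exact hw.le_maxDegree v
    · refine (mul_le_mul_of_nonneg_right hD (Nat.cast_nonneg _)).trans_lt ?_
      exact mul_lt_mul_of_pos_left h (by linarith)
  · rw [cast_vol_notVeryLarge hP hc hw hσ hy hG]
    refine (weight_notVeryLarge_le hP hl hc hw hσ).trans ?_
    exact mul_le_mul_of_nonneg_right hK4 (by positivity)

/-- A union bound over at most n communities, each charged with twice exp(-(log n)²/16) for its
weight and again for its splitting; hence the factor 4 n. -/
theorem outer_graphLawGiven_le (hP : P.Valid) (hl : Large P ε n)
    (hc : GoodSizes P n ((n : ℝ) ^ (-ε)) c) (hw : GoodDegrees P n w) :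
    (graphLawGiven P.ξ w c).toOuterMeasure
      {x | ∃ G, x = some G ∧ P.GoodVolumes P.sizesConst G}ᶜ ≤
      ENNReal.ofReal (4 * n * Real.exp (-(Real.log n ^ 2 / 16))) := by
  have hne := admissible_nonempty hP hl hc hw
  set b := ENNReal.ofReal (Real.exp (-(Real.log n ^ 2 / 16))) with hb
  have hlen : (c.length : ℝ≥0∞) * (2 * b) ≤ n * (2 * b) := by
    gcongr
    exact hc.length_le hP
  rw [graphLawGiven_eq hne]
  refine (outer_bind_le (b := 0 + n * (2 * b)) {σ | ∀ j, GoodWeight P w c σ j} fun σ hσ hgw =>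
    (outer_bind_le (b := 0) {y | ∀ j, GoodSplit P w c σ j y} fun y hy hgs => ?_).trans ?_).trans
    ((add_le_add_right ((outer_compl_forall_le _ fun j =>
      outer_not_goodWeight_le hP hl hc hw hne j).trans hlen) _).trans ?_)
  · rw [nonpos_iff_eq_zero, PMF.toOuterMeasure_apply_eq_zero_iff, Set.disjoint_left]
    intro x hx hbad
    obtain ⟨G, rfl, rfl, rfl, hG⟩ := mem_support_edgesLaw hx
    rw [PMF.mem_support_uniformOfFinset_iff] at hσ
    exact hbad ⟨G, rfl, goodVolumes hP hl hc hw hσ hy hG hgw hgs⟩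
  · rw [PMF.mem_support_uniformOfFinset_iff] at hσ
    exact add_le_add_right ((outer_compl_forall_le _ fun j =>
      outer_not_goodSplit_le hP hl hσ j).trans hlen) _
  · rw [ENNReal.ofReal_mul (by positivity), ENNReal.ofReal_mul (by norm_num),
      ENNReal.ofReal_natCast, ENNReal.ofReal_ofNat, ← hb]
    apply le_of_eq
    ring

theorem outer_sequencesLaw_le {θ : ℝ} {b : ℝ≥0∞}
    (hdeg : (degreeLaw P n).toOuterMeasure {w | GoodDegrees P n w}ᶜ ≤ b)
    (hsize : (sizeLaw P n).toOuterMeasure {x | ∃ c, x = some c ∧ GoodSizes P n θ c}ᶜ ≤ b) :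
    (sequencesLaw P n).toOuterMeasure
      {x | GoodDegrees P n x.1 ∧ ∃ c, x.2 = some c ∧ GoodSizes P n θ c}ᶜ ≤ b + b := by
  rw [sequencesLaw]
  refine (outer_bind_le {w | GoodDegrees P n w} fun w _ hw => ?_).trans (add_le_add_right hdeg b)
  rw [PMF.toOuterMeasure_map_apply]
  refine le_trans (PMF.toOuterMeasure_mono _ fun x hx => ?_) hsize
  exact fun hx' => hx.1 ⟨hw, hx'⟩

theorem outer_graphLaw_le (hP : P.Valid) (hl : Large P ε n) {b : ℝ≥0∞}
    (hseq : (sequencesLaw P n).toOuterMeasure {x | GoodDegrees P n x.1 ∧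
      ∃ c, x.2 = some c ∧ GoodSizes P n ((n : ℝ) ^ (-ε)) c}ᶜ ≤ b) :
    (graphLaw P n).toOuterMeasure {x | ∃ (l : ℕ) (G : Graph n l), x = some ⟨l, G⟩ ∧
      P.GoodVolumes P.sizesConst G}ᶜ ≤
      ENNReal.ofReal (4 * n * Real.exp (-(Real.log n ^ 2 / 16))) + b := by
  rw [graphLaw]
  refine (outer_bind_le {x | GoodDegrees P n x.1 ∧
    ∃ c, x.2 = some c ∧ GoodSizes P n ((n : ℝ) ^ (-ε)) c} ?_).trans (add_le_add_right hseq _)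
  rintro ⟨w, _⟩ _ ⟨hw, c, rfl, hc⟩
  refine le_trans ?_ (outer_graphLawGiven_le hP hl hc hw)
  dsimp only
  rw [PMF.toOuterMeasure_map_apply]
  refine PMF.toOuterMeasure_mono _ fun x hx => ?_
  rintro ⟨G, rfl, hG⟩
  exact hx.1 ⟨_, G, rfl, hG⟩

/-- With n = exp L and L ≥ 100, one factor exp L absorbs the constant 6, and 2 L - L²/16 ≤ -L²/64.
-/
theorem tail_sum_le (hP : P.Valid) (hl : Large P ε n) :
    4 * n * Real.exp (-(Real.log n ^ 2 / 16)) +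
      (Real.exp (-(Real.log n ^ 2)) + Real.exp (-(Real.log n ^ 2))) ≤
      Real.exp (-(1 / 64 * Real.log n ^ 2)) := by
  have hL := hl.log_ge_hundred hP
  have hn : (n : ℝ) = Real.exp (Real.log n) := (Real.exp_log hl.natCast_pos).symm
  set L := Real.log n
  have h1 := Real.add_one_le_exp L
  have h2 : Real.exp (-L ^ 2) ≤ Real.exp L * Real.exp (-(L ^ 2 / 16)) := by
    rw [← Real.exp_add]
    exact Real.exp_le_exp.2 (by nlinarith)
  have h3 : Real.exp L * (Real.exp L * Real.exp (-(L ^ 2 / 16))) ≤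
      Real.exp (-(1 / 64 * L ^ 2)) := by
    rw [← Real.exp_add, ← Real.exp_add]
    exact Real.exp_le_exp.2 (by nlinarith)
  have h4 : 6 * (Real.exp L * Real.exp (-(L ^ 2 / 16))) ≤
      Real.exp L * (Real.exp L * Real.exp (-(L ^ 2 / 16))) :=
    mul_le_mul_of_nonneg_right (by linarith) (by positivity)
  rw [hn]
  linarith

theorem Params.ExpectedVolumes.mono {K K' : ℝ} (hP : P.Valid) (hl : Large P ε n) (h : K ≤ K')
    {law : PMF (Option (Graph n c.length))} (hE : P.ExpectedVolumes K n c law) :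
    P.ExpectedVolumes K' n c law := by
  have hL := hl.log_ge_hundred hP
  have hd : 0 ≤ P.meanDegree n := by linarith [(hl.meanDegree_bounds hP).1]
  have hξ1 : 0 ≤ 1 - P.ξ := by linarith [hP.ξ_lt_one]
  have hL0 : 0 ≤ Real.log n := by linarith
  refine fun j hj => ⟨(hE j hj).1.trans ?_, (hE j hj).2.trans ?_⟩ <;> gcongr

end ABCD

/-! ### The theorem -/

theorem mainTheorem5 (P : ABCD.Params)
    (hγ : 2 < P.γ ∧ P.γ < 3)
    (hδ : 1 ≤ P.δ)
    (hζ : 0 < P.ζ ∧ P.ζ ≤ 1 / (P.γ - 1))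
    (hβ : 1 < P.β ∧ P.β < 2)
    (hs : P.δ + 1 ≤ P.s)
    (hτ : P.ζ < P.τ ∧ P.τ < 1)
    (hξ : 0 < P.ξ ∧ P.ξ < 1) :
    ∃ K : ℝ,
      -- expected volumes, the degrees and the community sizes being given
      ABCD.WithExtremeProbability (ABCD.sequencesLaw P) (fun n => {x | ∃ c : List ℕ,
        x.2 = some c ∧ (ABCD.admissible P.ξ x.1 c).Nonempty ∧
        P.ExpectedVolumes K n c (ABCD.graphLawGiven P.ξ x.1 c)}) ∧
      -- expected volumes, only the community sizes being given
      ABCD.WithExtremeProbability (ABCD.sizeLaw P) (fun n => {x | ∃ c : List ℕ,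
        x = some c ∧ P.ExpectedVolumes K n c (ABCD.graphLawGivenSizes P n c)}) ∧
      -- volumes of all communities, and of the union of those that are not very large
      ABCD.WithExtremeProbability (ABCD.graphLaw P) (fun n => {x | ∃ (l : ℕ) (G : ABCD.Graph n l),
        x = some ⟨l, G⟩ ∧
        (∀ j : Fin l,
          (P.veryLargeThreshold n ≤ (G.community j).card →
            P.Approx K n (G.vol (G.community j)) (P.meanDegree n * (G.community j).card) ∧
            P.Approx K n (G.volC (G.community j))
              ((1 - P.ξ) * P.meanDegree n * (G.community j).card)) ∧
          (ABCD.smallThreshold n ≤ (G.community j).card →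
            (G.community j).card < P.veryLargeThreshold n →
            (G.vol (G.community j) : ℝ) ≤ K * ((n : ℝ) ^ P.ζ * Real.log n ^ 4)) ∧
          ((G.community j).card < ABCD.smallThreshold n →
            G.vol (G.community j) ≤ P.maxDegree n * (G.community j).card ∧
            (P.maxDegree n : ℝ) * (G.community j).card < (n : ℝ) ^ P.ζ * Real.log n ^ 8)) ∧
        (G.vol (P.notVeryLarge G) : ℝ) ≤ K * (n / Real.log n ^ 2)})
      := by
  have hP : P.Valid := ⟨hγ.1, hγ.2, hδ, hζ.1, hτ.1.trans hτ.2, hβ.1, hβ.2, hs, hτ.1, hτ.2,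
    hξ.1, hξ.2⟩
  obtain ⟨ε, hε, hsize⟩ := ABCD.exists_eventually_goodSizes hP
  have hev := (hsize.and (ABCD.eventually_goodDegrees hP)).and (ABCD.eventually_large hP hε)
  have hK : P.baseConst ≤ P.sizesConst := by
    have := hP.tailConst_pos
    have h1 : 0 < 1 / (1 - P.ξ) := by have := hξ.2; exact one_div_pos.2 (by linarith)
    have h2 : P.baseConst = P.tailConst + 5 + 3 * (1 / (1 - P.ξ)) := by
      rw [ABCD.Params.baseConst]; ring
    rw [ABCD.Params.sizesConst]; linarith
  refine ⟨P.sizesConst, ⟨1 / 64, by norm_num, ?_⟩, ⟨1 / 64, by norm_num, ?_⟩,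
    ⟨1 / 64, by norm_num, ?_⟩⟩ <;>
    filter_upwards [hev] with n hn <;> obtain ⟨⟨hs, hd⟩, hl⟩ := hn <;>
    refine ABCD.one_sub_le_outer _ (Real.exp_pos _).le ?_ <;>
    have htail := ABCD.tail_sum_le hP hl <;>
    have hexp := (Real.exp_pos (-(Real.log n ^ 2))).le <;>
    have hexp' : 0 ≤ 4 * n * Real.exp (-(Real.log n ^ 2 / 16)) := by positivity
  · refine le_trans ?_ ((ABCD.outer_sequencesLaw_le hd hs).trans ?_)
    · refine ABCD.outer_le_of_imp _ fun x _ hx => fun ⟨hw, c, hxc, hc⟩ => hx ⟨c, hxc,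
        ABCD.admissible_nonempty hP hl hc hw,
        (ABCD.expectedVolumes_given hP hl hc hw).mono hP hl hK⟩
    · rw [← ENNReal.ofReal_add hexp hexp]
      exact ENNReal.ofReal_le_ofReal (by linarith)
  · refine le_trans ?_ (hs.trans (ENNReal.ofReal_le_ofReal (by linarith)))
    exact ABCD.outer_le_of_imp _ fun x _ hx => fun ⟨c, hxc, hc⟩ => hx ⟨c, hxc,
      ABCD.expectedVolumes_givenSizes hP hl hd hc⟩
  · refine (ABCD.outer_graphLaw_le hP hl (ABCD.outer_sequencesLaw_le hd hs)).trans ?_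
    rw [← ENNReal.ofReal_add hexp hexp, ← ENNReal.ofReal_add hexp' (by linarith)]
    exact ENNReal.ofReal_le_ofReal htail
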